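/- Let $F$ be an arbitrary field, $K$ an étale quadratic $F$-algebra, $B$ an Azumaya $K$-algebra of constant rank $9$ over $K$, and $\tau$ a unitary involution of $B$ trivial on $F$, i.e. an $F$-linear anti-automorphism of $B$ with $\tau^2=\mathrm{id}$ such that the set of elements of $K$ fixed by $\tau$ is $F$. Put $\operatorname{Sym}(B,\tau)=\{b\in B:\tau(b)=b\}$. (1) For every right ideal $I\subset B$ of constant rank $3$ over $K$, the $F$-subspace $(I\cdot\tau I)\cap\operatorname{Sym}(B,\tau)$ of $\operatorname{Sym}(B,\tau)$ is $1$-dimensional, where $I\cdot\tau I$ is the span of the products $x\,\tau(y)$ with $x,y\in I$. (2) Let $R_{K/F}\operatorname{SB}(B)$ be the Weil restriction of the Severi–Brauer variety $\operatorname{SB}(B)$; its points over a commutative $F$-algebra $R$ are the right ideals of $B_R=R\otimes_F B$ that are direct summands of constant rank $3$ over $K\otimes_F R$. Let $\mathbb P(\operatorname{Sym}(B,\tau))$ be the projective space of lines in $\operatorname{Sym}(B,\tau)$; its $R$-points are the direct summands of rank $1$ of $R\otimes_F\operatorname{Sym}(B,\tau)$, viewed inside $B_R$. Both are varieties (separated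 schemes of finite type) over $F$, and the rule $I\mapsto (I\cdot\tau_R I)\cap\operatorname{Sym}(B_R,\tau_R)$, for all $R$ and all $R$-points $I$ (with $\tau_R=\mathrm{id}_R\otimes\tau$), defines a closed embedding of varieties $$s_{B,\tau}:R_{K/F}\operatorname{SB}(B)\to\mathbb P(\operatorname{Sym}(B,\tau)).$$ (3) After splitting, $s_{B,\tau}$ becomes the Segre embedding. Precisely, let $R$ be a commutative $F$-algebra and $\varphi$ an isomorphism of $R$-algebras with involution from $(B_R,\tau_R)$ to $M_3(R)\times M_3(R)$ with the exchange involution $(a,b)\mapsto(b^t,a^t)$. Then there is a bijection $I\mapsto(U,W)$ from the $R$-points of $R_{K/F}\operatorname{SB}(B)$ to the pairs of rank one direct summands of $R^3$ (the $R$-points of $\mathbb P^2\times\mathbb P^2$) such that $\varphi(I)$ is the set of pairs $(a,b)$ of matrices with all columns of $a$ in $U$ and all columns of $b$ in $W$, and $\varphi(s_{B,\tau}(I))=\{(m,m^t): m\in U\otimes W\}$, where $U\otimes W\subset M_3(R)$ is spanned by the matrices $(u_iw_j)_{i,j}$ with $u\in U$, $w\in W$. Such a $\varphi$ exists whenever $R$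 is an algebraically closed field containing $F$. -/

import Mathlib

open CategoryTheory AlgebraicGeometry TensorProduct

universe u

namespace Segre

noncomputable section

/-! ### Direct summands of constant rank and their base change -/

/-- `N` is a direct summand of the `S`-module `M` and is finitely generated projective of constant
rank `n`. -/
structure IsSummandOfRank {S M : Type*} [CommRing S] [AddCommGroup M] [Module S M]
    (n : ℕ) (N : Submodule S M) : Prop where
  exists_isCompl : ∃ C : Submodule S M, IsCompl N C
  finite : Module.Finite S N
  projective : Module.Projective S N
  rank_eq : ∀ p : PrimeSpectrum S, Module.rankAtStalk (R := S) N p = n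

section BaseChange

variable {k : Type*} [CommRing k] {V : Type*} [AddCommGroup V] [Module k V]
  {S S' S'' : Type*} [CommRing S] [Algebra k S] [CommRing S'] [Algebra k S']
  [CommRing S''] [Algebra k S'']

/-- The base change of a submodule `N` of `S ⊗ V` along `f : S → S'`: the `S'`-submodule of
`S' ⊗ V` generated by the image of `N`. -/
def extendSubmodule (f : S →ₐ[k] S') (N : Submodule S (S ⊗[k] V)) : Submodule S' (S' ⊗[k] V) :=
  Submodule.span S' (f.toLinearMap.rTensor V '' (N : Set (S ⊗[k] V)))

lemma rTensor_smul (f : S →ₐ[k] S') (s : S) (x : S ⊗[k] V) :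
    f.toLinearMap.rTensor V (s • x) = f s • f.toLinearMap.rTensor V x := by
  induction x with
  | zero => simp
  | tmul a b => simp [TensorProduct.smul_tmul']
  | add x y hx hy => simp only [smul_add, map_add, hx, hy]

lemma extendSubmodule_id (N : Submodule S (S ⊗[k] V)) : extendSubmodule (AlgHom.id k S) N = N := by
  have : (AlgHom.id k S).toLinearMap.rTensor V = LinearMap.id := by
    ext; simp
  simp [extendSubmodule]

lemma extendSubmodule_comp (f : S →ₐ[k] S') (g : S' →ₐ[k] S'') (N : Submodule S (S ⊗[k] V)) :
    extendSubmodule (g.comp f) N = extendSubmodule g (extendSubmodule f N) := by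
  have hc : ∀ x : S ⊗[k] V, (g.comp f).toLinearMap.rTensor V x =
      g.toLinearMap.rTensor V (f.toLinearMap.rTensor V x) := by
    intro x
    rw [AlgHom.comp_toLinearMap, LinearMap.rTensor_comp]; rfl
  apply le_antisymm
  · refine Submodule.span_le.2 ?_
    rintro _ ⟨x, hx, rfl⟩
    rw [hc]
    exact Submodule.subset_span ⟨_, Submodule.subset_span ⟨x, hx, rfl⟩, rfl⟩
  · refine Submodule.span_le.2 ?_
    rintro _ ⟨y, hy, rfl⟩
    change y ∈ extendSubmodule f N at hy
    refine Submodule.span_induction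
      (p := fun y _ => g.toLinearMap.rTensor V y ∈ extendSubmodule (g.comp f) N) ?_ ?_ ?_ ?_ hy
    · rintro _ ⟨x, hx, rfl⟩
      rw [← hc]
      exact Submodule.subset_span ⟨x, hx, rfl⟩
    · simp
    · intro x y _ _ hx hy
      rw [map_add]; exact add_mem hx hy
    · intro a x _ hx
      rw [rTensor_smul]; exact Submodule.smul_mem _ _ hx

lemma isCompl_range_ker {R M P : Type*} [CommRing R] [AddCommGroup M] [Module R M]
    [AddCommGroup P] [Module R P] (i : P →ₗ[R] M) (r : M →ₗ[R] P) (h : ∀ x, r (i x) = x) :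
    IsCompl (LinearMap.range i) (LinearMap.ker r) := by
  constructor
  · rw [Submodule.disjoint_def]
    rintro _ ⟨x, rfl⟩ hx
    have : x = 0 := by rw [← h x]; exact hx
    simp [this]
  · rw [codisjoint_iff, eq_top_iff]
    intro x _
    have hx : x = i (r x) + (x - i (r x)) := by abel
    rw [hx]
    refine Submodule.add_mem_sup ⟨_, rfl⟩ ?_
    simp [h]

lemma IsSummandOfRank.extend {n : ℕ} (f : S →ₐ[k] S') {N : Submodule S (S ⊗[k] V)}
    (hN : IsSummandOfRank n N) : IsSummandOfRank n (extendSubmodule f N) := by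
  obtain ⟨⟨C, hC⟩, _, _, hr⟩ := hN
  let : Algebra S S' := f.toRingHom.toAlgebra
  have : IsScalarTower k S S' := IsScalarTower.of_algebraMap_eq fun x => (f.commutes x).symm
  let e := AlgebraTensorModule.cancelBaseChange k S S' S' V
  let i : S' ⊗[S] N →ₗ[S'] S' ⊗[k] V := e.toLinearMap ∘ₗ N.subtype.baseChange S'
  let r : S' ⊗[k] V →ₗ[S'] S' ⊗[S] N :=
    (N.projectionOnto C hC).baseChange S' ∘ₗ e.symm.toLinearMap
  have hri : ∀ x, r (i x) = x := by
    intro x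
    have h1 : N.projectionOnto C hC ∘ₗ N.subtype = LinearMap.id := by
      ext x; simp
    have h2 : (N.projectionOnto C hC).baseChange S' (N.subtype.baseChange S' x) = x := by
      rw [← LinearMap.comp_apply, ← LinearMap.baseChange_comp, h1]; simp
    simpa [r, i] using h2
  have hi : ∀ (s : S') (x : N), i (s ⊗ₜ x) = s • f.toLinearMap.rTensor V x := by
    intro s x
    have : ∀ y : S ⊗[k] V, e (s ⊗ₜ y) = s • f.toLinearMap.rTensor V y := by
      intro y
      induction y with
      | zero => simp
      | tmul a b =>
        simp [e, TensorProduct.smul_tmul', Algebra.smul_def, mul_comm,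
          RingHom.algebraMap_toAlgebra]
      | add x y hx hy => simp only [TensorProduct.tmul_add, map_add, smul_add, hx, hy]
    simpa [i] using this x
  have hrange : LinearMap.range i = extendSubmodule f N := by
    apply le_antisymm
    · rintro _ ⟨x, rfl⟩
      induction x with
      | zero => simp
      | tmul s x =>
        rw [hi]
        exact Submodule.smul_mem _ _ (Submodule.subset_span ⟨x, x.2, rfl⟩)
      | add x y hx hy => rw [map_add]; exact add_mem hx hy
    · refine Submodule.span_le.2 ?_
      rintro _ ⟨x, hx, rfl⟩
      exact ⟨1 ⊗ₜ ⟨x, hx⟩, by rw [hi]; simp⟩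
  have hinj : Function.Injective i := Function.LeftInverse.injective (g := r) hri
  let e' := LinearEquiv.ofInjective i hinj
  rw [← hrange]
  refine ⟨⟨LinearMap.ker r, isCompl_range_ker i r hri⟩, Module.Finite.equiv e',
    Module.Projective.of_equiv e', fun p => ?_⟩
  rw [← Module.rankAtStalk_eq_of_equiv e']
  exact (Module.rankAtStalk_baseChange p).trans (hr _)

end BaseChange

attribute [-instance] CommAlgCat.instCommRingObjForgetAlgHomCarrier
  CommAlgCat.instAlgebraObjForgetAlgHomCarrier

/-! ### Projective spaces, Severi-Brauer varieties and Weil restriction as functors of points -/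

/-- The functor of points of the projective space `ℙ(V)` of lines in a `k`-module `V`: it sends a
commutative `k`-algebra `S` to the set of rank one direct summands of `S ⊗ V`. -/
def projectiveSpace (k : Type u) [CommRing k] (V : Type u) [AddCommGroup V] [Module k V] :
    CommAlgCat.{u} k ⥤ Type u where
  obj S := {N : Submodule S (S ⊗[k] V) // IsSummandOfRank 1 N}
  map f := ↾fun N => ⟨extendSubmodule f.hom N.1, N.2.extend f.hom⟩
  map_id _ := ConcreteCategory.hom_ext _ _ fun N => Subtype.ext (extendSubmodule_id N.1)
  map_comp f g :=
    ConcreteCategory.hom_ext _ _ fun N => Subtype.ext (extendSubmodule_comp f.hom g.hom N.1)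

/-- A submodule of a ring `D` is a right ideal. -/
def IsRightIdeal {S D : Type*} [CommRing S] [Ring D] [Algebra S D] (N : Submodule S D) : Prop :=
  ∀ x ∈ N, ∀ d : D, x * d ∈ N

lemma IsRightIdeal.extend {k S S' A : Type*} [CommRing k] [Ring A] [Algebra k A] [CommRing S]
    [Algebra k S] [CommRing S'] [Algebra k S'] (f : S →ₐ[k] S') {N : Submodule S (S ⊗[k] A)}
    (hN : IsRightIdeal N) : IsRightIdeal (extendSubmodule f N) := by
  have hmul : ∀ (x : S ⊗[k] A) (a : A), f.toLinearMap.rTensor A x * (1 : S') ⊗ₜ[k] a =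
      f.toLinearMap.rTensor A (x * (1 : S) ⊗ₜ[k] a) := by
    intro x a
    induction x with
    | zero => simp
    | tmul s b => simp
    | add x y hx hy => simp only [map_add, add_mul, hx, hy]
  intro x hx d
  refine Submodule.span_induction (p := fun x _ => x * d ∈ extendSubmodule f N) ?_ ?_ ?_ ?_ hx
  · rintro _ ⟨x, hx, rfl⟩
    induction d with
    | zero => simp
    | tmul s a =>
      have : s ⊗ₜ[k] a = s • ((1 : S') ⊗ₜ[k] a) := by simp [TensorProduct.smul_tmul']
      rw [this, mul_smul_comm, hmul]
      exact Submodule.smul_mem _ _ (Submodule.subset_span ⟨_, hN x hx _, rfl⟩)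
    | add d e hd he => rw [mul_add]; exact add_mem hd he
  · simp
  · intro x y _ _ hx hy
    rw [add_mul]; exact add_mem hx hy
  · intro a x _ hx
    rw [smul_mul_assoc]; exact Submodule.smul_mem _ _ hx

/-- The functor of points of the Severi-Brauer variety of an Azumaya algebra `A` of degree `n` over
`k`: it sends a commutative `k`-algebra `S` to the set of right ideals of `S ⊗ A` that are direct
summands of rank `n` as `S`-modules. -/
def severiBrauer (k : Type u) [CommRing k] (A : Type u) [Ring A] [Algebra k A] (n : ℕ) :
    CommAlgCat.{u} k ⥤ Type u where
  obj S := {N : Submodule S (S ⊗[k] A) // IsRightIdeal N ∧ IsSummandOfRank n N}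
  map f := ↾fun N => ⟨extendSubmodule f.hom N.1, N.2.1.extend f.hom, N.2.2.extend f.hom⟩
  map_id _ := ConcreteCategory.hom_ext _ _ fun N => Subtype.ext (extendSubmodule_id N.1)
  map_comp f g :=
    ConcreteCategory.hom_ext _ _ fun N => Subtype.ext (extendSubmodule_comp f.hom g.hom N.1)

/-- Extension of scalars `R ↦ K ⊗ R` from `F`-algebras to `K`-algebras. -/
def extendScalars (F K : Type u) [CommRing F] [CommRing K] [Algebra F K] :
    CommAlgCat.{u} F ⥤ CommAlgCat.{u} K where
  obj R := CommAlgCat.of K (K ⊗[F] R)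
  map f := CommAlgCat.ofHom (Algebra.TensorProduct.map (AlgHom.id K K) f.hom)
  map_id R := by ext x; simp
  map_comp f g := by
    apply CommAlgCat.hom_ext
    apply Algebra.TensorProduct.ext'
    intro a b
    simp

/-- The Weil restriction `R_{K/F} X` of a functor `X` on commutative `K`-algebras:
`(R_{K/F} X)(R) = X(K ⊗ R)`. -/
abbrev weilRestriction (F K : Type u) [CommRing F] [CommRing K] [Algebra F K]
    (X : CommAlgCat.{u} K ⥤ Type u) : CommAlgCat.{u} F ⥤ Type u :=
  extendScalars F K ⋙ X

/-! ### Varieties and closed embeddings -/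

/-- The functor of points `R ↦ Hom_F(Spec R, X)` of a scheme `X` over `F`. -/
abbrev points {F : Type u} [Field F] (X : Over (Spec (.of F))) : CommAlgCat.{u} F ⥤ Type u :=
  (algSpec (.of F)).rightOp ⋙ yoneda.obj X

/-- A variety over a field `F`: a separated scheme of finite type over `F`. -/
structure IsVariety {F : Type u} [Field F] (X : Over (Spec (.of F))) : Prop where
  isSeparated : IsSeparated X.hom
  locallyOfFiniteType : LocallyOfFiniteType X.hom
  quasiCompact : QuasiCompact X.hom

/-- The morphism `s` of functors is a closed embedding of varieties: both functors are the functors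
of points of varieties over `F`, and the corresponding morphism of varieties is a closed
immersion. -/
def IsClosedEmbedding {F : Type u} [Field F] {X Y : CommAlgCat.{u} F ⥤ Type u} (s : X ⟶ Y) :
    Prop :=
  ∃ (X' Y' : Over (Spec (.of F))) (eX : points X' ≅ X) (eY : points Y' ≅ Y) (f : X' ⟶ Y'),
    IsVariety X' ∧ IsVariety Y' ∧ IsClosedImmersion f.left ∧
      eX.hom ≫ s = ((algSpec (.of F)).rightOp.whiskerLeft (yoneda.map f)) ≫ eY.hom

/-! ### Unitary involutions -/

section Symmetric

variable {S D : Type*} [CommRing S] [Ring D] [Algebra S D]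

/-- The submodule `{x | σ x = x}` of `σ`-symmetric elements. -/
def symElems (σ : D →ₗ[S] D) : Submodule S D := LinearMap.eqLocus σ LinearMap.id

/-- The submodule `(N · σ N) ∩ Sym(D, σ)`, where `N · σ N` is spanned by the products `x * σ y`
with `x, y ∈ N`. -/
def symPart (σ : D →ₗ[S] D) (N : Submodule S D) : Submodule S D :=
  (N * N.map σ) ⊓ symElems σ

end Symmetric

/-- `τ` is a unitary involution of the `K`-algebra `B`, trivial on `F`: an `F`-linear
anti-automorphism of order two, such that `F` is the set of elements of `K` fixed by `τ`. -/
structure IsUnitaryInvolution (F K : Type*) {B : Type*} [CommRing F] [CommRing K] [Algebra F K]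
    [Ring B] [Algebra K B] [Algebra F B] (τ : B →ₗ[F] B) : Prop where
  map_mul : ∀ x y, τ (x * y) = τ y * τ x
  involutive : ∀ x, τ (τ x) = x
  fixed_iff : ∀ c : K, τ (algebraMap K B c) = algebraMap K B c ↔ c ∈ (algebraMap F K).range

section Weil

variable (F K B : Type u) [Field F] [CommRing K] [Algebra F K] [Ring B] [Algebra K B]
  [Algebra F B] [IsScalarTower F K B]

/-- The canonical ring homomorphism `R ⊗_F B → (K ⊗_F R) ⊗_K B`, `r ⊗ b ↦ (1 ⊗ r) ⊗ b`. (It is an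
isomorphism.) -/
def toWeil (R : Type u) [CommRing R] [Algebra F R] : R ⊗[F] B →ₐ[F] (K ⊗[F] R) ⊗[K] B :=
  Algebra.TensorProduct.lift
    ((Algebra.TensorProduct.includeLeft : K ⊗[F] R →ₐ[F] (K ⊗[F] R) ⊗[K] B).comp
      Algebra.TensorProduct.includeRight)
    ((Algebra.TensorProduct.includeRight : B →ₐ[K] (K ⊗[F] R) ⊗[K] B).restrictScalars F)
    (fun x y => by simp [Commute, SemiconjBy])

variable {F K B}

lemma toWeil_tmul {R : Type u} [CommRing R] [Algebra F R] (r : R) (b : B) :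
    toWeil F K B R (r ⊗ₜ[F] b) = ((1 : K) ⊗ₜ[F] r) ⊗ₜ[K] b :=
  (Algebra.TensorProduct.lift_tmul _ _ _ _ _).trans (by simp)

lemma toWeil_smul {R : Type u} [CommRing R] [Algebra F R] (r : R) (x : R ⊗[F] B) :
    toWeil F K B R (r • x) = ((1 : K) ⊗ₜ[F] r) • toWeil F K B R x := by
  induction x with
  | zero => simp
  | tmul a b => simp [toWeil_tmul, TensorProduct.smul_tmul']
  | add x y hx hy => simp only [smul_add, map_add, hx, hy]

/-- The variety `R_{K/F} SB(B)` for an Azumaya `K`-algebra `B` of degree 3, as a functor. -/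
abbrev weilSB (F K B : Type u) [Field F] [CommRing K] [Algebra F K] [Ring B] [Algebra K B] :
    CommAlgCat.{u} F ⥤ Type u :=
  weilRestriction F K (severiBrauer K B 3)

/-- An `R`-point of `R_{K/F} SB(B)`, which is a right ideal of `(K ⊗_F R) ⊗_K B`, seen as a right
ideal of `R ⊗_F B`. -/
def idealOf {R : Type u} [CommRing R] [Algebra F R] (I : (weilSB F K B).obj (.of F R)) :
    Submodule R (R ⊗[F] B) where
  carrier := {x | toWeil F K B R x ∈ I.1}
  add_mem' hx hy := by
    simp only [Set.mem_ofPred_eq, map_add] at *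
    exact add_mem hx hy
  zero_mem' := by
    simp only [Set.mem_ofPred_eq, map_zero]
    exact zero_mem _
  smul_mem' r x hx := by
    simp only [Set.mem_ofPred_eq, toWeil_smul] at *
    exact Submodule.smul_mem _ _ hx

/-- An `R`-point of `ℙ(Sym(B, τ))`, which is a submodule of `R ⊗ Sym(B, τ)`, seen as a submodule of
`R ⊗ B`. -/
def lineOf {τ : B →ₗ[F] B} {R : Type u} [CommRing R] [Algebra F R]
    (L : (projectiveSpace F (symElems τ)).obj (.of F R)) :
    Submodule R (R ⊗[F] B) :=
  L.1.map ((symElems τ).subtype.baseChange R)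

end Weil

/-! ### The split case -/

section Split

variable {R : Type*} [CommRing R]

/-- The exchange involution `ε(a, b) = (bᵗ, aᵗ)` of `M₃(R) × M₃(R)`. -/
def exchange (x : Matrix (Fin 3) (Fin 3) R × Matrix (Fin 3) (Fin 3) R) :
    Matrix (Fin 3) (Fin 3) R × Matrix (Fin 3) (Fin 3) R :=
  (x.2.transpose, x.1.transpose)

/-- A splitting of `(B, τ)` over the commutative `F`-algebra `R`: an isomorphism of `R`-algebras
with involution from `R ⊗ (B, τ)` to `M₃(R) × M₃(R)` with the exchange involution. -/
structure Splitting {F B : Type*} [Field F] [Ring B] [Algebra F B] (τ : B →ₗ[F] B)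
    (R : Type*) [CommRing R] [Algebra F R] where
  equiv : (R ⊗[F] B) ≃ₐ[R] (Matrix (Fin 3) (Fin 3) R × Matrix (Fin 3) (Fin 3) R)
  map_involution : ∀ x, equiv (τ.baseChange R x) = exchange (equiv x)

/-- The `R`-points of `ℙ²`, as rank one direct summands of `R³`. -/
def P2 (R : Type*) [CommRing R] : Type _ :=
  {U : Submodule R (Fin 3 → R) // IsSummandOfRank 1 U}

/-- The right ideal `Hom(R³, U) × Hom(R³, W)` of `M₃(R) × M₃(R)`: pairs of matrices with all columns
in `U` and all columns in `W` respectively. -/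
def splitIdeal (U W : Submodule R (Fin 3 → R)) :
    Submodule R (Matrix (Fin 3) (Fin 3) R × Matrix (Fin 3) (Fin 3) R) where
  carrier := {x | ∀ j, x.1.col j ∈ U ∧ x.2.col j ∈ W}
  add_mem' hx hy j := ⟨add_mem (hx j).1 (hy j).1, add_mem (hx j).2 (hy j).2⟩
  zero_mem' _ := ⟨zero_mem U, zero_mem W⟩
  smul_mem' r _ hx j := ⟨U.smul_mem r (hx j).1, W.smul_mem r (hx j).2⟩

/-- The Segre embedding `ℙ² × ℙ² → ℙ(M₃)`, `(U, W) ↦ U ⊗ W`: the submodule of `M₃(R)` spanned by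
the matrices `(uᵢ wⱼ)` with `u ∈ U`, `w ∈ W`. -/
def segreProduct (U W : Submodule R (Fin 3 → R)) : Submodule R (Matrix (Fin 3) (Fin 3) R) :=
  Submodule.span R {m | ∃ u ∈ U, ∃ w ∈ W, m = Matrix.vecMulVec u w}

/-- The identification `a ↦ (a, aᵗ)` of `M₃(R)` with the symmetric elements of the exchange
involution. -/
def symEmbedding : Matrix (Fin 3) (Fin 3) R →ₗ[R] Matrix (Fin 3) (Fin 3) R × Matrix (Fin 3) (Fin 3) R :=
  LinearMap.prod LinearMap.id (Matrix.transposeLinearEquiv (Fin 3) (Fin 3) R R).toLinearMap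

end Split

end

end Segre

open Segre

/-!
# The Segre embedding of `R_{K/F} SB(B)` attached to a unitary involution of degree 3

Everything is reduced to the split case `(M₃(R) × M₃(R), exchange)`, where right ideals of rank `3`
are pairs `(U, W)` of lines in `R³` (`exists_eq_splitIdeal`, `isWeilPoint_iff_of_splitting`) and
`(I · τ I) ∩ Sym` is `U ⊗ W` (`symPart_splitIdeal`). If `E` is an algebraically closed extension of
`F`, then `(B, τ)` splits over `E` (`nonempty_splitting`): a homomorphism `K → E` gives an
idempotent of the centre `K ⊗ E` of `E ⊗ B`, its conjugate under `τ` is the complementary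
idempotent, and the corner algebra is an Azumaya algebra of rank `9` over `E`, hence `M₃(E)`.
Consequently `(B, τ)` splits over `R ⊗ E` for every `R`.

What holds over `R ⊗ E` descends to `R`, because `R ⊗ E` is a free `R`-module in which `R` is a
direct summand as an `R`-module. For a submodule `N` of `R ⊗ V` being a rank one summand is a
condition of this kind: it means that the coordinates of any two elements of `N` are proportional
and that all these coordinates generate the unit ideal (`isSummandOfRank_one_iff`). Hence
`(I · τ I) ∩ Sym` is a line over every `R` (`isSummandOfRank_lineSym`), and `I` is recovered from it
as the right ideal that it generates (`symPart_mul_top`), so that the morphism is injective on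
`R`-points. For `R = F` the line is a one-dimensional space (`finrank_symPart_eq_one`).

The image of the Segre embedding consists of the lines of matrices of rank one. These are singled
out by the identity `ℓ₁ x ℓ₂ y ℓ₃ = ℓ₁ y ℓ₂ x ℓ₃` for elements `ℓ₁, ℓ₂, ℓ₃` of the line and arbitrary
`x, y`, which makes sense in `R ⊗ B` without a splitting. So the image of the morphism is the set of
lines that satisfy this identity (`mem_range_segreMorphism_iff`). The identity is the vanishing of
an ideal whose formation commutes with base change (`sandwichIdeal_extend`).

To pass from functors to schemes, the functor of lines in an `n`-dimensional space is identified
with the functor of points of `Proj F[X₁, …, Xₙ]` (`exists_points_iso`). A family of ideals on the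
affine points of a scheme that commutes with base change defines a closed subscheme
(`exists_closed_subscheme`), and with the family just described this subscheme represents the Weil
restriction (`isClosedEmbedding_segreMorphism`).
-/

namespace Segre

/-! ### Lines as submodules with proportional coordinates -/

section Lines

variable {S M M' ι : Type*} [CommRing S] [AddCommGroup M] [Module S M] [AddCommGroup M']
  [Module S M']

/-- A submodule `N` of a module with basis `b` is a *line* if any two of its elements have
proportional coordinates and the coordinates of its elements generate the unit ideal. By
`isSummandOfRank_one_iff` these are the direct summands of rank one; this description is
equational, hence easy to localize and to descend. -/
structure IsLine (b : Module.Basis ι S M) (N : Submodule S M) : Prop where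
  proportional : ∀ v ∈ N, ∀ w ∈ N, ∀ i j, b.repr v i * b.repr w j = b.repr v j * b.repr w i
  span_eq_top : Ideal.span {x | ∃ v ∈ N, ∃ i, b.repr v i = x} = ⊤

variable {b : Module.Basis ι S M} {N N' : Submodule S M}

lemma IsLine.smul_eq (hN : IsLine b N) {v w : M} (hv : v ∈ N) (hw : w ∈ N) (i : ι) :
    b.repr v i • w = b.repr w i • v := by
  apply b.repr.injective
  ext j
  simpa [mul_comm] using hN.proportional v hv w hw i j

/-- A line is maximal among the submodules with proportional coordinates. -/
lemma IsLine.le_of_proportional (hN : IsLine b N)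
    (h : ∀ v ∈ N, ∀ w ∈ N', ∀ i j, b.repr v i * b.repr w j = b.repr v j * b.repr w i) :
    N' ≤ N := by
  intro w hw
  let J : Ideal S := N.comap (LinearMap.toSpanSingleton S M w)
  have hJ : J = ⊤ := by
    rw [eq_top_iff, ← hN.span_eq_top, Ideal.span_le]
    rintro _ ⟨v, hv, i, rfl⟩
    have : b.repr v i • w = b.repr w i • v := by
      apply b.repr.injective
      ext j
      simpa [mul_comm] using h v hv w hw i j
    change b.repr v i • w ∈ N
    rw [this]
    exact N.smul_mem _ hv
  have : (1 : S) ∈ J := hJ ▸ Submodule.mem_top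
  simpa [J] using this

lemma IsLine.eq_of_le (hN : IsLine b N) (hN' : IsLine b N') (hle : N ≤ N') : N = N' :=
  le_antisymm hle (hN.le_of_proportional fun v hv w hw => hN'.proportional v (hle hv) w hw)

/-- The coordinates of elements of a line provide a projection onto it. -/
lemma IsLine.exists_retraction (hN : IsLine b N) :
    ∃ g : M →ₗ[S] M, ∃ P : Submodule S M, P.FG ∧ P ≤ N ∧ LinearMap.range g ≤ P ∧
      ∀ w ∈ N, g w = w := by
  have key : ∀ r ∈ Ideal.span {x | ∃ v ∈ N, ∃ i, b.repr v i = x},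
      ∃ g : M →ₗ[S] M, ∃ P : Submodule S M, P.FG ∧ P ≤ N ∧ LinearMap.range g ≤ P ∧
      ∀ w ∈ N, g w = r • w := by
    intro r hr
    refine Submodule.span_induction ?_ ?_ ?_ ?_ hr
    · rintro _ ⟨v, hv, i, rfl⟩
      refine ⟨(b.coord i).smulRight v, S ∙ v, Submodule.fg_span_singleton v,
        by simpa using hv, ?_, fun w hw => ?_⟩
      · rintro _ ⟨w, rfl⟩
        exact Submodule.smul_mem _ _ (Submodule.mem_span_singleton_self v)
      · simpa using (hN.smul_eq hv hw i).symm
    · exact ⟨0, ⊥, Submodule.fg_bot, bot_le, by simp, by simp⟩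
    · rintro x y _ _ ⟨g, P, h1, h2, h3, h4⟩ ⟨g', P', h1', h2', h3', h4'⟩
      refine ⟨g + g', P ⊔ P', h1.sup h1', sup_le h2 h2', ?_, fun w hw => ?_⟩
      · rintro _ ⟨w, rfl⟩
        exact Submodule.add_mem_sup (h3 ⟨w, rfl⟩) (h3' ⟨w, rfl⟩)
      · simp [h4 w hw, h4' w hw, add_smul]
    · rintro a x _ ⟨g, P, h1, h2, h3, h4⟩
      refine ⟨a • g, P, h1, h2, ?_, fun w hw => ?_⟩
      · rintro _ ⟨w, rfl⟩
        exact P.smul_mem _ (h3 ⟨w, rfl⟩)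
      · simp [h4 w hw, mul_smul]
  obtain ⟨g, P, h1, h2, h3, h4⟩ := key 1 (hN.span_eq_top ▸ Submodule.mem_top)
  exact ⟨g, P, h1, h2, h3, by simpa using h4⟩

lemma IsLine.isSummandOfRank (hN : IsLine b N) : IsSummandOfRank 1 N := by
  obtain ⟨g, P, hP, hPN, hg, hgN⟩ := hN.exists_retraction
  have hPN' : P = N := le_antisymm hPN fun w hw => hgN w hw ▸ hg ⟨w, rfl⟩
  subst hPN'
  let r : M →ₗ[S] P := g.codRestrict P fun x => hg ⟨x, rfl⟩
  have hr : ∀ x, r (P.subtype x) = x := fun x => Subtype.ext (hgN x x.2)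
  have hfin : Module.Finite S P := Module.Finite.iff_fg.2 hP
  have : Module.Free S M := Module.Free.of_basis b
  have hproj : Module.Projective S P :=
    Module.Projective.of_split P.subtype r (LinearMap.ext hr)
  refine ⟨⟨LinearMap.ker r, by simpa using isCompl_range_ker P.subtype r hr⟩, hfin, hproj, ?_⟩
  intro p
  -- some coordinate of some element is a unit at `p`
  obtain ⟨v, hv, i, hvi⟩ : ∃ v ∈ P, ∃ i, b.repr v i ∉ p.asIdeal := by
    by_contra! h
    refine p.2.ne_top (eq_top_iff.2 ?_)
    rw [← hN.span_eq_top, Ideal.span_le]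
    rintro _ ⟨v, hv, i, rfl⟩
    exact h v hv i
  let α : S →ₗ[S] P := LinearMap.toSpanSingleton S P ⟨v, hv⟩
  let β : P →ₗ[S] S := b.coord i ∘ₗ P.subtype
  have hβα : β ∘ₗ α = b.repr v i • LinearMap.id := by ext; simp [α, β]
  have hαβ : α ∘ₗ β = b.repr v i • LinearMap.id := by
    ext w
    simpa [α, β] using (hN.smul_eq hv w.2 i).symm
  let A := Localization.AtPrime p.asIdeal
  have hu : IsUnit (algebraMap S A (b.repr v i)) :=
    IsLocalization.map_units A (⟨_, hvi⟩ : p.asIdeal.primeCompl)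
  have h1 : β.baseChange A ∘ₗ α.baseChange A = algebraMap S A (b.repr v i) • LinearMap.id := by
    rw [← LinearMap.baseChange_comp, hβα, LinearMap.baseChange_smul, LinearMap.baseChange_id]
    ext; simp
  have h2 : α.baseChange A ∘ₗ β.baseChange A = algebraMap S A (b.repr v i) • LinearMap.id := by
    rw [← LinearMap.baseChange_comp, hαβ, LinearMap.baseChange_smul, LinearMap.baseChange_id]
    ext; simp
  have hbij : Function.Bijective (α.baseChange A) := by
    constructor
    · intro x y hxy
      have := congrArg (β.baseChange A) hxy
      rw [← LinearMap.comp_apply, ← LinearMap.comp_apply, h1] at this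
      exact hu.smul_left_cancel.1 this
    · intro y
      obtain ⟨c, hc⟩ := hu.exists_left_inv
      refine ⟨c • β.baseChange A y, ?_⟩
      rw [map_smul, ← LinearMap.comp_apply, h2, LinearMap.smul_apply, smul_smul, hc, one_smul,
        LinearMap.id_apply]
  have : Nontrivial S := p.nontrivial
  rw [Module.rankAtStalk_eq_finrank_tensorProduct,
    ← (LinearEquiv.ofBijective _ hbij).finrank_eq, Module.finrank_baseChange, Module.finrank_self]

lemma IsSummandOfRank.isLine (hN : IsSummandOfRank 1 N) (b : Module.Basis ι S M) :
    IsLine b N := by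
  obtain ⟨⟨C, hC⟩, hfin, hproj, hr⟩ := hN
  refine ⟨fun v hv w hw i j => ?_, ?_⟩
  · refine Module.eq_of_localization_maximal (R := S) (M := S)
      (fun P _ => Localization.AtPrime P) (fun P _ => Algebra.linearMap S _) _ _ fun P _ => ?_
    let A := Localization.AtPrime P
    have hfree : Module.Free A (A ⊗[S] N) := Module.free_of_flat_of_isLocalRing
    have h1 : Module.finrank A (A ⊗[S] N) = 1 := by
      rw [← hr ⟨P, inferInstance⟩, Module.rankAtStalk_eq_finrank_tensorProduct]
    let B := Module.finBasisOfFinrankEq A (A ⊗[S] N) h1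
    -- any two functionals on a module with one generator are proportional
    have hprop : ∀ (f g : A ⊗[S] N →ₗ[A] A) (x y : A ⊗[S] N), f x * g y = g x * f y := by
      intro f g x y
      have hx : ∀ z, z = B.repr z 0 • B 0 := fun z => by
        conv_lhs => rw [← B.sum_repr z]
        simp
      rw [hx x, hx y]
      simp only [map_smul, smul_eq_mul]
      ring
    let c : ι → (A ⊗[S] N →ₗ[A] A) := fun k =>
      (AlgebraTensorModule.rid S A A).toLinearMap ∘ₗ (b.coord k ∘ₗ N.subtype).baseChange A
    have hc : ∀ k (x : N), c k (1 ⊗ₜ x) = algebraMap S A (b.repr x k) := fun k x => by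
      simp [c, Algebra.smul_def]
    have := hprop (c i) (c j) (1 ⊗ₜ ⟨v, hv⟩) (1 ⊗ₜ ⟨w, hw⟩)
    simpa [hc] using this
  · by_contra htop
    obtain ⟨P, hP, hle⟩ := Ideal.exists_le_maximal _ htop
    -- otherwise `N = P N`, and `N` vanishes at `P` by Nakayama
    have hPN : (⊤ : Submodule S N) ≤ P • (⊤ : Submodule S N) := by
      intro v _
      have hv : v = (b.repr v).sum fun i a => a • N.projectionOnto C hC (b i) := by
        have := congrArg (N.projectionOnto C hC) (b.linearCombination_repr (v : M))
        rw [Finsupp.linearCombination_apply, map_finsuppSum] at this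
        simpa using this.symm
      rw [hv]
      exact Submodule.sum_mem _ fun i _ =>
        Submodule.smul_mem_smul (hle (Ideal.subset_span ⟨v, v.2, i, rfl⟩)) trivial
    obtain ⟨r, hr1, hr2⟩ := Submodule.exists_sub_one_mem_and_smul_eq_zero_of_fg_of_le_smul P ⊤
      Module.Finite.fg_top hPN
    have hrP : r ∉ P := fun h => hP.ne_top <| (Ideal.eq_top_iff_one _).2 <| by
      simpa using P.sub_mem h hr1
    have h0 : Module.rankAtStalk (R := S) N ⟨P, inferInstance⟩ = 0 := by
      rw [Module.rankAtStalk_eq_zero_iff_notMem_support, Module.notMem_support_iff']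
      exact fun m => ⟨r, hrP, hr2 m trivial⟩
    simp [hr] at h0

theorem isSummandOfRank_one_iff (b : Module.Basis ι S M) : IsSummandOfRank 1 N ↔ IsLine b N :=
  ⟨fun h => h.isLine b, fun h => h.isSummandOfRank⟩

lemma IsSummandOfRank.map_equiv {n : ℕ} (hN : IsSummandOfRank n N) (e : M ≃ₗ[S] M') :
    IsSummandOfRank n (N.map e.toLinearMap) := by
  obtain ⟨⟨C, hC⟩, hfin, hproj, hr⟩ := hN
  let e' : N ≃ₗ[S] N.map e.toLinearMap := e.submoduleMap N
  refine ⟨⟨C.map e.toLinearMap, ?_⟩, Module.Finite.equiv e', Module.Projective.of_equiv e', ?_⟩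
  · exact hC.map (Submodule.orderIsoMapComap e)
  · intro p
    rw [← Module.rankAtStalk_eq_of_equiv e']
    exact hr p

end Lines

/-! ### Base change of submodules -/

section Extend

variable {k : Type*} [CommRing k] {V V' A ι : Type*} [AddCommGroup V] [Module k V]
  [AddCommGroup V'] [Module k V'] [Ring A] [Algebra k A]
  {S S' : Type*} [CommRing S] [Algebra k S] [CommRing S'] [Algebra k S']

lemma rTensor_mem_extendSubmodule (f : S →ₐ[k] S') {N : Submodule S (S ⊗[k] V)} {x : S ⊗[k] V}
    (hx : x ∈ N) : f.toLinearMap.rTensor V x ∈ extendSubmodule f N :=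
  Submodule.subset_span ⟨x, hx, rfl⟩

lemma extendSubmodule_le {f : S →ₐ[k] S'} {N : Submodule S (S ⊗[k] V)}
    {N' : Submodule S' (S' ⊗[k] V)} :
    extendSubmodule f N ≤ N' ↔ ∀ x ∈ N, f.toLinearMap.rTensor V x ∈ N' := by
  rw [extendSubmodule, Submodule.span_le, Set.image_subset_iff]; rfl

lemma extendSubmodule_mono (f : S →ₐ[k] S') {N N' : Submodule S (S ⊗[k] V)} (h : N ≤ N') :
    extendSubmodule f N ≤ extendSubmodule f N' :=
  extendSubmodule_le.2 fun _ hx => rTensor_mem_extendSubmodule f (h hx)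

lemma extendSubmodule_top (f : S →ₐ[k] S') :
    extendSubmodule f (⊤ : Submodule S (S ⊗[k] V)) = ⊤ := by
  rw [eq_top_iff]
  rintro x -
  induction x with
  | zero => simp
  | tmul s v =>
    have : s ⊗ₜ[k] v = s • f.toLinearMap.rTensor V (1 ⊗ₜ v) := by simp [smul_tmul']
    rw [this]
    exact Submodule.smul_mem _ _ (rTensor_mem_extendSubmodule f trivial)
  | add x y hx hy => exact add_mem hx hy

lemma rTensor_mul (f : S →ₐ[k] S') (x y : S ⊗[k] A) :
    f.toLinearMap.rTensor A (x * y) =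
      f.toLinearMap.rTensor A x * f.toLinearMap.rTensor A y :=
  map_mul (Algebra.TensorProduct.map f (AlgHom.id k A)) x y

lemma extendSubmodule_mul (f : S →ₐ[k] S') (N N' : Submodule S (S ⊗[k] A)) :
    extendSubmodule f (N * N') = extendSubmodule f N * extendSubmodule f N' := by
  apply le_antisymm
  · refine extendSubmodule_le.2 fun x hx => ?_
    induction hx using Submodule.mul_induction_on' with
    | mem_mul_mem m hm n hn =>
      rw [rTensor_mul]
      exact Submodule.mul_mem_mul (rTensor_mem_extendSubmodule f hm)
        (rTensor_mem_extendSubmodule f hn)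
    | add x _ y _ hx hy => rw [map_add]; exact add_mem hx hy
  · rw [extendSubmodule, extendSubmodule, Submodule.span_mul_span, Submodule.span_le]
    rintro _ ⟨_, ⟨x, hx, rfl⟩, _, ⟨y, hy, rfl⟩, rfl⟩
    change f.toLinearMap.rTensor A x * f.toLinearMap.rTensor A y ∈ _
    rw [← rTensor_mul]
    exact rTensor_mem_extendSubmodule f (Submodule.mul_mem_mul hx hy)

lemma rTensor_baseChange (f : S →ₐ[k] S') (g : V →ₗ[k] V') (x : S ⊗[k] V) :
    f.toLinearMap.rTensor V' (g.baseChange S x) = g.baseChange S' (f.toLinearMap.rTensor V x) := by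
  induction x with
  | zero => simp
  | tmul s v => simp
  | add x y hx hy => simp only [map_add, hx, hy]

lemma extendSubmodule_map (f : S →ₐ[k] S') (g : V →ₗ[k] V') (N : Submodule S (S ⊗[k] V)) :
    extendSubmodule f (N.map (g.baseChange S)) = (extendSubmodule f N).map (g.baseChange S') := by
  apply le_antisymm
  · refine extendSubmodule_le.2 ?_
    rintro _ ⟨x, hx, rfl⟩
    rw [rTensor_baseChange]
    exact ⟨_, rTensor_mem_extendSubmodule f hx, rfl⟩
  · rw [Submodule.map_le_iff_le_comap, extendSubmodule_le]
    intro x hx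
    rw [Submodule.mem_comap, ← rTensor_baseChange]
    exact rTensor_mem_extendSubmodule f ⟨x, hx, rfl⟩

lemma extendSubmodule_symPart_le (f : S →ₐ[k] S') (τ : A →ₗ[k] A) (N : Submodule S (S ⊗[k] A)) :
    extendSubmodule f (symPart (τ.baseChange S) N) ≤
      symPart (τ.baseChange S') (extendSubmodule f N) := by
  refine le_inf ?_ ?_
  · rw [← extendSubmodule_map, ← extendSubmodule_mul]
    exact extendSubmodule_mono f inf_le_left
  · refine extendSubmodule_le.2 fun x hx => ?_
    have : τ.baseChange S x = x := hx.2
    change τ.baseChange S' _ = _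
    rw [← rTensor_baseChange, this]; rfl

lemma repr_rTensor (b : Module.Basis ι k V) (f : S →ₐ[k] S') (x : S ⊗[k] V) (i : ι) :
    (b.baseChange S').repr (f.toLinearMap.rTensor V x) i = f ((b.baseChange S).repr x i) := by
  induction x with
  | zero => simp
  | tmul s v => simp [Algebra.smul_def, mul_comm]
  | add x y hx hy => simp only [map_add, Finsupp.add_apply, hx, hy]

lemma IsLine.extend {b : Module.Basis ι k V} {N : Submodule S (S ⊗[k] V)}
    (hN : IsLine (b.baseChange S) N) (f : S →ₐ[k] S') :
    IsLine (b.baseChange S') (extendSubmodule f N) :=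
  (hN.isSummandOfRank.extend f).isLine _

end Extend

/-! ### Descent along free extensions -/

section Descent

variable {k : Type*} [CommRing k] {V A ι κ : Type*} [AddCommGroup V] [Module k V]
  [Ring A] [Algebra k A] {R T : Type*} [CommRing R] [Algebra k R] [CommRing T] [Algebra k T]
  [Algebra R T] [IsScalarTower k R T]

/-- An `R`-linear functional `ρ` on the `R`-algebra `T`, applied to the coefficients of elements
of `T ⊗ V`. -/
noncomputable def applyCoeff (V : Type*) [AddCommGroup V] [Module k V] (ρ : T →ₗ[R] R) :
    T ⊗[k] V →ₗ[k] R ⊗[k] V :=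
  (ρ.restrictScalars k).rTensor V

lemma applyCoeff_smul_rTensor (ρ : T →ₗ[R] R) (t : T) (x : R ⊗[k] V) :
    applyCoeff V ρ (t • (IsScalarTower.toAlgHom k R T).toLinearMap.rTensor V x) = ρ t • x := by
  induction x with
  | zero => simp
  | tmul s v =>
    have : ρ (t * algebraMap R T s) = ρ t * s := by
      rw [mul_comm, ← Algebra.smul_def, map_smul, smul_eq_mul, mul_comm]
    simp [applyCoeff, smul_tmul', this]
  | add x y hx hy => simp only [map_add, smul_add, hx, hy]

/-- Functionals map the extension of `N` back into `N`. -/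
lemma applyCoeff_mem (ρ : T →ₗ[R] R) {N : Submodule R (R ⊗[k] V)} {y : T ⊗[k] V}
    (hy : y ∈ extendSubmodule (IsScalarTower.toAlgHom k R T) N) : applyCoeff V ρ y ∈ N := by
  have key : ∀ t : T, applyCoeff V ρ (t • y) ∈ N := by
    refine Submodule.span_induction (p := fun y _ => ∀ t : T, applyCoeff V ρ (t • y) ∈ N)
      ?_ ?_ ?_ ?_ hy
    · rintro _ ⟨x, hx, rfl⟩ t
      rw [applyCoeff_smul_rTensor]
      exact N.smul_mem _ hx
    · simp
    · intro x y _ _ hx hy t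
      rw [smul_add, map_add]
      exact add_mem (hx t) (hy t)
    · intro a x _ hx t
      rw [smul_smul]
      exact hx _
  simpa using key 1

/-- Every element of `T ⊗ V` is recovered from its coefficients with respect to an `R`-basis of
`T`. -/
lemma mem_extendSubmodule_of_applyCoeff_mem (e : Module.Basis κ R T)
    {N : Submodule R (R ⊗[k] V)} {y : T ⊗[k] V} (hy : ∀ j, applyCoeff V (e.coord j) y ∈ N) :
    y ∈ extendSubmodule (IsScalarTower.toAlgHom k R T) N := by
  classical
  have key : ∃ s : Finset κ, ∀ s', s ⊆ s' → y = ∑ j ∈ s', e j •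
      (IsScalarTower.toAlgHom k R T).toLinearMap.rTensor V (applyCoeff V (e.coord j) y) := by
    clear hy
    induction y with
    | zero => exact ⟨∅, by simp⟩
    | tmul t v =>
      refine ⟨(e.repr t).support, fun s' hs' => ?_⟩
      have : t = ∑ j ∈ s', e j * algebraMap R T (e.repr t j) := by
        conv_lhs => rw [← e.linearCombination_repr t, Finsupp.linearCombination_apply,
          Finsupp.sum_of_support_subset _ hs' _ (by simp)]
        exact Finset.sum_congr rfl fun j _ => by rw [Algebra.smul_def, mul_comm]
      conv_lhs => rw [this, sum_tmul]
      exact Finset.sum_congr rfl fun j _ => by simp [applyCoeff, smul_tmul']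
    | add x y hx hy =>
      obtain ⟨s, hs⟩ := hx
      obtain ⟨s', hs'⟩ := hy
      refine ⟨s ∪ s', fun u hu => ?_⟩
      conv_lhs => rw [hs u (Finset.union_subset_left hu), hs' u (Finset.union_subset_right hu)]
      simp only [map_add, smul_add, Finset.sum_add_distrib]
  obtain ⟨s, hs⟩ := key
  rw [hs s subset_rfl]
  exact Submodule.sum_mem _ fun j _ =>
    Submodule.smul_mem _ _ (rTensor_mem_extendSubmodule _ (hy j))

variable {ρ : T →ₗ[R] R}

/-- A retraction `ρ : T → R`, i.e. a functional with `ρ 1 = 1`, recovers `N` from its extension. -/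
lemma le_of_extendSubmodule_le (hρ : ρ 1 = 1) {N N' : Submodule R (R ⊗[k] V)}
    (h : extendSubmodule (IsScalarTower.toAlgHom k R T) N ≤
      extendSubmodule (IsScalarTower.toAlgHom k R T) N') : N ≤ N' := by
  intro x hx
  have := applyCoeff_mem ρ (h (rTensor_mem_extendSubmodule _ hx))
  rwa [← one_smul T (LinearMap.rTensor V _ x), applyCoeff_smul_rTensor, hρ, one_smul] at this

lemma extendSubmodule_injective (hρ : ρ 1 = 1) : Function.Injective
    (extendSubmodule (V := V) (IsScalarTower.toAlgHom k R T)) := fun _ _ h =>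
  le_antisymm (le_of_extendSubmodule_le hρ h.le) (le_of_extendSubmodule_le hρ h.ge)

lemma algebraMap_injective_of_retraction (hρ : ρ 1 = 1) :
    Function.Injective (algebraMap R T) := by
  refine Function.LeftInverse.injective (g := ρ) fun r => ?_
  rw [Algebra.algebraMap_eq_smul_one, map_smul, hρ, smul_eq_mul, mul_one]

lemma applyCoeff_baseChange (ρ : T →ₗ[R] R) (τ : V →ₗ[k] V) (y : T ⊗[k] V) :
    applyCoeff V ρ (τ.baseChange T y) = τ.baseChange R (applyCoeff V ρ y) := by
  induction y with
  | zero => simp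
  | tmul s v => simp [applyCoeff]
  | add x y hx hy => simp only [map_add, hx, hy]

/-- Symmetric elements are the solutions of a linear system over `k`, so over `T` they are spanned
by those over `R`: the coefficients of a symmetric element are symmetric. -/
lemma extendSubmodule_symElems (e : Module.Basis κ R T) (τ : A →ₗ[k] A) :
    extendSubmodule (IsScalarTower.toAlgHom k R T) (symElems (τ.baseChange R)) =
      symElems (τ.baseChange T) := by
  apply le_antisymm
  · refine extendSubmodule_le.2 fun x hx => ?_
    have : τ.baseChange R x = x := hx
    change τ.baseChange T _ = _
    rw [← rTensor_baseChange, this]; rfl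
  · intro y hy
    refine mem_extendSubmodule_of_applyCoeff_mem e fun j => ?_
    have hy : τ.baseChange T y = y := hy
    change τ.baseChange R _ = _
    rw [← applyCoeff_baseChange, hy]; rfl

/-- For a free extension `T` of `R` the construction `N ↦ (N · τ N) ∩ Sym` commutes with base change.
In general only `extendSubmodule_symPart_le` holds, because of the intersection. -/
lemma extendSubmodule_symPart (e : Module.Basis κ R T) (τ : A →ₗ[k] A)
    (N : Submodule R (R ⊗[k] A)) :
    extendSubmodule (IsScalarTower.toAlgHom k R T) (symPart (τ.baseChange R) N) =
      symPart (τ.baseChange T) (extendSubmodule (IsScalarTower.toAlgHom k R T) N) := by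
  refine le_antisymm (extendSubmodule_symPart_le _ _ _) ?_
  intro y hy
  rw [symPart, ← extendSubmodule_map, ← extendSubmodule_mul, ← extendSubmodule_symElems e] at hy
  exact mem_extendSubmodule_of_applyCoeff_mem e fun j =>
    ⟨applyCoeff_mem _ hy.1, applyCoeff_mem _ hy.2⟩

/-- Being a line descends along `R → T`, if `R` is a direct summand of the `R`-module `T`. -/
lemma IsLine.of_extend (hρ : ρ 1 = 1) {b : Module.Basis ι k V} {N : Submodule R (R ⊗[k] V)}
    (hN : IsLine (b.baseChange T) (extendSubmodule (IsScalarTower.toAlgHom k R T) N)) :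
    IsLine (b.baseChange R) N := by
  constructor
  · intro v hv w hw i j
    have := hN.proportional _ (rTensor_mem_extendSubmodule _ hv) _
      (rTensor_mem_extendSubmodule _ hw) i j
    simp only [repr_rTensor, ← map_mul] at this
    exact algebraMap_injective_of_retraction hρ this
  · set c := Ideal.span {x | ∃ v ∈ N, ∃ i, (b.baseChange R).repr v i = x}
    have h1 : (1 : T) ∈ c.map (algebraMap R T) := by
      have : (1 : T) ∈ (⊤ : Ideal T) := trivial
      rw [← hN.span_eq_top] at this
      refine Ideal.span_le.2 ?_ this
      rintro _ ⟨v, hv, i, rfl⟩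
      refine Submodule.span_induction
        (p := fun v _ => (b.baseChange T).repr v i ∈ c.map (algebraMap R T)) ?_ ?_ ?_ ?_ hv
      · rintro _ ⟨x, hx, rfl⟩
        rw [repr_rTensor]
        exact Ideal.mem_map_of_mem _ (Ideal.subset_span ⟨x, hx, i, rfl⟩)
      · simp
      · intro v v' _ _ hv hv'
        rw [map_add]
        exact add_mem hv hv'
      · intro a v _ hv
        rw [map_smul]
        exact Ideal.mul_mem_left _ _ hv
    have h2 : ∀ x ∈ c.map (algebraMap R T), ρ x ∈ c := by
      intro x hx
      have key : ∀ t : T, ρ (t * x) ∈ c := by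
        refine Submodule.span_induction (p := fun x _ => ∀ t : T, ρ (t * x) ∈ c) ?_ ?_ ?_ ?_ hx
        · rintro _ ⟨x, hx, rfl⟩ t
          rw [mul_comm, ← Algebra.smul_def, map_smul]
          exact c.mul_mem_right _ hx
        · simp
        · intro x y _ _ hx hy t
          rw [mul_add, map_add]
          exact add_mem (hx t) (hy t)
        · intro a x _ hx t
          rw [smul_eq_mul, ← mul_assoc]
          exact hx _
      simpa using key 1
    rw [Ideal.eq_top_iff_one, ← hρ]
    exact h2 _ h1

end Descent

/-! ### Descent of direct summands along faithfully flat extensions -/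

section FaithfullyFlat

variable {S S' M : Type*} [CommRing S] [CommRing S'] [Algebra S S'] [AddCommGroup M] [Module S M]

/-- Being a direct summand of constant rank descends along faithfully flat base change: the
quotient is finitely presented and flat, hence projective. -/
lemma isSummandOfRank_of_baseChange [Module.FaithfullyFlat S S'] [Module.Finite S M]
    [Module.Projective S M] {n : ℕ} {N : Submodule S M}
    (hN : IsSummandOfRank n (LinearMap.range (N.subtype.baseChange S'))) :
    IsSummandOfRank n N := by
  obtain ⟨⟨C, hC⟩, hfin, hproj, hr⟩ := hN
  have hinj : Function.Injective (N.subtype.baseChange S') :=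
    Module.Flat.lTensor_preserves_injective_linearMap _ N.injective_subtype
  let e : S' ⊗[S] N ≃ₗ[S'] LinearMap.range (N.subtype.baseChange S') :=
    LinearEquiv.ofInjective _ hinj
  have hfin' : Module.Finite S' (S' ⊗[S] N) := Module.Finite.equiv e.symm
  have hNfin : Module.Finite S N := Module.Finite.of_finite_tensorProduct_of_faithfullyFlat S'
  have : Module.FinitePresentation S M := Module.finitePresentation_of_projective S M
  have hQfp : Module.FinitePresentation S (M ⧸ N) :=
    Module.finitePresentation_of_surjective N.mkQ N.mkQ_surjective
      (by rw [Submodule.ker_mkQ]; exact Module.Finite.iff_fg.1 hNfin)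
  have hker : LinearMap.ker (N.mkQ.baseChange S') = LinearMap.range (N.subtype.baseChange S') := by
    have hex : Function.Exact N.subtype N.mkQ := LinearMap.exact_subtype_mkQ N
    have := lTensor_exact S' hex N.mkQ_surjective
    ext x
    exact this x
  have hsurj : Function.Surjective (N.mkQ.baseChange S') :=
    LinearMap.lTensor_surjective S' N.mkQ_surjective
  let e' : C ≃ₗ[S'] S' ⊗[S] (M ⧸ N) :=
    (Submodule.quotientEquivOfIsCompl _ C hC).symm ≪≫ₗ Submodule.quotEquivOfEq _ _ hker.symm ≪≫ₗ
      LinearMap.quotKerEquivOfSurjective _ hsurj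
  have hCproj : Module.Projective S' C :=
    Module.Projective.of_split C.subtype (C.projectionOnto _ hC.symm) (by ext x; simp)
  have hQproj : Module.Projective S' (S' ⊗[S] (M ⧸ N)) := Module.Projective.of_equiv e'
  have hQflat : Module.Flat S (M ⧸ N) := Module.Flat.of_flat_tensorProduct S _ S'
  have hQ : Module.Projective S (M ⧸ N) := Module.Flat.projective_of_finitePresentation
  obtain ⟨C', hC'⟩ : ∃ C', IsCompl N C' := by
    obtain ⟨g, hg⟩ := Module.projective_lifting_property N.mkQ LinearMap.id N.mkQ_surjective
    have := (isCompl_range_ker g N.mkQ (LinearMap.congr_fun hg)).symm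
    rw [Submodule.ker_mkQ] at this
    exact ⟨_, this⟩
  have hNproj : Module.Projective S N :=
    Module.Projective.of_split N.subtype (N.projectionOnto _ hC') (by ext x; simp)
  refine ⟨⟨C', hC'⟩, hNfin, hNproj, fun p => ?_⟩
  obtain ⟨q, rfl⟩ := PrimeSpectrum.comap_surjective_of_faithfullyFlat (A := S) (B := S') p
  rw [← Module.rankAtStalk_baseChange]
  exact (congrFun (Module.rankAtStalk_eq_of_equiv (LinearEquiv.ofInjective _ hinj)) q).trans (hr q)

/-- Descent of summands in terms of the spans in `S' ⊗ V`. -/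
lemma isSummandOfRank_of_extend {k V : Type*} [CommRing k] [AddCommGroup V] [Module k V]
    [Algebra k S] [Algebra k S'] [IsScalarTower k S S'] [Module.FaithfullyFlat S S']
    [Module.Finite k V] [Module.Projective k V] {n : ℕ} {N : Submodule S (S ⊗[k] V)}
    (hN : IsSummandOfRank n (extendSubmodule (IsScalarTower.toAlgHom k S S') N)) :
    IsSummandOfRank n N := by
  apply isSummandOfRank_of_baseChange (S' := S')
  let e := AlgebraTensorModule.cancelBaseChange k S S' S' V
  have he : ∀ (s : S') (x : S ⊗[k] V),
      e (s ⊗ₜ x) = s • (IsScalarTower.toAlgHom k S S').toLinearMap.rTensor V x := by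
    intro s x
    induction x with
    | zero => simp
    | tmul a b => simp [e, TensorProduct.smul_tmul', Algebra.smul_def, mul_comm]
    | add x y hx hy => simp only [TensorProduct.tmul_add, map_add, smul_add, hx, hy]
  have hrange : (LinearMap.range (N.subtype.baseChange S')).map e.toLinearMap =
      extendSubmodule (IsScalarTower.toAlgHom k S S') N := by
    apply le_antisymm
    · rw [← LinearMap.range_comp]
      rintro _ ⟨x, rfl⟩
      induction x with
      | zero => simp
      | tmul s x =>
        simp only [LinearMap.comp_apply, LinearMap.baseChange_tmul, LinearEquiv.coe_coe, he]
        exact Submodule.smul_mem _ _ (rTensor_mem_extendSubmodule _ x.2)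
      | add x y hx hy => rw [map_add]; exact add_mem hx hy
    · refine extendSubmodule_le.2 fun x hx => ⟨1 ⊗ₜ x, ⟨1 ⊗ₜ ⟨x, hx⟩, by simp⟩, ?_⟩
      rw [LinearEquiv.coe_coe, he, one_smul]
  have := (hrange ▸ hN).map_equiv e.symm
  rwa [← Submodule.map_comp, LinearEquiv.comp_coe, LinearEquiv.self_trans_symm,
    LinearEquiv.refl_toLinearMap, Submodule.map_id] at this

end FaithfullyFlat

/-! ### Direct summands over a product of two rings -/

section Product

variable {S R M A A₁ A₂ : Type*} [CommRing S] [CommRing R] [AddCommGroup M] [Module S M]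
  [AddCommGroup A] [Module R A] [AddCommGroup A₁] [Module R A₁] [AddCommGroup A₂] [Module R A₂]

/-- If `q : N → N₁` is the quotient by `ε N`, where `S → R` is a surjection with `ε` in its
kernel, then `N₁` is the base change of `N`. -/
lemma isBaseChange_of_idempotent [Algebra S R] {N N₁ : Type*} [AddCommGroup N] [Module S N]
    [AddCommGroup N₁] [Module S N₁] [Module R N₁] [IsScalarTower S R N₁]
    (hsurj : Function.Surjective (algebraMap S R)) (q : N →ₗ[S] N₁) (hq : Function.Surjective q)
    (ε : S) (hε : algebraMap S R ε = 0) (hker : ∀ x, q x = 0 → ε • x = x) :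
    IsBaseChange R q := by
  have h1 : ∀ z : R ⊗[S] N, ∃ x, z = 1 ⊗ₜ x := by
    intro z
    induction z with
    | zero => exact ⟨0, by simp⟩
    | tmul r x =>
      obtain ⟨s, rfl⟩ := hsurj r
      exact ⟨s • x, by rw [tmul_smul, smul_tmul', Algebra.smul_def, mul_one]⟩
    | add x y hx hy =>
      obtain ⟨x, rfl⟩ := hx
      obtain ⟨y, rfl⟩ := hy
      exact ⟨x + y, by rw [tmul_add]⟩
  have hl : ∀ x, q.liftBaseChange R (1 ⊗ₜ x) = q x := fun x => by simp
  have hbij : Function.Bijective (q.liftBaseChange R) := by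
    constructor
    · rw [injective_iff_map_eq_zero]
      intro z hz
      obtain ⟨x, rfl⟩ := h1 z
      rw [hl] at hz
      rw [← hker x hz, tmul_smul, smul_tmul', Algebra.smul_def, hε, zero_mul, zero_tmul]
    · intro y
      obtain ⟨x, rfl⟩ := hq y
      exact ⟨_, hl x⟩
  refine IsBaseChange.of_equiv (LinearEquiv.ofBijective _ hbij) fun x => hl x

/-- The rank of the first factor under a decomposition along `S ≃ R × R`; here `p` is the first
projection, `ε` generates its kernel and `Φ` is the first component. -/
lemma rankAtStalk_factor {N : Submodule S M} {N₁ : Submodule R A} [Module.Finite S N]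
    [Module.Projective S N] (p : S →+* R) (hp : Function.Surjective p)
    (ε : S) (hε : p ε = 0) (Φ : M →ₛₗ[p] A) (Ψ : A →+ M) (hΦΨ : ∀ a, Φ (Ψ a) = a)
    (hker : ∀ x, Φ x = 0 → ε • x = x) (h1 : ∀ x ∈ N, Φ x ∈ N₁) (h2 : ∀ a ∈ N₁, Ψ a ∈ N)
    (P : PrimeSpectrum R) :
    Module.rankAtStalk (R := R) N₁ P = Module.rankAtStalk (R := S) N (P.comap p) := by
  let := p.toAlgebra
  let : Module S N₁ := Module.compHom N₁ p
  have : IsScalarTower S R N₁ := IsScalarTower.of_algebraMap_smul fun _ _ => rfl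
  let q : N →ₗ[S] N₁ :=
    { toFun x := ⟨Φ x, h1 x x.2⟩
      map_add' x y := Subtype.ext (by simp)
      map_smul' s x := Subtype.ext (Φ.map_smulₛₗ s x) }
  refine Module.rankAtStalk_isBaseChange
    (isBaseChange_of_idempotent hp q (fun y => ⟨⟨Ψ y, h2 y y.2⟩, Subtype.ext (hΦΨ y)⟩) ε hε
      fun x hx => Subtype.ext (hker x (congrArg Subtype.val hx))) P

/-- Being a summand of rank `n` passes to the first factor under a decomposition of `M` along
`S ≃ R × R`; here `p` is the first projection, `ε` generates its kernel and `Φ` is the first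
component. -/
lemma IsSummandOfRank.factor [Module.Finite R A] [Module.Projective R A] {n : ℕ}
    {N : Submodule S M} {N₁ : Submodule R A}
    (hN : IsSummandOfRank n N) (p : S →+* R) (hp : Function.Surjective p)
    (ε : S) (hε : p ε = 0)
    (Φ : M →ₛₗ[p] A) (Ψ : A →+ M) (hΦΨ : ∀ a, Φ (Ψ a) = a) (hΨ : ∀ s a, Ψ (p s • a) = s • Ψ a)
    (hker : ∀ x, Φ x = 0 → ε • x = x)
    (h1 : ∀ x ∈ N, Φ x ∈ N₁) (h2 : ∀ a ∈ N₁, Ψ a ∈ N) : IsSummandOfRank n N₁ := by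
  obtain ⟨⟨C, hC⟩, hfin, hproj, hr⟩ := hN
  let r : A →ₗ[R] N₁ :=
    { toFun a := ⟨Φ (N.projectionOnto C hC (Ψ a)), h1 _ (Subtype.prop _)⟩
      map_add' x y := Subtype.ext (by simp)
      map_smul' c x := Subtype.ext (by
        obtain ⟨s, rfl⟩ := hp c
        simp [hΨ]) }
  have hr' : ∀ x, r (N₁.subtype x) = x := fun x => Subtype.ext (by
    have := Submodule.projectionOnto_apply_left hC ⟨Ψ x, h2 x x.2⟩
    change Φ (N.projectionOnto C hC (Ψ x)) = x
    rw [this, hΦΨ])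
  refine ⟨⟨LinearMap.ker r, by simpa using isCompl_range_ker N₁.subtype r hr'⟩,
    Module.Finite.of_surjective r fun x => ⟨_, hr' x⟩,
    Module.Projective.of_split N₁.subtype r (LinearMap.ext hr'), fun P => ?_⟩
  rw [rankAtStalk_factor p hp ε hε Φ Ψ hΦΨ hker h1 h2, hr]

/-- Over `S ≃ R × R` the direct summands of rank `n` of `A₁ × A₂` are the products of direct
summands of rank `n`. -/
theorem isSummandOfRank_prod_iff [Module.Finite S M] [Module.Projective S M]
    [Module.Finite R A₁] [Module.Projective R A₁] [Module.Finite R A₂] [Module.Projective R A₂]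
    (p₁ p₂ : S →+* R) (hp : Function.Bijective fun s => (p₁ s, p₂ s)) (Φ : M ≃+ A₁ × A₂)
    (hΦ : ∀ s x, Φ (s • x) = (p₁ s • (Φ x).1, p₂ s • (Φ x).2)) {n : ℕ}
    {N : Submodule S M} {N₁ : Submodule R A₁} {N₂ : Submodule R A₂}
    (hN : ∀ x, x ∈ N ↔ (Φ x).1 ∈ N₁ ∧ (Φ x).2 ∈ N₂) :
    IsSummandOfRank n N ↔ IsSummandOfRank n N₁ ∧ IsSummandOfRank n N₂ := by
  obtain ⟨ε₁, hε₁⟩ := hp.2 (0, 1)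
  obtain ⟨ε₂, hε₂⟩ := hp.2 (1, 0)
  obtain ⟨h11, h12⟩ : p₁ ε₁ = 0 ∧ p₂ ε₁ = 1 := Prod.ext_iff.1 hε₁
  obtain ⟨h21, h22⟩ : p₁ ε₂ = 1 ∧ p₂ ε₂ = 0 := Prod.ext_iff.1 hε₂
  have hp₁ : Function.Surjective p₁ := fun r =>
    let ⟨s, hs⟩ := hp.2 (r, 0); ⟨s, (Prod.ext_iff.1 hs).1⟩
  have hp₂ : Function.Surjective p₂ := fun r =>
    let ⟨s, hs⟩ := hp.2 (0, r); ⟨s, (Prod.ext_iff.1 hs).2⟩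
  let Φ₁ : M →ₛₗ[p₁] A₁ :=
    { toFun x := (Φ x).1, map_add' := by simp, map_smul' := by simp [hΦ] }
  let Φ₂ : M →ₛₗ[p₂] A₂ :=
    { toFun x := (Φ x).2, map_add' := by simp, map_smul' := by simp [hΦ] }
  let Ψ₁ : A₁ →+ M := Φ.symm.toAddMonoidHom.comp (AddMonoidHom.inl A₁ A₂)
  let Ψ₂ : A₂ →+ M := Φ.symm.toAddMonoidHom.comp (AddMonoidHom.inr A₁ A₂)
  have hΨ₁ : ∀ a, Φ (Ψ₁ a) = (a, 0) := fun a => Φ.apply_symm_apply _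
  have hΨ₂ : ∀ a, Φ (Ψ₂ a) = (0, a) := fun a => Φ.apply_symm_apply _
  have a1 : ∀ a, Φ₁ (Ψ₁ a) = a := fun a => congrArg Prod.fst (hΨ₁ a)
  have a2 : ∀ a, Φ₂ (Ψ₂ a) = a := fun a => congrArg Prod.snd (hΨ₂ a)
  have b1 : ∀ s a, Ψ₁ (p₁ s • a) = s • Ψ₁ a := fun s a => Φ.injective (by simp [hΨ₁, hΦ])
  have b2 : ∀ s a, Ψ₂ (p₂ s • a) = s • Ψ₂ a := fun s a => Φ.injective (by simp [hΨ₂, hΦ])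
  have c1 : ∀ x, Φ₁ x = 0 → ε₁ • x = x := fun x hx => Φ.injective <| by
    have hx : (Φ x).1 = 0 := hx
    rw [hΦ, h11, h12]; exact Prod.ext (by simp [hx]) (by simp)
  have c2 : ∀ x, Φ₂ x = 0 → ε₂ • x = x := fun x hx => Φ.injective <| by
    have hx : (Φ x).2 = 0 := hx
    rw [hΦ, h21, h22]; exact Prod.ext (by simp) (by simp [hx])
  have d1 : ∀ x ∈ N, Φ₁ x ∈ N₁ := fun x hx => ((hN x).1 hx).1
  have d2 : ∀ x ∈ N, Φ₂ x ∈ N₂ := fun x hx => ((hN x).1 hx).2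
  have e1 : ∀ a ∈ N₁, Ψ₁ a ∈ N := fun a ha => (hN _).2 (by simp [hΨ₁, ha])
  have e2 : ∀ a ∈ N₂, Ψ₂ a ∈ N := fun a ha => (hN _).2 (by simp [hΨ₂, ha])
  constructor
  · exact fun h => ⟨h.factor p₁ hp₁ ε₁ h11 Φ₁ Ψ₁ a1 b1 c1 d1 e1,
      h.factor p₂ hp₂ ε₂ h22 Φ₂ Ψ₂ a2 b2 c2 d2 e2⟩
  · rintro ⟨⟨⟨C₁, hC₁⟩, hfin₁, hproj₁, hr₁⟩, ⟨⟨C₂, hC₂⟩, hfin₂, hproj₂, hr₂⟩⟩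
    let r : M →ₗ[S] N :=
      { toFun x := ⟨Ψ₁ (N₁.projectionOnto C₁ hC₁ (Φ x).1) + Ψ₂ (N₂.projectionOnto C₂ hC₂ (Φ x).2),
          add_mem (e1 _ (Subtype.prop _)) (e2 _ (Subtype.prop _))⟩
        map_add' x y := Subtype.ext (by simp; abel)
        map_smul' s x := Subtype.ext (by simp [hΦ, b1, b2]) }
    have hr : ∀ x, r (N.subtype x) = x := fun x => Subtype.ext <| Φ.injective <| by
      have h1 := Submodule.projectionOnto_apply_left hC₁ ⟨_, ((hN x).1 x.2).1⟩
      have h2 := Submodule.projectionOnto_apply_left hC₂ ⟨_, ((hN x).1 x.2).2⟩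
      change Φ (Ψ₁ (N₁.projectionOnto C₁ hC₁ (Φ x).1) +
        Ψ₂ (N₂.projectionOnto C₂ hC₂ (Φ x).2)) = Φ x
      rw [h1, h2, map_add, hΨ₁, hΨ₂]
      simp
    have hfin : Module.Finite S N := Module.Finite.of_surjective r fun x => ⟨_, hr x⟩
    have hproj : Module.Projective S N := Module.Projective.of_split N.subtype r (LinearMap.ext hr)
    refine ⟨⟨LinearMap.ker r, by simpa using isCompl_range_ker N.subtype r hr⟩, hfin, hproj,
      fun P => ?_⟩
    have hε : ε₁ * ε₂ = 0 := hp.1 (by simp_all)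
    have hlift : ∀ (p : S →+* R) (hp : Function.Surjective p) (ε : S),
        (∀ x, p x = 0 → x * ε = x) → ε ∈ P.asIdeal → ∃ Q : PrimeSpectrum R, Q.comap p = P := by
      intro p hp ε hε hP
      have : P ∈ Set.range (PrimeSpectrum.comap p) := by
        rw [range_comap_of_surjective _ p hp]
        exact fun x hx => hε x hx ▸ P.asIdeal.mul_mem_left x hP
      exact this
    rcases P.2.mem_or_mem (hε ▸ P.asIdeal.zero_mem : ε₁ * ε₂ ∈ P.asIdeal) with h | h
    · obtain ⟨Q, rfl⟩ := hlift p₁ hp₁ ε₁ (fun x hx => hp.1 (by simp [hx, h12])) h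
      rw [← rankAtStalk_factor p₁ hp₁ ε₁ h11 Φ₁ Ψ₁ a1 c1 d1 e1, hr₁]
    · obtain ⟨Q, rfl⟩ := hlift p₂ hp₂ ε₂ (fun x hx => hp.1 (by simp [hx, h21])) h
      rw [← rankAtStalk_factor p₂ hp₂ ε₂ h22 Φ₂ Ψ₂ a2 c2 d2 e2, hr₂]

end Product

/-! ### The split case -/

section Split

variable {R : Type*} [CommRing R]

local notation "M₃" R => Matrix (Fin 3) (Fin 3) R

/-- The right ideal of `M₃(R)` of matrices with all columns in `U`. -/
def colIdeal (U : Submodule R (Fin 3 → R)) : Submodule R (M₃ R) where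
  carrier := {a | ∀ j, a.col j ∈ U}
  add_mem' hx hy j := add_mem (hx j) (hy j)
  zero_mem' _ := zero_mem U
  smul_mem' r _ hx j := U.smul_mem r (hx j)

lemma mem_splitIdeal {U W : Submodule R (Fin 3 → R)} {x : (M₃ R) × (M₃ R)} :
    x ∈ splitIdeal U W ↔ x.1 ∈ colIdeal U ∧ x.2 ∈ colIdeal W := forall_and

lemma col_vecMulVec (u w : Fin 3 → R) (j : Fin 3) :
    (Matrix.vecMulVec u w).col j = w j • u := by
  ext i; simp [Matrix.vecMulVec_apply, mul_comm]

lemma vecMulVec_mem_colIdeal {U : Submodule R (Fin 3 → R)} {u : Fin 3 → R} (hu : u ∈ U)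
    (w : Fin 3 → R) : Matrix.vecMulVec u w ∈ colIdeal U := fun j => by
  rw [col_vecMulVec]; exact U.smul_mem _ hu

lemma eq_sum_vecMulVec_col (a : M₃ R) :
    a = ∑ j, Matrix.vecMulVec (a.col j) (Pi.single j 1) := by
  ext i k
  simp [Matrix.sum_apply, Matrix.vecMulVec_apply, Pi.single_apply]

lemma col_mul (a c : M₃ R) (j : Fin 3) : (a * c).col j = ∑ k, c k j • a.col k := by
  ext i; simp [Matrix.mul_apply, mul_comm]

lemma mul_mem_colIdeal {U : Submodule R (Fin 3 → R)} {a : M₃ R} (ha : a ∈ colIdeal U)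
    (c : M₃ R) : a * c ∈ colIdeal U := fun j => by
  rw [col_mul]; exact Submodule.sum_mem _ fun k _ => U.smul_mem _ (ha k)

lemma colIdeal_injective : Function.Injective (colIdeal (R := R)) := by
  intro U U' h
  ext u
  have key : ∀ U : Submodule R (Fin 3 → R),
      u ∈ U ↔ Matrix.vecMulVec u (Pi.single 0 1) ∈ colIdeal U := by
    refine fun U => ⟨fun hu => vecMulVec_mem_colIdeal hu _, fun hu => ?_⟩
    simpa [col_vecMulVec] using hu 0
  rw [key, h, ← key]

lemma splitIdeal_injective {U W U' W' : Submodule R (Fin 3 → R)}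
    (h : splitIdeal U W = splitIdeal U' W') : U = U' ∧ W = W' := by
  have key : ∀ x, x ∈ splitIdeal U W ↔ x ∈ splitIdeal U' W' := fun x => by rw [h]
  simp only [mem_splitIdeal] at key
  constructor
  · refine colIdeal_injective (Submodule.ext fun a => ?_)
    simpa using key (a, 0)
  · refine colIdeal_injective (Submodule.ext fun a => ?_)
    simpa using key (0, a)

lemma isRightIdeal_splitIdeal (U W : Submodule R (Fin 3 → R)) : IsRightIdeal (splitIdeal U W) := by
  intro x hx d
  rw [mem_splitIdeal] at hx ⊢
  exact ⟨mul_mem_colIdeal hx.1 _, mul_mem_colIdeal hx.2 _⟩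

/-- A matrix all of whose columns vanish except possibly the zeroth one. -/
def zerothCol : (Fin 3 → R) →ₗ[R] M₃ R where
  toFun u := Matrix.vecMulVec u (Pi.single 0 1)
  map_add' u v := Matrix.add_vecMulVec u v _
  map_smul' r u := Matrix.smul_vecMulVec r u _

/-- Every right ideal `J` of `M₃(R) × M₃(R)` is given by two submodules of `R³`: multiplication by
matrix units from the right moves the columns of the elements of `J` to any position, so `J` is
determined by its elements that are supported in the zeroth column. -/
lemma exists_eq_splitIdeal {J : Submodule R ((M₃ R) × (M₃ R))} (hJ : IsRightIdeal J) :
    ∃ U W, J = splitIdeal U W := by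
  let U : Submodule R (Fin 3 → R) := J.comap (LinearMap.inl R _ _ ∘ₗ zerothCol)
  let W : Submodule R (Fin 3 → R) := J.comap (LinearMap.inr R _ _ ∘ₗ zerothCol)
  have hsplit : ∀ x : (M₃ R) × (M₃ R), x ∈ J ↔ (x.1, 0) ∈ J ∧ (0, x.2) ∈ J := by
    refine fun x => ⟨fun hx => ⟨?_, ?_⟩, fun hx => ?_⟩
    · simpa [Prod.mul_def] using hJ x hx (1, 0)
    · simpa [Prod.mul_def] using hJ x hx (0, 1)
    · simpa using add_mem hx.1 hx.2
  have hmul : ∀ (u : Fin 3 → R) (i j : Fin 3), Matrix.vecMulVec u (Pi.single i 1) *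
      Matrix.vecMulVec (Pi.single i 1) (Pi.single j 1) = Matrix.vecMulVec u (Pi.single j 1) := by
    intro u i j
    rw [Matrix.vecMulVec_mul_vecMulVec]
    simp
  have hcol : ∀ (a : M₃ R) (i : Fin 3), a * Matrix.vecMulVec (Pi.single i 1) (Pi.single 0 1) =
      zerothCol (a.col i) := by
    intro a i
    rw [Matrix.mul_vecMulVec]
    simp [zerothCol]
  refine ⟨U, W, Submodule.ext fun x => ?_⟩
  rw [hsplit, mem_splitIdeal]
  refine and_congr ⟨fun h j => ?_, fun h => ?_⟩ ⟨fun h j => ?_, fun h => ?_⟩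
  · have := hJ _ h (Matrix.vecMulVec (Pi.single j 1) (Pi.single 0 1), 0)
    rw [Prod.mk_mul_mk, hcol, mul_zero] at this
    exact this
  · have hx : (x.1, (0 : M₃ R)) = ∑ j, (zerothCol (x.1.col j), (0 : M₃ R)) *
        (Matrix.vecMulVec (Pi.single 0 1) (Pi.single j 1), 0) := by
      simp only [Prod.mk_mul_mk, zerothCol, LinearMap.coe_mk, AddHom.coe_mk, hmul, mul_zero]
      conv_lhs => rw [eq_sum_vecMulVec_col x.1]
      ext <;> simp [Prod.fst_sum, Prod.snd_sum]
    rw [hx]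
    exact Submodule.sum_mem _ fun j _ => hJ _ (h j) _
  · have := hJ _ h (0, Matrix.vecMulVec (Pi.single j 1) (Pi.single 0 1))
    rw [Prod.mk_mul_mk, hcol, mul_zero] at this
    exact this
  · have hx : ((0 : M₃ R), x.2) = ∑ j, ((0 : M₃ R), zerothCol (x.2.col j)) *
        (0, Matrix.vecMulVec (Pi.single 0 1) (Pi.single j 1)) := by
      simp only [Prod.mk_mul_mk, zerothCol, LinearMap.coe_mk, AddHom.coe_mk, hmul, mul_zero]
      conv_lhs => rw [eq_sum_vecMulVec_col x.2]
      ext <;> simp [Prod.fst_sum, Prod.snd_sum]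
    rw [hx]
    exact Submodule.sum_mem _ fun j _ => hJ _ (h j) _

/-- `colIdeal U` is `U³`. -/
def colIdealEquiv (U : Submodule R (Fin 3 → R)) : colIdeal U ≃ₗ[R] (Fin 3 → U) where
  toFun a j := ⟨a.1.col j, a.2 j⟩
  invFun u := ⟨Matrix.of fun i j => (u j).1 i, fun j => (u j).2⟩
  map_add' _ _ := rfl
  map_smul' _ _ := rfl
  left_inv _ := rfl
  right_inv _ := rfl

/-- As `colIdeal U` is `U³`, it has rank three exactly when `U` has rank one. -/
lemma isSummandOfRank_colIdeal_iff {U : Submodule R (Fin 3 → R)} :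
    IsSummandOfRank 3 (colIdeal U) ↔ IsSummandOfRank 1 U := by
  have hrank : ∀ [Module.Finite R U] [Module.Projective R U] (P : PrimeSpectrum R),
      Module.rankAtStalk (R := R) (colIdeal U) P = 3 * Module.rankAtStalk (R := R) U P := by
    intro _ _ P
    rw [Module.rankAtStalk_eq_of_equiv (colIdealEquiv U)]
    exact (Module.rankAtStalk_pi (fun _ : Fin 3 => U) P).trans (by
      rw [finsum_eq_sum_of_fintype]; simp)
  constructor
  · rintro ⟨⟨C, hC⟩, hfin, hproj, hr⟩
    let r : (Fin 3 → R) →ₗ[R] U :=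
      LinearMap.proj 0 ∘ₗ (colIdealEquiv U).toLinearMap ∘ₗ (colIdeal U).projectionOnto C hC ∘ₗ
        zerothCol
    have hr' : ∀ x, r (U.subtype x) = x := by
      intro x
      have := Submodule.projectionOnto_apply_left hC
        ⟨zerothCol x.1, vecMulVec_mem_colIdeal x.2 _⟩
      change colIdealEquiv U ((colIdeal U).projectionOnto C hC (zerothCol x.1)) 0 = x
      rw [this]
      ext i
      change Matrix.vecMulVec x.1 (Pi.single 0 1) i 0 = x.1 i
      simp [Matrix.vecMulVec_apply]
    have hUfin : Module.Finite R U := Module.Finite.of_surjective r fun x => ⟨_, hr' x⟩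
    have hUproj : Module.Projective R U :=
      Module.Projective.of_split U.subtype r (LinearMap.ext hr')
    refine ⟨⟨LinearMap.ker r, by simpa using isCompl_range_ker U.subtype r hr'⟩, hUfin, hUproj,
      fun P => ?_⟩
    have := hr P
    rw [hrank] at this
    omega
  · rintro ⟨⟨C, hC⟩, hfin, hproj, hr⟩
    let r : (M₃ R) →ₗ[R] colIdeal U :=
      (colIdealEquiv U).symm.toLinearMap ∘ₗ LinearMap.pi fun j =>
        U.projectionOnto C hC ∘ₗ
          { toFun a := a.col j, map_add' _ _ := rfl, map_smul' _ _ := rfl }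
    have hr' : ∀ x, r ((colIdeal U).subtype x) = x := by
      intro x
      apply (colIdealEquiv U).injective
      ext j : 1
      have := Submodule.projectionOnto_apply_left hC ⟨x.1.col j, x.2 j⟩
      simp only [r, LinearMap.comp_apply, LinearEquiv.coe_coe, LinearEquiv.apply_symm_apply]
      exact this
    refine ⟨⟨LinearMap.ker r, by simpa using isCompl_range_ker (colIdeal U).subtype r hr'⟩,
      Module.Finite.of_surjective r fun x => ⟨_, hr' x⟩,
      Module.Projective.of_split (colIdeal U).subtype r (LinearMap.ext hr'), fun P => ?_⟩
    rw [hrank, hr]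

lemma stdBasis_repr (a : M₃ R) (p : Fin 3 × Fin 3) :
    (Matrix.stdBasis R (Fin 3) (Fin 3)).repr a p = a p.1 p.2 := by
  simp [Matrix.stdBasis, Pi.basis, Pi.basisFun_repr]

/-- It suffices to check the properties of a line on generators. -/
lemma isLine_span {ι M : Type*} [AddCommGroup M] [Module R M] {b : Module.Basis ι R M} {s : Set M}
    (h : ∀ v ∈ s, ∀ w ∈ s, ∀ i j, b.repr v i * b.repr w j = b.repr v j * b.repr w i)
    (htop : Ideal.span {x | ∃ v ∈ s, ∃ i, b.repr v i = x} = ⊤) :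
    IsLine b (Submodule.span R s) := by
  constructor
  · intro v hv w hw i j
    induction hv, hw using Submodule.span_induction₂ with
    | mem_mem v w hv hw => exact h v hv w hw i j
    | zero_left => simp
    | zero_right => simp
    | add_left x y z _ _ _ hx hy => simp only [map_add, Finsupp.add_apply, add_mul, hx, hy]
    | add_right x y z _ _ _ hx hy => simp only [map_add, Finsupp.add_apply, mul_add, hx, hy]
    | smul_left r x y _ _ hx =>
      simp only [map_smul, Finsupp.smul_apply, smul_eq_mul]
      linear_combination r * hx
    | smul_right r x y _ _ hx =>
      simp only [map_smul, Finsupp.smul_apply, smul_eq_mul]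
      linear_combination r * hx
  · rw [eq_top_iff, ← htop]
    refine Ideal.span_mono ?_
    rintro _ ⟨v, hv, i, rfl⟩
    exact ⟨v, Submodule.subset_span hv, i, rfl⟩

lemma isLine_pi_iff {U : Submodule R (Fin 3 → R)} : IsSummandOfRank 1 U ↔
    (∀ v ∈ U, ∀ w ∈ U, ∀ i j, v i * w j = v j * w i) ∧
      Ideal.span {x | ∃ v ∈ U, ∃ i, v i = x} = ⊤ := by
  rw [isSummandOfRank_one_iff (Pi.basisFun R (Fin 3))]
  exact ⟨fun h => ⟨fun v hv w hw i j => by simpa using h.1 v hv w hw i j, by simpa using h.2⟩,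
    fun h => ⟨fun v hv w hw i j => by simpa using h.1 v hv w hw i j, by simpa using h.2⟩⟩

lemma isLine_matrix_iff {M : Submodule R (M₃ R)} : IsSummandOfRank 1 M ↔
    (∀ v ∈ M, ∀ w ∈ M, ∀ i j k l, v i j * w k l = v k l * w i j) ∧
      Ideal.span {x | ∃ v ∈ M, ∃ i j, v i j = x} = ⊤ := by
  rw [isSummandOfRank_one_iff (Matrix.stdBasis R (Fin 3) (Fin 3))]
  have hset : {x | ∃ v ∈ M, ∃ p, (Matrix.stdBasis R (Fin 3) (Fin 3)).repr v p = x} =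
      {x | ∃ v ∈ M, ∃ i j, v i j = x} := by
    simp [stdBasis_repr, Prod.exists]
  refine ⟨fun h => ⟨fun v hv w hw i j k l => ?_, hset ▸ h.2⟩,
    fun h => ⟨fun v hv w hw i j => ?_, hset ▸ h.2⟩⟩
  · simpa [stdBasis_repr] using h.1 v hv w hw (i, j) (k, l)
  · simpa [stdBasis_repr] using h.1 v hv w hw i.1 i.2 j.1 j.2

/-! ### The Segre embedding and matrices of rank one -/

/-- All `2 × 2` minors of the matrices in `M` vanish, in polarized form. -/
def IsRankOne (M : Submodule R (M₃ R)) : Prop :=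
  ∀ m ∈ M, ∀ m' ∈ M, ∀ i j a c, m i a * m' j c = m i c * m' j a

/-- The cubic identity `ℓ₁ x ℓ₂ y ℓ₃ = ℓ₁ y ℓ₂ x ℓ₃` for elements of `N`. For a line of matrices
it says that the matrices have rank one, but it makes no reference to a matrix description. -/
def IsSandwichSymm {A : Type*} [Ring A] [Algebra R A] (N : Submodule R A) : Prop :=
  ∀ l₁ ∈ N, ∀ l₂ ∈ N, ∀ l₃ ∈ N, ∀ x y, l₁ * x * l₂ * y * l₃ = l₁ * y * l₂ * x * l₃

/-- If the coordinates of the elements of `U` and those of the elements of `W` generate the unit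
ideal, then so do their products. -/
lemma isSummandOfRank_segreProduct {U W : Submodule R (Fin 3 → R)} (hU : IsSummandOfRank 1 U)
    (hW : IsSummandOfRank 1 W) : IsSummandOfRank 1 (segreProduct U W) := by
  rw [isLine_pi_iff] at hU hW
  refine IsLine.isSummandOfRank (b := Matrix.stdBasis R (Fin 3) (Fin 3)) (isLine_span ?_ ?_)
  · rintro _ ⟨u, hu, w, hw, rfl⟩ _ ⟨u', hu', w', hw', rfl⟩ ⟨i, a⟩ ⟨j, c⟩
    simp only [stdBasis_repr, Matrix.vecMulVec_apply]
    linear_combination w a * w' c * hU.1 u hu u' hu' i j + u j * u' i * hW.1 w hw w' hw' a c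
  · have htop : (⊤ : Ideal R) = Ideal.span {x | ∃ v ∈ U, ∃ i, v i = x} *
        Ideal.span {x | ∃ v ∈ W, ∃ i, v i = x} := by
      rw [hU.2, hW.2, Ideal.mul_top]
    rw [eq_top_iff, htop, Ideal.span_mul_span', Ideal.span_le]
    rintro _ ⟨_, ⟨u, hu, i, rfl⟩, _, ⟨w, hw, j, rfl⟩, rfl⟩
    refine Ideal.subset_span ⟨_, ⟨u, hu, w, hw, rfl⟩, (i, j), ?_⟩
    simp [stdBasis_repr, Matrix.vecMulVec_apply]

/-- Already proportionality in the second factor makes the minors of `u wᵗ` and `u' w'ᵗ` vanish. -/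
lemma isRankOne_segreProduct {U W : Submodule R (Fin 3 → R)} (hW : IsSummandOfRank 1 W) :
    IsRankOne (segreProduct U W) := by
  rw [isLine_pi_iff] at hW
  intro m hm m' hm' i j a c
  induction hm, hm' using Submodule.span_induction₂ with
  | mem_mem m m' hm hm' =>
    obtain ⟨u, hu, w, hw, rfl⟩ := hm
    obtain ⟨u', hu', w', hw', rfl⟩ := hm'
    simp only [Matrix.vecMulVec_apply]
    linear_combination u i * u' j * hW.1 w hw w' hw' a c
  | zero_left => simp
  | zero_right => simp
  | add_left x y z _ _ _ hx hy => simp only [Matrix.add_apply, add_mul, hx, hy]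
  | add_right x y z _ _ _ hx hy => simp only [Matrix.add_apply, mul_add, hx, hy]
  | smul_left r x y _ _ hx =>
    simp only [Matrix.smul_apply, smul_eq_mul]
    linear_combination r * hx
  | smul_right r x y _ _ hx =>
    simp only [Matrix.smul_apply, smul_eq_mul]
    linear_combination r * hx

lemma IsRankOne.isSandwichSymm {M : Submodule R (M₃ R)} (hM : IsSummandOfRank 1 M)
    (h : IsRankOne M) : IsSandwichSymm M := by
  rw [isLine_matrix_iff] at hM
  intro m hm m' hm' m'' hm'' x y
  ext i j
  simp only [Matrix.mul_apply, Finset.sum_mul]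
  have hterm : ∀ a b c d, m i a * x a b * m' b c * y c d * m'' d j =
      m i c * y c d * m' d a * x a b * m'' b j := by
    intro a b c d
    linear_combination x a b * y c d * (m'' d j * h m hm m' hm' i b a c +
      m i c * hM.1 m' hm' m'' hm'' b a d j + m i c * h m' hm' m'' hm'' d b j a)
  calc _ = ∑ d, ∑ c, ∑ b, ∑ a, m i c * y c d * m' d a * x a b * m'' b j := by
        simp only [hterm]
    _ = ∑ d, ∑ b, ∑ c, ∑ a, m i c * y c d * m' d a * x a b * m'' b j :=
        Finset.sum_congr rfl fun d _ => Finset.sum_comm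
    _ = ∑ b, ∑ d, ∑ c, ∑ a, m i c * y c d * m' d a * x a b * m'' b j := Finset.sum_comm
    _ = ∑ b, ∑ d, ∑ a, ∑ c, m i c * y c d * m' d a * x a b * m'' b j :=
        Finset.sum_congr rfl fun b _ => Finset.sum_congr rfl fun d _ => Finset.sum_comm
    _ = _ := Finset.sum_congr rfl fun b _ => Finset.sum_comm

/-- Locally on `R` some entry of a matrix `v` in the line is invertible. The sandwich identity then
expresses `v` by a row and a column, and all elements of the line are proportional to `v`. To avoid
localization, the minors are shown to be annihilated by the sixth powers of the entries of all such
`v`, which still generate the unit ideal. -/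
lemma IsSandwichSymm.isRankOne {M : Submodule R (M₃ R)} (hM : IsSummandOfRank 1 M)
    (h : IsSandwichSymm M) : IsRankOne M := by
  rw [isLine_matrix_iff] at hM
  obtain ⟨hprop, htop⟩ := hM
  -- the identity for matrix units permutes three column indices cyclically
  have hcyc : ∀ m ∈ M, ∀ i a b c d j, m i a * m b c * m d j = m i c * m d a * m b j := by
    intro m hm i a b c d j
    have := congrFun (congrFun (h m hm m hm m hm (Matrix.single a b 1) (Matrix.single c d 1)) i) j
    simpa [Matrix.mul_apply, Matrix.single_apply, ite_and, Finset.sum_ite_eq] using this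
  intro m hm m' hm' i j a c
  have hspan := Ideal.span_pow_eq_top _ htop 6
  rw [← sub_eq_zero]
  have hann : ∀ r ∈ Ideal.span ((· ^ 6) '' {x | ∃ v ∈ M, ∃ i j, v i j = x}),
      r * (m i a * m' j c - m i c * m' j a) = 0 := by
    intro r hr
    refine Submodule.span_induction (p := fun r _ => r * (m i a * m' j c - m i c * m' j a) = 0)
      ?_ (zero_mul _) (fun x y _ _ hx hy => by rw [add_mul, hx, hy, add_zero])
      (fun s x _ hx => by rw [smul_eq_mul, mul_assoc, hx, mul_zero]) hr
    rintro _ ⟨_, ⟨v, hv, d, k, rfl⟩, rfl⟩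
    -- where the entry `v d k` is invertible, `v` is determined by its row `d` and column `k`
    have h1 : ∀ i a, v d k * (v d k * v i a) = v d k * (v d a * v i k) := by
      intro i a
      linear_combination hcyc v hv d k i a d k
    have e1 := hprop v hv m hm d k
    have e2 := hprop v hv m' hm' d k
    have hm1 : ∀ i a, v d k * m i a = m d k * v i a := fun i a => by
      linear_combination e1 i a
    have hm2 : ∀ i a, v d k * m' i a = m' d k * v i a := fun i a => by
      linear_combination e2 i a
    have key : v d k ^ 4 * (v i a * v j c - v i c * v j a) = 0 := by
      linear_combination (v d k * v d k * v j c) * h1 i a - (v d k * v d k * v j a) * h1 i c +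
        (v d k * v d a * v i k) * h1 j c - (v d k * v d c * v i k) * h1 j a
    simp only
    linear_combination (m d k * m' d k) * key + v d k ^ 4 * (v d k * m' j c * hm1 i a +
      m d k * v i a * hm2 j c - v d k * m' j a * hm1 i c - m d k * v i c * hm2 j a)
  have := hann 1 (hspan ▸ Submodule.mem_top)
  rwa [one_mul] at this

/-- A line of matrices of rank one is in the image of the Segre embedding. -/
lemma IsRankOne.exists_eq_segreProduct {M : Submodule R (M₃ R)} (hM : IsSummandOfRank 1 M)
    (h : IsRankOne M) : ∃ U W : Submodule R (Fin 3 → R), IsSummandOfRank 1 U ∧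
      IsSummandOfRank 1 W ∧ M = segreProduct U W := by
  have hM' := isLine_matrix_iff.1 hM
  let s : Set (Fin 3 → R) := {u | ∃ m ∈ M, ∃ a, u = m.col a}
  let t : Set (Fin 3 → R) := {w | ∃ m ∈ M, ∃ i, w = m.row i}
  have hU : IsSummandOfRank 1 (Submodule.span R s) := by
    refine (isLine_span (b := Pi.basisFun R (Fin 3)) ?_ ?_).isSummandOfRank
    · rintro _ ⟨m, hm, a, rfl⟩ _ ⟨m', hm', c, rfl⟩ i j
      simp only [Pi.basisFun_repr, Matrix.col_apply]
      linear_combination h m hm m' hm' i j a c + hM'.1 m hm m' hm' i c j a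
    · rw [eq_top_iff, ← hM'.2]
      refine Ideal.span_mono ?_
      rintro _ ⟨m, hm, i, a, rfl⟩
      exact ⟨_, ⟨m, hm, a, rfl⟩, i, by simp⟩
  have hW : IsSummandOfRank 1 (Submodule.span R t) := by
    refine (isLine_span (b := Pi.basisFun R (Fin 3)) ?_ ?_).isSummandOfRank
    · rintro _ ⟨m, hm, i, rfl⟩ _ ⟨m', hm', j, rfl⟩ a c
      simp only [Pi.basisFun_repr, Matrix.row_apply]
      exact h m hm m' hm' i j a c
    · rw [eq_top_iff, ← hM'.2]
      refine Ideal.span_mono ?_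
      rintro _ ⟨m, hm, i, a, rfl⟩
      exact ⟨_, ⟨m, hm, i, rfl⟩, a, by simp⟩
  refine ⟨_, _, hU, hW, ?_⟩
  let b := Matrix.stdBasis R (Fin 3) (Fin 3)
  have hS := (isSummandOfRank_segreProduct hU hW).isLine b
  refine (hM.isLine b).eq_of_le hS (hS.le_of_proportional ?_)
  intro v hv w hw
  rintro ⟨i, j⟩ ⟨k, l⟩
  simp only [b, stdBasis_repr]
  induction hv using Submodule.span_induction with
  | zero => simp
  | add x y _ _ hx hy => simp only [Matrix.add_apply, add_mul, hx, hy]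
  | smul r x _ hx =>
    simp only [Matrix.smul_apply, smul_eq_mul]
    linear_combination r * hx
  | mem x hx =>
    obtain ⟨u, hu, u', hu', rfl⟩ := hx
    simp only [Matrix.vecMulVec_apply]
    induction hu, hu' using Submodule.span_induction₂ with
    | zero_left => simp
    | zero_right => simp
    | add_left x y z _ _ _ hx hy => simp only [Pi.add_apply, add_mul, hx, hy]
    | add_right x y z _ _ _ hx hy => simp only [Pi.add_apply, mul_add, add_mul, hx, hy]
    | smul_left r x y _ _ hx =>
      simp only [Pi.smul_apply, smul_eq_mul]
      linear_combination r * hx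
    | smul_right r x y _ _ hx =>
      simp only [Pi.smul_apply, smul_eq_mul]
      linear_combination r * hx
    | mem_mem x y hx hy =>
      obtain ⟨m₁, hm₁, a, rfl⟩ := hx
      obtain ⟨m₂, hm₂, c, rfl⟩ := hy
      simp only [Matrix.col_apply, Matrix.row_apply]
      linear_combination m₂ c j * h m₁ hm₁ w hw i k a l + m₂ c j * hM'.1 m₁ hm₁ w hw i l k a +
        m₁ k a * h w hw m₂ hm₂ i c l j

/-! ### The construction `I ↦ (I · τ I) ∩ Sym` in the split case -/

variable {σ : (M₃ R) × (M₃ R) →ₗ[R] (M₃ R) × (M₃ R)}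

/-- In the split case `(I · τ I) ∩ Sym` is the Segre product `U ⊗ W`: the first component of
`x · σ y` is the sum of the products of the columns of `x₁`, which lie in `U`, and the columns of
`y₂`, which lie in `W`. -/
lemma symPart_splitIdeal (hσ : ∀ x, σ x = exchange x) (U W : Submodule R (Fin 3 → R)) :
    symPart σ (splitIdeal U W) = (segreProduct U W).map symEmbedding := by
  apply le_antisymm
  · rintro ⟨a, b⟩ ⟨hab, hsym⟩
    have hsym : σ (a, b) = (a, b) := hsym
    rw [hσ] at hsym
    have hb : b = a.transpose := ((Prod.ext_iff.1 hsym).2).symm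
    refine ⟨a, ?_, by simp [symEmbedding, hb]⟩
    have key : ∀ x ∈ splitIdeal U W * (splitIdeal U W).map σ, x.1 ∈ segreProduct U W := by
      intro x hx
      induction hx using Submodule.mul_induction_on' with
      | mem_mul_mem x hx y hy =>
        obtain ⟨y, hy, rfl⟩ := hy
        have hxy : (x * σ y).1 = ∑ k, Matrix.vecMulVec (x.1.col k) (y.2.col k) := by
          ext i j
          simp [hσ, exchange, Matrix.mul_apply, Matrix.sum_apply, Matrix.vecMulVec_apply]
        rw [hxy]
        exact Submodule.sum_mem _ fun k _ =>
          Submodule.subset_span ⟨_, (hx k).1, _, (hy k).2, rfl⟩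
      | add x _ y _ hx hy => exact add_mem hx hy
    exact key _ hab
  · rw [Submodule.map_le_iff_le_comap, segreProduct, Submodule.span_le]
    rintro _ ⟨u, hu, w, hw, rfl⟩
    let e : Fin 3 → R := Pi.single 0 1
    have hx : (Matrix.vecMulVec u e, Matrix.vecMulVec w e) ∈ splitIdeal U W :=
      mem_splitIdeal.2 ⟨vecMulVec_mem_colIdeal hu _, vecMulVec_mem_colIdeal hw _⟩
    refine ⟨?_, ?_⟩
    · have : symEmbedding (Matrix.vecMulVec u w) = (Matrix.vecMulVec u e, Matrix.vecMulVec w e) *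
          σ (Matrix.vecMulVec u e, Matrix.vecMulVec w e) := by
        simp [symEmbedding, hσ, exchange, Matrix.transpose_vecMulVec,
          Matrix.vecMulVec_mul_vecMulVec, e]
      rw [this]
      exact Submodule.mul_mem_mul hx ⟨_, hx, rfl⟩
    · change σ _ = _
      simp [hσ, exchange, symEmbedding]

/-- In the split case the ideal is the right ideal generated by the line `(I · τ I) ∩ Sym`. -/
lemma map_symEmbedding_mul_top {U W : Submodule R (Fin 3 → R)} (hU : IsSummandOfRank 1 U)
    (hW : IsSummandOfRank 1 W) :
    (segreProduct U W).map symEmbedding * ⊤ = splitIdeal U W := by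
  apply le_antisymm
  · rw [Submodule.mul_le]
    intro x hx y _
    refine isRightIdeal_splitIdeal U W x ?_ y
    revert x
    change (segreProduct U W).map symEmbedding ≤ _
    rw [Submodule.map_le_iff_le_comap, segreProduct, Submodule.span_le]
    rintro _ ⟨u, hu, w, hw, rfl⟩
    refine mem_splitIdeal.2 ⟨vecMulVec_mem_colIdeal hu _, ?_⟩
    simpa [symEmbedding, Matrix.transpose_vecMulVec] using vecMulVec_mem_colIdeal hw _
  · set P := (segreProduct U W).map symEmbedding * ⊤
    have hmem : ∀ u ∈ U, ∀ w ∈ W, ∀ c d : M₃ R,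
        (Matrix.vecMulVec u w * c, Matrix.vecMulVec w u * d) ∈ P := by
      intro u hu w hw c d
      have : (Matrix.vecMulVec u w * c, Matrix.vecMulVec w u * d) =
          symEmbedding (Matrix.vecMulVec u w) * (c, d) := by
        simp [symEmbedding, Matrix.transpose_vecMulVec]
      rw [this]
      exact Submodule.mul_mem_mul ⟨_, Submodule.subset_span ⟨u, hu, w, hw, rfl⟩, rfl⟩ trivial
    have hmul : ∀ (u w e : Fin 3 → R) (i : Fin 3),
        Matrix.vecMulVec u w * Matrix.vecMulVec (Pi.single i 1) e = w i • Matrix.vecMulVec u e := by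
      intro u w e i
      rw [Matrix.vecMulVec_mul_vecMulVec]
      ext a c
      simp [Matrix.vecMulVec_apply]; ring
    have h1 : ∀ u ∈ U, ∀ e : Fin 3 → R, (Matrix.vecMulVec u e, 0) ∈ P := by
      intro u hu e
      let J : Ideal R := P.comap (LinearMap.toSpanSingleton R _ (Matrix.vecMulVec u e, 0))
      have hJ : J = ⊤ := by
        rw [eq_top_iff, ← (isLine_pi_iff.1 hW).2, Ideal.span_le]
        rintro _ ⟨w, hw, i, rfl⟩
        have := hmem u hu w hw (Matrix.vecMulVec (Pi.single i 1) e) 0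
        rw [hmul, mul_zero] at this
        change w i • (Matrix.vecMulVec u e, (0 : M₃ R)) ∈ P
        rwa [Prod.smul_mk, smul_zero]
      have : (1 : R) ∈ J := hJ ▸ Submodule.mem_top
      simpa [J] using this
    have h2 : ∀ w ∈ W, ∀ e : Fin 3 → R, (0, Matrix.vecMulVec w e) ∈ P := by
      intro w hw e
      let J : Ideal R := P.comap (LinearMap.toSpanSingleton R _ (0, Matrix.vecMulVec w e))
      have hJ : J = ⊤ := by
        rw [eq_top_iff, ← (isLine_pi_iff.1 hU).2, Ideal.span_le]
        rintro _ ⟨u, hu, i, rfl⟩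
        have := hmem u hu w hw 0 (Matrix.vecMulVec (Pi.single i 1) e)
        rw [hmul, mul_zero] at this
        change u i • ((0 : M₃ R), Matrix.vecMulVec w e) ∈ P
        rwa [Prod.smul_mk, smul_zero]
      have : (1 : R) ∈ J := hJ ▸ Submodule.mem_top
      simpa [J] using this
    rintro ⟨a, c⟩ hac
    have : (a, c) = ∑ j, ((Matrix.vecMulVec (a.col j) (Pi.single j 1), (0 : M₃ R)) +
        ((0 : M₃ R), Matrix.vecMulVec (c.col j) (Pi.single j 1))) := by
      simp only [Prod.mk_add_mk, add_zero, zero_add]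
      refine Prod.ext ?_ ?_
      · rw [Prod.fst_sum]; exact eq_sum_vecMulVec_col a
      · rw [Prod.snd_sum]; exact eq_sum_vecMulVec_col c
    rw [this]
    exact Submodule.sum_mem _ fun j _ => add_mem (h1 _ (hac j).1 _) (h2 _ (hac j).2 _)

end Split

/-! ### Weil restriction in terms of right ideals of `R ⊗ B` -/

section Weil

variable {F K B : Type u} [Field F] [CommRing K] [Algebra F K] [Ring B] [Algebra K B]
  [Algebra F B] [IsScalarTower F K B] {R R' : Type u} [CommRing R] [Algebra F R]
  [CommRing R'] [Algebra F R']

variable (F K B R) in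
/-- The central homomorphism `K ⊗ R → R ⊗ B`. -/
noncomputable def scalarHom : K ⊗[F] R →ₐ[F] R ⊗[F] B :=
  (Algebra.TensorProduct.map (AlgHom.id F R) (IsScalarTower.toAlgHom F K B)).comp
    (Algebra.TensorProduct.comm F K R).toAlgHom

lemma scalarHom_tmul (c : K) (r : R) :
    scalarHom F K B R (c ⊗ₜ r) = r ⊗ₜ algebraMap K B c := by
  simp [scalarHom]

lemma scalarHom_mul_comm (s : K ⊗[F] R) (x : R ⊗[F] B) :
    scalarHom F K B R s * x = x * scalarHom F K B R s := by
  induction s with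
  | zero => simp
  | add s s' hs hs' => simp only [map_add, add_mul, mul_add, hs, hs']
  | tmul c r =>
    induction x with
    | zero => simp
    | add x y hx hy => simp only [add_mul, mul_add, hx, hy]
    | tmul r' b =>
      simp only [scalarHom_tmul, Algebra.TensorProduct.tmul_mul_tmul, mul_comm r r',
        Algebra.commutes c b]

lemma scalarHom_injective [FaithfulSMul K B] : Function.Injective (scalarHom F K B R) := by
  have h : Function.Injective (IsScalarTower.toAlgHom F K B).toLinearMap :=
    FaithfulSMul.algebraMap_injective K B
  have := Module.Flat.lTensor_preserves_injective_linearMap (M := R) _ h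
  exact this.comp (Algebra.TensorProduct.comm F K R).injective

lemma toWeil_scalarHom_mul (s : K ⊗[F] R) (x : R ⊗[F] B) :
    toWeil F K B R (scalarHom F K B R s * x) = s • toWeil F K B R x := by
  induction s with
  | zero => simp
  | add s s' hs hs' => simp only [map_add, add_mul, add_smul, hs, hs']
  | tmul c r =>
    induction x with
    | zero => simp
    | add x y hx hy => simp only [map_add, mul_add, smul_add, hx, hy]
    | tmul r' b =>
      rw [scalarHom_tmul, Algebra.TensorProduct.tmul_mul_tmul, toWeil_tmul, toWeil_tmul,
        ← Algebra.smul_def, tmul_smul, smul_tmul', smul_tmul']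
      congr 1
      simp

variable (F K B R) in
lemma toWeil_bijective : Function.Bijective (toWeil F K B R) := by
  let L : R ⊗[F] B ≃ₗ[F] (K ⊗[F] R) ⊗[K] B :=
    TensorProduct.comm F R B ≪≫ₗ
      (AlgebraTensorModule.cancelBaseChange F K K B R).symm.restrictScalars F ≪≫ₗ
      (TensorProduct.comm K B (K ⊗[F] R)).restrictScalars F
  have : ∀ x, toWeil F K B R x = L x := by
    intro x
    induction x with
    | zero => simp
    | add x y hx hy => simp only [map_add, hx, hy]
    | tmul r b => rw [toWeil_tmul]; simp [L]
  rw [show ⇑(toWeil F K B R) = L from funext this]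
  exact L.bijective

/-- A right ideal of `R ⊗ B` as a `K ⊗ R`-submodule of `(K ⊗ R) ⊗ B`. -/
def weilModule (J : Submodule R (R ⊗[F] B)) (hJ : IsRightIdeal J) :
    Submodule (K ⊗[F] R) ((K ⊗[F] R) ⊗[K] B) where
  carrier := toWeil F K B R '' J
  add_mem' := by
    rintro _ _ ⟨x, hx, rfl⟩ ⟨y, hy, rfl⟩
    exact ⟨x + y, add_mem hx hy, map_add _ _ _⟩
  zero_mem' := ⟨0, zero_mem J, map_zero _⟩
  smul_mem' := by
    rintro s _ ⟨x, hx, rfl⟩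
    exact ⟨x * scalarHom F K B R s, hJ x hx _, by
      rw [← scalarHom_mul_comm, toWeil_scalarHom_mul]⟩

lemma toWeil_mem_weilModule {J : Submodule R (R ⊗[F] B)} {hJ : IsRightIdeal J} {x : R ⊗[F] B} :
    toWeil F K B R x ∈ weilModule (K := K) J hJ ↔ x ∈ J :=
  (toWeil_bijective F K B R).1.mem_set_image

lemma isRightIdeal_weilModule {J : Submodule R (R ⊗[F] B)} (hJ : IsRightIdeal J) :
    IsRightIdeal (weilModule (K := K) J hJ) := by
  rintro _ ⟨x, hx, rfl⟩ d
  obtain ⟨y, rfl⟩ := (toWeil_bijective F K B R).2 d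
  exact ⟨x * y, hJ x hx y, map_mul _ _ _⟩

lemma isRightIdeal_idealOf (I : (weilSB F K B).obj (.of F R)) : IsRightIdeal (idealOf I) := by
  intro x hx d
  change toWeil F K B R (x * d) ∈ I.1
  rw [map_mul]
  exact I.2.1 _ hx _

lemma weilModule_idealOf (I : (weilSB F K B).obj (.of F R)) :
    weilModule (idealOf I) (isRightIdeal_idealOf I) = I.1 := by
  refine Submodule.ext fun y => ?_
  obtain ⟨x, rfl⟩ := (toWeil_bijective F K B R).2 y
  exact toWeil_mem_weilModule

lemma idealOf_injective : Function.Injective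
    (idealOf : (weilSB F K B).obj (.of F R) → Submodule R (R ⊗[F] B)) := by
  intro I I' h
  apply Subtype.ext
  refine (weilModule_idealOf I).symm.trans (Eq.trans ?_ (weilModule_idealOf I'))
  congr 1

variable (K) in
/-- The right ideal `J` of `R ⊗ B` is an `R`-point of `R_{K/F} SB(B)`. -/
def IsWeilPoint (J : Submodule R (R ⊗[F] B)) : Prop :=
  ∃ I : (weilSB F K B).obj (.of F R), idealOf I = J

lemma isWeilPoint_iff {J : Submodule R (R ⊗[F] B)} (hJ : IsRightIdeal J) :
    IsWeilPoint K J ↔ IsSummandOfRank 3 (weilModule (K := K) J hJ) := by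
  constructor
  · rintro ⟨I, rfl⟩
    rw [weilModule_idealOf]
    exact I.2.2
  · intro h
    refine ⟨⟨weilModule J hJ, isRightIdeal_weilModule hJ, h⟩, ?_⟩
    ext x
    exact toWeil_mem_weilModule (hJ := hJ)

lemma toWeil_rTensor (f : R →ₐ[F] R') (x : R ⊗[F] B) :
    toWeil F K B R' (f.toLinearMap.rTensor B x) =
      (Algebra.TensorProduct.map (AlgHom.id K K) f).toLinearMap.rTensor B (toWeil F K B R x) := by
  induction x with
  | zero => simp
  | tmul r b => simp [toWeil_tmul]
  | add x y hx hy => simp only [map_add, hx, hy]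

lemma extendSubmodule_weilModule (f : R →ₐ[F] R') {J : Submodule R (R ⊗[F] B)}
    (hJ : IsRightIdeal J) :
    extendSubmodule (Algebra.TensorProduct.map (AlgHom.id K K) f) (weilModule (K := K) J hJ) =
      weilModule (K := K) (extendSubmodule f J) (hJ.extend f) := by
  apply le_antisymm
  · refine extendSubmodule_le.2 ?_
    rintro _ ⟨x, hx, rfl⟩
    rw [← toWeil_rTensor]
    exact ⟨_, rTensor_mem_extendSubmodule f hx, rfl⟩
  · rintro _ ⟨x, hx, rfl⟩
    refine Submodule.span_induction (p := fun x _ => toWeil F K B R' x ∈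
      extendSubmodule (Algebra.TensorProduct.map (AlgHom.id K K) f) (weilModule (K := K) J hJ))
      ?_ ?_ ?_ ?_ hx
    · rintro _ ⟨x, hx, rfl⟩
      rw [toWeil_rTensor]
      exact rTensor_mem_extendSubmodule _ ⟨x, hx, rfl⟩
    · simp
    · intro x y _ _ hx hy
      rw [map_add]; exact add_mem hx hy
    · intro a x _ hx
      rw [toWeil_smul]; exact Submodule.smul_mem _ _ hx

lemma idealOf_map (f : R →ₐ[F] R') (I : (weilSB F K B).obj (.of F R)) :
    idealOf (R := R') ((weilSB F K B).map (CommAlgCat.ofHom f) I) =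
      extendSubmodule f (idealOf I) := by
  ext x
  rw [← toWeil_mem_weilModule (K := K) (hJ := (isRightIdeal_idealOf I).extend f),
    ← extendSubmodule_weilModule f (isRightIdeal_idealOf I), weilModule_idealOf]
  rfl

/-- Points of the Weil restriction descend along `R → R ⊗ E`. -/
lemma isWeilPoint_of_extend {E : Type u} [Field E] [Algebra F E] [Module.Finite K B]
    [Module.Projective K B] {J : Submodule R (R ⊗[F] B)} (hJ : IsRightIdeal J)
    (h : IsWeilPoint K (extendSubmodule (IsScalarTower.toAlgHom F R (R ⊗[F] E)) J)) :
    IsWeilPoint K J := by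
  rw [isWeilPoint_iff (hJ.extend _), ← extendSubmodule_weilModule _ hJ] at h
  rw [isWeilPoint_iff hJ]
  let g : K ⊗[F] R →ₐ[K] K ⊗[F] (R ⊗[F] E) :=
    Algebra.TensorProduct.map (AlgHom.id K K) (IsScalarTower.toAlgHom F R (R ⊗[F] E))
  algebraize [g.toRingHom]
  have : IsScalarTower K (K ⊗[F] R) (K ⊗[F] (R ⊗[F] E)) :=
    IsScalarTower.of_algebraMap_eq fun x => (g.commutes x).symm
  let e : (K ⊗[F] R) ⊗[F] E ≃ₗ[K ⊗[F] R] K ⊗[F] (R ⊗[F] E) :=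
    { toFun := Algebra.TensorProduct.assoc F F F K R E
      invFun := (Algebra.TensorProduct.assoc F F F K R E).symm
      map_add' := map_add _
      map_smul' s x := by
        have h1 : Algebra.TensorProduct.assoc F F F K R E (s ⊗ₜ 1) = g s := by
          induction s with
          | zero => simp
          | add s s' hs hs' => simp only [add_tmul, map_add, hs, hs']
          | tmul c r => simp [g]
        have h2 : s • x = (s ⊗ₜ 1) * x := by
          induction x with
          | zero => simp
          | add x y hx hy => simp only [smul_add, mul_add, hx, hy]
          | tmul a b => simp [smul_tmul']
        rw [h2, map_mul, h1, RingHom.id_apply, Algebra.smul_def]; rfl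
      left_inv := (Algebra.TensorProduct.assoc F F F K R E).left_inv
      right_inv := (Algebra.TensorProduct.assoc F F F K R E).right_inv }
  have : Module.FaithfullyFlat (K ⊗[F] R) (K ⊗[F] (R ⊗[F] E)) :=
    Module.FaithfullyFlat.of_linearEquiv _ _ e.symm
  exact isSummandOfRank_of_extend (S' := K ⊗[F] (R ⊗[F] E)) h

end Weil

/-! ### The centre of `R ⊗ B` -/

section Center

variable {F K B : Type u} [Field F] [CommRing K] [Algebra F K] [Ring B] [Algebra K B]
  [Algebra F B] [IsScalarTower F K B] {R : Type u} [CommRing R] [Algebra F R]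

/-- `K` is a direct summand of the `K`-module `B`. -/
lemma exists_linearMap_one_eq_one [IsSemisimpleRing K] [FaithfulSMul K B] :
    ∃ π : B →ₗ[K] K, π 1 = 1 := by
  obtain ⟨C, hC⟩ := exists_isCompl (LinearMap.range (Algebra.linearMap K B))
  let e : K ≃ₗ[K] LinearMap.range (Algebra.linearMap K B) :=
    LinearEquiv.ofInjective _ (FaithfulSMul.algebraMap_injective K B)
  refine ⟨e.symm.toLinearMap ∘ₗ Submodule.projectionOnto _ C hC, ?_⟩
  have h1 : (1 : B) = (e 1 : B) := (map_one (algebraMap K B)).symm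
  rw [LinearMap.comp_apply, LinearEquiv.coe_coe, h1, Submodule.projectionOnto_apply_left,
    LinearEquiv.symm_apply_apply]

/-- Every endomorphism of the Azumaya algebra `B` is a sum of maps `x ↦ a x b`, hence commutes
with multiplication by central elements. -/
lemma baseChange_apply_of_central [IsAzumaya K B] (h : Module.End K B) {c : R ⊗[F] B}
    (hc : ∀ x, c * x = x * c) :
    (h.restrictScalars F).baseChange R c = c * (1 ⊗ₜ h 1) := by
  obtain ⟨z, rfl⟩ := (IsAzumaya.bij (R := K) (A := B)).2 h
  induction z with
  | zero =>
    have : (0 : Module.End K B).restrictScalars F = 0 := rfl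
    simp [this]
  | add x y hx hy =>
    have : (AlgHom.mulLeftRight K B (x + y)).restrictScalars F =
        (AlgHom.mulLeftRight K B x).restrictScalars F +
        (AlgHom.mulLeftRight K B y).restrictScalars F := by
      rw [map_add]; rfl
    rw [this, LinearMap.baseChange_add, LinearMap.add_apply, hx, hy, map_add, LinearMap.add_apply,
      tmul_add, mul_add]
  | tmul a b =>
    have : ∀ c : R ⊗[F] B,
        ((AlgHom.mulLeftRight K B (a ⊗ₜ b)).restrictScalars F).baseChange R c =
        (1 ⊗ₜ a) * c * (1 ⊗ₜ b.unop) := by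
      intro c
      induction c with
      | zero => simp
      | tmul r x => simp
      | add x y hx hy => simp only [map_add, mul_add, add_mul, hx, hy]
    rw [this, AlgHom.mulLeftRight_apply, ← hc, mul_assoc]
    simp

/-- The centre of `R ⊗ B` is `K ⊗ R`. -/
lemma exists_scalarHom_eq [IsSemisimpleRing K] [IsAzumaya K B] {c : R ⊗[F] B}
    (hc : ∀ x, c * x = x * c) : ∃ s, scalarHom F K B R s = c := by
  obtain ⟨π, hπ⟩ := exists_linearMap_one_eq_one (K := K) (B := B)
  have h1 := baseChange_apply_of_central (R := R) (F := F) (Algebra.linearMap K B ∘ₗ π) hc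
  have h2 : ∀ c : R ⊗[F] B, ∃ s, scalarHom F K B R s =
      ((Algebra.linearMap K B ∘ₗ π).restrictScalars F).baseChange R c := by
    intro c
    induction c with
    | zero => exact ⟨0, by simp⟩
    | tmul r x => exact ⟨π x ⊗ₜ r, by simp [scalarHom_tmul]⟩
    | add x y hx hy =>
      obtain ⟨s, hs⟩ := hx
      obtain ⟨t, ht⟩ := hy
      exact ⟨s + t, by rw [map_add, map_add, hs, ht]⟩
  obtain ⟨s, hs⟩ := h2 c
  refine ⟨s, ?_⟩
  rw [hs, h1]
  simp [hπ, ← Algebra.TensorProduct.one_def]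

lemma matrix_eq_smul_one_of_central {c : Matrix (Fin 3) (Fin 3) R}
    (hc : ∀ x, c * x = x * c) : c = c 0 0 • 1 := by
  ext i j
  have := congrFun (congrFun (hc (Matrix.single j 0 1)) i) 0
  simpa [Matrix.mul_apply, Matrix.single_apply, Matrix.one_apply, ite_and, eq_comm] using this

/-! ### Points of the Weil restriction in the split case -/

variable {τ : B →ₗ[F] B}

/-- After splitting, the points of `R_{K/F} SB(B)` are the pairs of points of `ℙ²`. -/
theorem isWeilPoint_iff_of_splitting [IsSemisimpleRing K] [IsAzumaya K B] (φ : Splitting τ R)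
    {J : Submodule R (R ⊗[F] B)} (hJ : IsRightIdeal J) {U W : Submodule R (Fin 3 → R)}
    (hUW : J.map φ.equiv.toLinearMap = splitIdeal U W) :
    IsWeilPoint K J ↔ IsSummandOfRank 1 U ∧ IsSummandOfRank 1 W := by
  have hmem : ∀ x, x ∈ J ↔ φ.equiv x ∈ splitIdeal U W := fun x => by
    rw [← hUW]
    exact (φ.equiv.injective.mem_set_image (s := J)).symm
  -- `K ⊗ R` acts through scalar matrices
  have hcentral : ∀ s (x : Matrix (Fin 3) (Fin 3) R × Matrix (Fin 3) (Fin 3) R),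
      φ.equiv (scalarHom F K B R s) * x = x * φ.equiv (scalarHom F K B R s) := by
    intro s x
    obtain ⟨y, rfl⟩ := φ.equiv.surjective x
    rw [← map_mul, scalarHom_mul_comm, map_mul]
  have h1 : ∀ s, (φ.equiv (scalarHom F K B R s)).1 = (φ.equiv (scalarHom F K B R s)).1 0 0 • 1 :=
    fun s => matrix_eq_smul_one_of_central fun x => congrArg Prod.fst (hcentral s (x, 0))
  have h2 : ∀ s, (φ.equiv (scalarHom F K B R s)).2 = (φ.equiv (scalarHom F K B R s)).2 0 0 • 1 :=
    fun s => matrix_eq_smul_one_of_central fun x => congrArg Prod.snd (hcentral s (0, x))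
  let p₁ : K ⊗[F] R →+* R :=
    { toFun s := (φ.equiv (scalarHom F K B R s)).1 0 0
      map_one' := by simp
      map_zero' := by simp
      map_add' := by simp
      map_mul' s t := by
        rw [map_mul, map_mul, Prod.fst_mul, h1 s, h1 t]
        simp [mul_comm] }
  let p₂ : K ⊗[F] R →+* R :=
    { toFun s := (φ.equiv (scalarHom F K B R s)).2 0 0
      map_one' := by simp
      map_zero' := by simp
      map_add' := by simp
      map_mul' s t := by
        rw [map_mul, map_mul, Prod.snd_mul, h2 s, h2 t]
        simp [mul_comm] }
  have hp : ∀ s, φ.equiv (scalarHom F K B R s) = (p₁ s • 1, p₂ s • 1) := fun s =>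
    Prod.ext (h1 s) (h2 s)
  have hbij : Function.Bijective fun s => (p₁ s, p₂ s) := by
    constructor
    · intro s t hst
      obtain ⟨h, h'⟩ := Prod.ext_iff.1 hst
      refine scalarHom_injective (φ.equiv.injective ?_)
      rw [hp, hp]
      exact Prod.ext (congrArg (· • 1) h) (congrArg (· • 1) h')
    · rintro ⟨r, r'⟩
      obtain ⟨c, hc⟩ := φ.equiv.surjective (r • 1, r' • 1)
      obtain ⟨s, rfl⟩ := exists_scalarHom_eq (K := K) (c := c) fun x => φ.equiv.injective <| by
        rw [map_mul, map_mul, hc]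
        ext <;> simp
      refine ⟨s, ?_⟩
      change ((φ.equiv (scalarHom F K B R s)).1 0 0, (φ.equiv (scalarHom F K B R s)).2 0 0) = _
      rw [hc]
      simp
  let ψ : R ⊗[F] B ≃+ (K ⊗[F] R) ⊗[K] B :=
    AddEquiv.ofBijective (toWeil F K B R) (toWeil_bijective F K B R)
  let Φ := ψ.symm.trans φ.equiv.toRingEquiv.toAddEquiv
  have hΦψ : ∀ x, Φ (toWeil F K B R x) = φ.equiv x := fun x =>
    congrArg φ.equiv (ψ.symm_apply_apply x)
  rw [isWeilPoint_iff hJ, ← isSummandOfRank_colIdeal_iff, ← isSummandOfRank_colIdeal_iff]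
  refine isSummandOfRank_prod_iff p₁ p₂ hbij Φ ?_ ?_
  · intro s y
    obtain ⟨x, rfl⟩ := (toWeil_bijective F K B R).2 y
    rw [← toWeil_scalarHom_mul, hΦψ, hΦψ, map_mul, hp]
    ext <;> simp
  · intro y
    obtain ⟨x, rfl⟩ := (toWeil_bijective F K B R).2 y
    rw [toWeil_mem_weilModule, hmem, mem_splitIdeal, hΦψ]

lemma isRightIdeal_map (φ : Splitting τ R) {J : Submodule R (R ⊗[F] B)} (hJ : IsRightIdeal J) :
    IsRightIdeal (J.map φ.equiv.toLinearMap) := by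
  rintro _ ⟨x, hx, rfl⟩ d
  obtain ⟨y, rfl⟩ := φ.equiv.surjective d
  exact ⟨x * y, hJ x hx y, map_mul φ.equiv x y⟩

/-- Isomorphisms of algebras with involution respect the construction `N ↦ (N · σ N) ∩ Sym`. -/
lemma map_symPart_algEquiv {S D D' : Type*} [CommRing S] [Ring D] [Algebra S D] [Ring D']
    [Algebra S D'] (e : D ≃ₐ[S] D') {σ : D →ₗ[S] D} {σ' : D' →ₗ[S] D'}
    (h : ∀ x, σ' (e x) = e (σ x)) (N : Submodule S D) :
    (symPart σ N).map e.toLinearMap = symPart σ' (N.map e.toLinearMap) := by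
  have hN : (N.map σ).map e.toLinearMap = (N.map e.toLinearMap).map σ' := by
    rw [← Submodule.map_comp, ← Submodule.map_comp]
    congr 1
    exact LinearMap.ext fun x => (h x).symm
  have hmul := Submodule.map_mul N (N.map σ) e.toAlgHom
  rw [symPart, symPart, ← hN]
  ext y
  obtain ⟨x, rfl⟩ := e.surjective y
  have hx : ∀ P : Submodule S D, e x ∈ P.map e.toLinearMap ↔ x ∈ P :=
    fun P => e.injective.mem_set_image (s := P)
  rw [hx, Submodule.mem_inf, Submodule.mem_inf]
  refine and_congr ?_ ?_
  · rw [← hx]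
    exact Eq.to_iff (congrArg (e x ∈ ·) hmul)
  · change _ = _ ↔ _ = _
    rw [h]
    exact e.injective.eq_iff.symm

/-- If `J` corresponds to the pair `(U, W)` under a splitting, then `(J · τ J) ∩ Sym` corresponds to
`U ⊗ W`. -/
lemma map_symPart (φ : Splitting τ R) (J : Submodule R (R ⊗[F] B)) {U W : Submodule R (Fin 3 → R)}
    (hUW : J.map φ.equiv.toLinearMap = splitIdeal U W) :
    (symPart (τ.baseChange R) J).map φ.equiv.toLinearMap =
      (segreProduct U W).map symEmbedding := by
  let σ := φ.equiv.toLinearMap ∘ₗ τ.baseChange R ∘ₗ φ.equiv.symm.toLinearMap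
  have hσφ : ∀ x, σ (φ.equiv x) = φ.equiv (τ.baseChange R x) := fun x => by simp [σ]
  have hσ : ∀ x, σ x = exchange x := by
    intro x
    obtain ⟨x, rfl⟩ := φ.equiv.surjective x
    rw [hσφ, φ.map_involution]
  rw [map_symPart_algEquiv φ.equiv hσφ, hUW, symPart_splitIdeal hσ]

end Center

/-! ### Azumaya algebras over algebraically closed fields -/

section AlgClosed

/-- Functionals on the finite projective module `M` separate the elements of `E ⊗ M`. -/
lemma exists_dual_baseChange_ne_zero {K E M : Type*} [CommRing K] [CommRing E] [Algebra K E]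
    [AddCommGroup M] [Module K M] [Module.Finite K M] [Module.Projective K M] {c : E ⊗[K] M}
    (hc : c ≠ 0) : ∃ f : M →ₗ[K] K, f.baseChange E c ≠ 0 := by
  obtain ⟨n, g, f, -, -, hgf⟩ := Module.Finite.exists_comp_eq_id_of_projective K M
  by_contra! h
  apply hc
  have h1 : f.baseChange E c = 0 := by
    apply (TensorProduct.piScalarRight K E E (Fin n)).injective
    have : ∀ c : E ⊗[K] M, ∀ i, TensorProduct.piScalarRight K E E (Fin n) (f.baseChange E c) i =
        TensorProduct.rid K E ((LinearMap.proj i ∘ₗ f).baseChange E c) := by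
      intro c i
      induction c with
      | zero => simp
      | tmul a b => simp
      | add x y hx hy => simp only [map_add, Pi.add_apply, hx, hy]
    ext i
    rw [this, h]
    simp
  have h2 : g.baseChange E (f.baseChange E c) = c := by
    rw [← LinearMap.comp_apply, ← LinearMap.baseChange_comp, hgf]
    simp
  rw [← h2, h1, map_zero]

/-- A two-sided ideal `I` of `E ⊗ B` is stable under `1 ⊗ h` for all endomorphisms `h` of the module
`B`, because these are sums of maps `x ↦ a x b`. If `I` contains `c ≠ 0`, then a functional `f` with
`f c ≠ 0`, followed by `1 ∈ B`, takes `c` to a unit. -/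
lemma isSimpleRing_baseChange (K E B : Type*) [CommRing K] [Field E] [Algebra K E] [Ring B]
    [Algebra K B] [IsAzumaya K B] [Nontrivial (E ⊗[K] B)] : IsSimpleRing (E ⊗[K] B) := by
  refine IsSimpleRing.of_eq_bot_or_eq_top fun I => ?_
  rw [or_iff_not_imp_left]
  intro hI
  obtain ⟨c, hcI, hc⟩ := SetLike.exists_of_lt (bot_lt_iff_ne_bot.2 hI)
  have hc0 : c ≠ 0 := hc
  have key : ∀ h : Module.End K B, h.baseChange E c ∈ I := by
    intro h
    obtain ⟨z, rfl⟩ := (IsAzumaya.bij (R := K) (A := B)).2 h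
    induction z with
    | zero => simp
    | add x y hx hy =>
      rw [map_add, LinearMap.baseChange_add]
      exact I.add_mem hx hy
    | tmul a b =>
      have : ∀ c : E ⊗[K] B, (AlgHom.mulLeftRight K B (a ⊗ₜ b)).baseChange E c =
          (1 ⊗ₜ a) * c * (1 ⊗ₜ b.unop) := by
        intro c
        induction c with
        | zero => simp
        | tmul r x => simp
        | add x y hx hy => simp only [map_add, mul_add, add_mul, hx, hy]
      rw [this]
      exact I.mul_mem_right _ _ (I.mul_mem_left _ _ hcI)
  obtain ⟨f, hf⟩ := exists_dual_baseChange_ne_zero hc0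
  have h1 := key (Algebra.linearMap K B ∘ₗ f)
  obtain ⟨t, ht⟩ : ∃ t : E, f.baseChange E c = t ⊗ₜ 1 :=
    ⟨TensorProduct.rid K E (f.baseChange E c), by
      apply (TensorProduct.rid K E).injective; simp⟩
  have ht0 : t ≠ 0 := fun h0 => hf (by rw [ht, h0, zero_tmul])
  rw [LinearMap.baseChange_comp, LinearMap.comp_apply, ht] at h1
  rw [← I.one_mem_iff]
  have := I.mul_mem_left (t⁻¹ ⊗ₜ 1) _ h1
  simpa [ht0, Algebra.TensorProduct.one_def] using this

/-- Over an algebraically closed field an Azumaya algebra of rank `9` becomes `M₃`. -/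
lemma nonempty_algEquiv_matrix (K E B : Type*) [CommRing K] [Field E] [IsAlgClosed E] [Algebra K E]
    [Ring B] [Algebra K B] [IsAzumaya K B]
    (hB : ∀ p : PrimeSpectrum K, Module.rankAtStalk (R := K) B p = 9) :
    Nonempty ((E ⊗[K] B) ≃ₐ[E] Matrix (Fin 3) (Fin 3) E) := by
  have h9 : Module.finrank E (E ⊗[K] B) = 9 := by
    have h := Module.rankAtStalk_baseChange (R := K) (M := B) (⊥ : PrimeSpectrum E)
    rw [hB, Module.rankAtStalk_eq_finrank_of_free] at h
    simpa using h
  have : Nontrivial (E ⊗[K] B) := Module.nontrivial_of_finrank_pos (R := E) (by omega)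
  have := isSimpleRing_baseChange K E B
  obtain ⟨n, hn, ⟨e⟩⟩ := IsSimpleRing.exists_algEquiv_matrix_of_isAlgClosed E (E ⊗[K] B)
  have hn9 : n * n = 9 := by
    have := e.toLinearEquiv.finrank_eq
    rw [h9, Module.finrank_matrix] at this
    simpa using this.symm
  obtain rfl : n = 3 := by nlinarith
  exact ⟨e⟩

end AlgClosed

/-! ### Existence of splittings -/

section Existence

variable {F K B : Type u} [Field F] [CommRing K] [Algebra F K] [Ring B] [Algebra K B]
  [Algebra F B] {τ : B →ₗ[F] B} {R : Type u} [CommRing R] [Algebra F R]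

lemma IsUnitaryInvolution.baseChange_mul (hτ : IsUnitaryInvolution F K τ) (x y : R ⊗[F] B) :
    τ.baseChange R (x * y) = τ.baseChange R y * τ.baseChange R x := by
  induction x with
  | zero => simp
  | add x x' hx hx' => simp only [map_add, add_mul, mul_add, hx, hx']
  | tmul r b =>
    induction y with
    | zero => simp
    | add x x' hx hx' => simp only [map_add, add_mul, mul_add, hx, hx']
    | tmul r' b' => simp [hτ.map_mul, mul_comm]

lemma IsUnitaryInvolution.baseChange_involutive (hτ : IsUnitaryInvolution F K τ) (x : R ⊗[F] B) :
    τ.baseChange R (τ.baseChange R x) = x := by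
  induction x with
  | zero => simp
  | add x x' hx hx' => simp only [map_add, hx, hx']
  | tmul r b => simp [hτ.involutive]

/-- An étale algebra over a field is a finite product of fields. -/
lemma isSemisimpleRing_of_etale (F K : Type*) [Field F] [CommRing K] [Algebra F K]
    [Algebra.Etale F K] [Module.Finite F K] : IsSemisimpleRing K := by
  have := Algebra.FormallyUnramified.isReduced_of_field F K
  have := IsArtinianRing.of_finite F K
  exact IsArtinianRing.isSemisimpleRing_of_isReduced K

/-- The idempotent of `K ⊗ E` given by a homomorphism `σ : K → E`. -/
lemma exists_idempotent_of_algHom [Algebra.Etale F K] {E : Type u} [Field E] [Algebra F E]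
    [Algebra K E] [IsScalarTower F K E] :
    ∃ e : K ⊗[F] E, (∀ s : K ⊗[F] E, s * e =
      (1 ⊗ₜ Algebra.TensorProduct.lift (IsScalarTower.toAlgHom F K E) (AlgHom.id F E)
        (fun _ _ => .all _ _) s) * e) ∧
      Algebra.TensorProduct.lift (IsScalarTower.toAlgHom F K E) (AlgHom.id F E)
        (fun _ _ => .all _ _) e = 1 := by
  let g : K ⊗[F] K →ₐ[F] K ⊗[F] E :=
    Algebra.TensorProduct.map (AlgHom.id F K) (IsScalarTower.toAlgHom F K E)
  let ev : K ⊗[F] E →ₐ[F] E :=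
    Algebra.TensorProduct.lift (IsScalarTower.toAlgHom F K E) (AlgHom.id F E)
        (fun _ _ => .all _ _)
  let e₀ := Algebra.FormallyUnramified.elem F K
  have h1 : ∀ c : K, (c ⊗ₜ 1) * g e₀ = (1 ⊗ₜ algebraMap K E c) * g e₀ := by
    intro c
    have := congrArg g (Algebra.FormallyUnramified.one_tmul_mul_elem (R := F) (S := K) c)
    rw [map_mul, map_mul] at this
    simpa [g] using this.symm
  have h2 : ev (g e₀) = 1 := by
    have : ∀ z, ev (g z) = algebraMap K E (Algebra.TensorProduct.lmul' F z) := by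
      intro z
      induction z with
      | zero => simp
      | add x y hx hy => simp only [map_add, hx, hy]
      | tmul a b => simp [ev, g]
    rw [this, Algebra.FormallyUnramified.lmul_elem, map_one]
  refine ⟨g e₀, fun s => ?_, h2⟩
  change s * g e₀ = (1 ⊗ₜ ev s) * g e₀
  induction s with
  | zero => simp
  | add x y hx hy => simp only [map_add, add_mul, tmul_add, hx, hy]
  | tmul c t =>
    have h3 : c ⊗ₜ[F] t = (1 ⊗ₜ t) * (c ⊗ₜ 1) := by simp
    have h4 : ev (c ⊗ₜ t) = t * algebraMap K E c := by simp [ev, mul_comm]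
    rw [h4, h3, mul_assoc, h1, ← mul_assoc]
    simp

end Existence

section Existence

variable {F K B : Type u} [Field F] [CommRing K] [Algebra F K] [Ring B] [Algebra K B]
  [Algebra F B] {τ : B →ₗ[F] B} {R : Type u} [CommRing R] [Algebra F R] [IsScalarTower F K B]

/-- A homomorphism from `K` to an algebraically closed field splits `(B, τ)`: the idempotent `ê` of
`E ⊗ B` given by `K → E` and its conjugate are complementary, and either of the two corner algebras
is `M₃(E)`. -/
lemma nonempty_splitting_of_algebra [Algebra.Etale F K] (hK : Module.finrank F K = 2)
    [IsAzumaya K B] (hB : ∀ p : PrimeSpectrum K, Module.rankAtStalk (R := K) B p = 9)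
    (hτ : IsUnitaryInvolution F K τ) (E : Type u) [Field E] [IsAlgClosed E] [Algebra F E]
    [Algebra K E] [IsScalarTower F K E] : Nonempty (Splitting τ E) := by
  have : Module.Finite F K := Module.finite_of_finrank_pos (by omega)
  have : IsSemisimpleRing K := isSemisimpleRing_of_etale F K
  obtain ⟨ψ⟩ := nonempty_algEquiv_matrix K E B hB
  obtain ⟨e, he, he1⟩ := exists_idempotent_of_algHom (F := F) (K := K) (E := E)
  set ev : K ⊗[F] E →ₐ[F] E := Algebra.TensorProduct.lift (IsScalarTower.toAlgHom F K E)
    (AlgHom.id F E) (fun _ _ => .all _ _) with hev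
  let θ := scalarHom F K B E
  have hθE : ∀ t : E, θ (1 ⊗ₜ t) = t ⊗ₜ 1 := fun t => by simp [θ, scalarHom_tmul]
  have hsm : ∀ (t : E) (x : E ⊗[F] B), (t ⊗ₜ 1) * x = t • x := fun t x => by
    rw [Algebra.smul_def]; rfl
  have hθinj : Function.Injective θ := scalarHom_injective
  set ê := θ e with hê
  have hmulê : ∀ s, θ s * ê = ev s • ê := fun s => by
    rw [hê, ← map_mul, he, map_mul, hθE, hsm]
  have hêc : ∀ x, ê * x = x * ê := scalarHom_mul_comm e
  have hêê : ê * ê = ê := by rw [hmulê, he1, one_smul]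
  -- the projection `E ⊗_F B → E ⊗_K B`
  let φ₀ : E ⊗[F] B →ₐ[E] E ⊗[K] B :=
    Algebra.TensorProduct.lift Algebra.TensorProduct.includeLeft
      ((Algebra.TensorProduct.includeRight : B →ₐ[K] E ⊗[K] B).restrictScalars F)
      (fun x y => by simp [Commute, SemiconjBy])
  have hφ₀ : ∀ (t : E) (b : B), φ₀ (t ⊗ₜ b) = t ⊗ₜ b := fun t b =>
    (Algebra.TensorProduct.lift_tmul _ _ _ _ _).trans (by simp)
  have hφ₀θ : ∀ s, φ₀ (θ s) = ev s ⊗ₜ 1 := by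
    intro s
    induction s with
    | zero => simp
    | add x y hx hy => simp only [map_add, hx, hy, add_tmul]
    | tmul c t =>
      simp only [θ, scalarHom_tmul, hφ₀, hev, Algebra.TensorProduct.lift_tmul]
      rw [Algebra.algebraMap_eq_smul_one, tmul_smul, smul_tmul', Algebra.smul_def]
      rfl
  have hφ₀surj : Function.Surjective φ₀ := by
    intro z
    induction z with
    | zero => exact ⟨0, map_zero _⟩
    | add x y hx hy =>
      obtain ⟨x, rfl⟩ := hx
      obtain ⟨y, rfl⟩ := hy
      exact ⟨x + y, map_add _ _ _⟩
    | tmul t b => exact ⟨t ⊗ₜ b, hφ₀ t b⟩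
  have hφ₀ê : φ₀ ê = 1 := by rw [hφ₀θ, he1]; rfl
  have hφ₀ker : ∀ x, φ₀ x = 0 → ê * x = 0 := by
    let ρ : E ⊗[K] B →+ E ⊗[F] B := TensorProduct.liftAddHom
      { toFun t :=
          { toFun b := ê * (t ⊗ₜ b)
            map_zero' := by simp
            map_add' := fun x y => by simp [tmul_add, mul_add] }
        map_zero' := by ext; simp
        map_add' := fun x y => by ext; simp [add_tmul, mul_add] } (by
        intro c t b
        have h1 : t ⊗ₜ[F] (c • b) = θ (c ⊗ₜ 1) * (t ⊗ₜ b) := by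
          simp [θ, scalarHom_tmul, Algebra.smul_def]
        have h2 : (c • t) ⊗ₜ[F] b = algebraMap K E c • (t ⊗ₜ[F] b) := by
          rw [smul_tmul', Algebra.smul_def]; rfl
        change ê * ((c • t) ⊗ₜ[F] b) = ê * (t ⊗ₜ[F] (c • b))
        rw [h1, h2, ← mul_assoc, hêc (θ _), hmulê, smul_mul_assoc, mul_smul_comm]
        simp [hev])
    have hρ : ∀ x, ρ (φ₀ x) = ê * x := by
      intro x
      induction x with
      | zero => simp
      | add x y hx hy => simp only [map_add, mul_add, hx, hy]
      | tmul t b => rw [hφ₀]; rfl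
    intro x hx
    rw [← hρ, hx, map_zero]
  set τE := τ.baseChange E with hτE
  have hτmul := hτ.baseChange_mul (R := E)
  have hττ := hτ.baseChange_involutive (R := E)
  -- the conjugate idempotent
  obtain ⟨s, hs⟩ := exists_scalarHom_eq (K := K) (c := τE ê) fun x => by
    rw [← hττ x, ← hτmul, ← hτmul, hêc]
  -- `ê` is a minimal idempotent of the centre, so `ê * τE ê ≠ 0` forces `ê = τE ê`; then `e ∈ E`,
  -- hence `e = 1`, which contradicts `[K : F] = 2`
  have h01 : ê * τE ê = 0 := by
    have h1 : τE ê * ê = ev s • ê := by rw [← hs]; exact hmulê s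
    have h2 : τE ê * ê = ev s • τE ê := by
      have := congrArg τE h1
      rwa [hτmul, hττ, map_smul] at this
    by_contra hne
    have ha : ev s ≠ 0 := by
      rintro h0
      rw [h0, zero_smul, ← hêc] at h1
      exact hne h1
    have hfix : ê = τE ê := by
      have := h1.symm.trans h2
      exact smul_right_injective _ ha this
    -- the elements of `E ⊗ K` fixed by the involution lie in `E`
    let g : K →ₗ[F] B := (τ - LinearMap.id) ∘ₗ (IsScalarTower.toAlgHom F K B).toLinearMap
    have hg : ∀ s : K ⊗[F] E, g.baseChange E (TensorProduct.comm F K E s) = τE (θ s) - θ s := by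
      intro s
      induction s with
      | zero => simp
      | add x y hx hy => simp only [map_add, hx, hy]; abel
      | tmul c t => simp [g, θ, scalarHom_tmul, tmul_sub, hτE]
    have hker : TensorProduct.comm F K E e ∈ LinearMap.ker (AlgebraTensorModule.lTensor E E g) := by
      change g.baseChange E (TensorProduct.comm F K E e) = 0
      rw [hg, ← hfix, sub_self]
    rw [Module.Flat.ker_lTensor_eq] at hker
    obtain ⟨z, hz⟩ := hker
    have hzt : ∀ z : E ⊗[F] LinearMap.ker g, ∃ t : E,
        AlgebraTensorModule.lTensor E E (LinearMap.ker g).subtype z = t ⊗ₜ 1 := by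
      intro z
      induction z with
      | zero => exact ⟨0, by simp⟩
      | add x y hx hy =>
        obtain ⟨t, ht⟩ := hx
        obtain ⟨t', ht'⟩ := hy
        exact ⟨t + t', by rw [map_add, ht, ht', add_tmul]⟩
      | tmul t c =>
        obtain ⟨a, ha⟩ := (hτ.fixed_iff c).1 (sub_eq_zero.1 c.2)
        refine ⟨a • t, ?_⟩
        rw [AlgebraTensorModule.lTensor_tmul, Submodule.subtype_apply, ← ha,
          Algebra.algebraMap_eq_smul_one, tmul_smul, smul_tmul']
    obtain ⟨t, ht⟩ := hzt z
    have het : e = 1 ⊗ₜ t := by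
      apply (TensorProduct.comm F K E).injective
      rw [← hz, ht]; rfl
    have ht1 : t = 1 := by
      rw [het] at he1
      simpa [hev] using he1
    have heone : e = 1 := by rw [het, ht1]; rfl
    have hspan : ∀ w : E ⊗[F] K, ∃ c : E, c • (1 : E ⊗[F] K) = w := by
      intro w
      have := he ((TensorProduct.comm F K E).symm w)
      rw [heone, mul_one, mul_one] at this
      refine ⟨ev ((TensorProduct.comm F K E).symm w), ?_⟩
      rw [← (TensorProduct.comm F K E).apply_symm_apply w, this]
      simp [Algebra.TensorProduct.one_def, smul_tmul', hev]
    have := finrank_le_one (R := E) (1 : E ⊗[F] K) hspan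
    rw [Module.finrank_baseChange, hK] at this
    omega
  have hes : e * s = 0 := hθinj (by rw [map_mul, hs, map_zero]; exact h01)
  have hsum : ê + τE ê = 1 := by
    have hee : e * e = e := hθinj (by rw [map_mul]; exact hêê)
    have hss : s * s = s := hθinj (by rw [map_mul, hs, ← hτmul, hêê])
    have he0 : e ≠ 0 := by rintro h; rw [h, map_zero] at he1; exact zero_ne_one he1
    have hs0 : s ≠ 0 := by
      rintro rfl
      rw [map_zero] at hs
      have := hττ ê
      rw [← hτE, ← hs, map_zero] at this
      rw [hê] at this
      exact he0 (hθinj (by rw [map_zero]; exact this.symm))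
    -- `e` and `s` form an `E`-basis of `K ⊗ E`
    let cm := Algebra.TensorProduct.comm F K E
    have hli : LinearIndependent E ![cm e, cm s] := by
      rw [LinearIndependent.pair_iff]
      intro a b hab
      have hab' : (1 ⊗ₜ a) * e + (1 ⊗ₜ b) * s = 0 := by
        apply cm.injective
        rw [map_add, map_mul, map_mul, map_zero, ← hab, Algebra.smul_def, Algebra.smul_def]
        rfl
      have key : ∀ (c : E) (w : K ⊗[F] E), w ≠ 0 → (1 ⊗ₜ c) * w = 0 → c = 0 := by
        intro c w hw h
        by_contra hc
        apply hw
        have : ((1 : K) ⊗ₜ[F] c⁻¹) * ((1 ⊗ₜ c) * w) = w := by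
          rw [← mul_assoc, Algebra.TensorProduct.tmul_mul_tmul, inv_mul_cancel₀ hc, one_mul]
          exact one_mul w
        rw [← this, h, mul_zero]
      constructor
      · apply key a e he0
        have := congrArg (· * e) hab'
        simpa [add_mul, mul_assoc, hee, mul_comm s e, hes] using this
      · apply key b s hs0
        have := congrArg (· * s) hab'
        simpa [add_mul, mul_assoc, hss, hes] using this
    have htop := hli.span_eq_top_of_card_eq_finrank' (by
      rw [Module.finrank_baseChange, hK]; simp)
    have h1 : (1 : E ⊗[F] K) ∈ Submodule.span E (Set.range ![cm e, cm s]) := by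
      rw [htop]; trivial
    rw [Matrix.range_cons_cons_empty, Submodule.mem_span_pair] at h1
    obtain ⟨a, b, hab⟩ := h1
    have hab' : (1 ⊗ₜ a) * e + (1 ⊗ₜ b) * s = 1 := by
      apply cm.injective
      rw [map_add, map_mul, map_mul, map_one, ← hab, Algebra.smul_def, Algebra.smul_def]
      rfl
    have h2 : e = (1 ⊗ₜ a) * e := by
      have := congrArg (· * e) hab'
      simpa [add_mul, mul_assoc, hee, mul_comm s e, hes] using this.symm
    have h3 : s = (1 ⊗ₜ b) * s := by
      have := congrArg (· * s) hab'
      simpa [add_mul, mul_assoc, hss, hes] using this.symm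
    rw [← hs, hê, ← map_add]
    rw [← h2, ← h3] at hab'
    rw [hab', map_one]
  have hφ₀ê' : φ₀ (τE ê) = 0 := by
    have := congrArg φ₀ h01
    rwa [map_mul, hφ₀ê, one_mul, map_zero] at this
  have hψφ : ∀ x y, ψ (φ₀ (x * y)) = ψ (φ₀ x) * ψ (φ₀ y) := fun x y => by
    rw [map_mul, map_mul]
  let φ : E ⊗[F] B →ₐ[E] Matrix (Fin 3) (Fin 3) E × Matrix (Fin 3) (Fin 3) E :=
    AlgHom.ofLinearMap
      (LinearMap.prod (ψ.toLinearMap ∘ₗ φ₀.toLinearMap)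
        ((Matrix.transposeLinearEquiv (Fin 3) (Fin 3) E E).toLinearMap ∘ₗ ψ.toLinearMap ∘ₗ
          φ₀.toLinearMap ∘ₗ τE))
      (by
        have h1 : τE 1 = 1 :=
          calc τE 1 = τE 1 * τE (τE 1) := by rw [hτE, hττ, mul_one]
            _ = τE (τE 1 * 1) := by rw [hτE, hτmul, hττ, mul_one]
            _ = 1 := by rw [mul_one, hτE, hττ]
        refine Prod.ext ?_ ?_
        · simp
        · simp [h1])
      (by
        intro x y
        refine Prod.ext ?_ ?_
        · simp
        · simp [hτE, hτmul, Matrix.transpose_mul])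
  have hφ : ∀ x, φ x = (ψ (φ₀ x), (ψ (φ₀ (τE x))).transpose) := fun x => rfl
  have hbij : Function.Bijective φ := by
    constructor
    · refine (injective_iff_map_eq_zero φ).2 fun x hx => ?_
      rw [hφ, Prod.ext_iff] at hx
      obtain ⟨h1, h2⟩ := hx
      have h1 : φ₀ x = 0 := ψ.injective (h1.trans (map_zero ψ).symm)
      have h2 : φ₀ (τE x) = 0 := by
        apply ψ.injective
        rw [map_zero]
        exact Matrix.transpose_injective (h2.trans Matrix.transpose_zero.symm)
      have h3 := congrArg τE (hφ₀ker _ h2)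
      rw [hτmul, hττ, map_zero] at h3
      calc x = ê * x + x * τE ê := by
            rw [hêc, ← mul_add, hsum, mul_one]
        _ = 0 := by rw [hφ₀ker _ h1, h3, add_zero]
    · rintro ⟨p, q⟩
      obtain ⟨x, hx⟩ := hφ₀surj (ψ.symm p)
      obtain ⟨y, hy⟩ := hφ₀surj (ψ.symm q.transpose)
      refine ⟨x * ê + τE (y * ê), ?_⟩
      rw [hφ]
      refine Prod.ext ?_ ?_
      · change ψ (φ₀ (x * ê + τE (y * ê))) = p
        rw [hτmul, map_add, map_mul φ₀, map_mul φ₀, ← hτE, hφ₀ê', hφ₀ê, hx]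
        simp
      · change (ψ (φ₀ (τE (x * ê + τE (y * ê))))).transpose = q
        rw [map_add τE, hτmul, hττ, map_add, map_mul φ₀, map_mul φ₀, ← hτE, hφ₀ê', hφ₀ê, hy]
        simp
  refine ⟨⟨AlgEquiv.ofBijective φ hbij, fun x => ?_⟩⟩
  change φ (τE x) = exchange (φ x)
  rw [hφ, hφ, exchange, hττ, Matrix.transpose_transpose]

/-- `(B, τ)` splits over every algebraically closed extension `E` of `F`, as the finite `F`-algebra
`K` has a homomorphism to `E`. -/
theorem nonempty_splitting [Algebra.Etale F K] (hK : Module.finrank F K = 2)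
    [IsAzumaya K B] (hB : ∀ p : PrimeSpectrum K, Module.rankAtStalk (R := K) B p = 9)
    (hτ : IsUnitaryInvolution F K τ) (E : Type u) [Field E] [IsAlgClosed E] [Algebra F E] :
    Nonempty (Splitting τ E) := by
  have : Module.Finite F K := Module.finite_of_finrank_pos (by omega)
  have : Nontrivial K := Module.nontrivial_of_finrank_pos (R := F) (by omega)
  obtain ⟨m, hm⟩ := Ideal.exists_maximal K
  let := Ideal.Quotient.field m
  have : Algebra.IsAlgebraic F (K ⧸ m) := Algebra.IsAlgebraic.of_finite F (K ⧸ m)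
  let σ : K →ₐ[F] E :=
    (IsAlgClosed.lift (R := F) (S := K ⧸ m) (M := E)).comp (Ideal.Quotient.mkₐ F m)
  algebraize [σ.toRingHom]
  have : IsScalarTower F K E := IsScalarTower.of_algebraMap_eq fun x => (σ.commutes x).symm
  exact nonempty_splitting_of_algebra hK hB hτ E

/-- A splitting over `E` gives one over every `E`-algebra. -/
lemma Splitting.nonempty_baseChange {F B E T : Type u} [Field F] [Ring B] [Algebra F B]
    {τ : B →ₗ[F] B} [CommRing E] [Algebra F E] [CommRing T] [Algebra F T] [Algebra E T]
    [IsScalarTower F E T] (φ : Splitting τ E) : Nonempty (Splitting τ T) := by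
  let M := Matrix (Fin 3) (Fin 3) E
  let μ : M →ₐ[F] Matrix (Fin 3) (Fin 3) T := (IsScalarTower.toAlgHom F E T).mapMatrix
  let g : T ⊗[F] B →ₐ[T] Matrix (Fin 3) (Fin 3) T × Matrix (Fin 3) (Fin 3) T :=
    Algebra.TensorProduct.lift (Algebra.ofId T _)
      ((AlgHom.prodMap μ μ).comp
        ((φ.equiv.toAlgHom.restrictScalars F).comp Algebra.TensorProduct.includeRight))
      (fun x y => Algebra.commutes x _)
  have hg : ∀ t b, g (t ⊗ₜ b) = t • (μ (φ.equiv (1 ⊗ₜ b)).1, μ (φ.equiv (1 ⊗ₜ b)).2) := by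
    intro t b
    rw [Algebra.smul_def]
    exact Algebra.TensorProduct.lift_tmul _ _ _ _ _
  let L : T ⊗[F] B ≃ₗ[E] Matrix (Fin 3) (Fin 3) T × Matrix (Fin 3) (Fin 3) T :=
    (AlgebraTensorModule.cancelBaseChange F E E T B).symm ≪≫ₗ
      AlgebraTensorModule.congr (LinearEquiv.refl E T) φ.equiv.toLinearEquiv ≪≫ₗ
      TensorProduct.prodRight E E T M M ≪≫ₗ
      LinearEquiv.prodCongr
        ((matrixEquivTensor (Fin 3) E T).symm.toLinearEquiv)
        ((matrixEquivTensor (Fin 3) E T).symm.toLinearEquiv)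
  have hL : ∀ x, g x = L x := by
    intro x
    induction x with
    | zero => simp
    | add x y hx hy => simp only [map_add, hx, hy]
    | tmul t b =>
      rw [hg]
      simp only [L, μ, LinearEquiv.trans_apply, AlgebraTensorModule.cancelBaseChange_symm_tmul,
        AlgebraTensorModule.congr_tmul, TensorProduct.prodRight_tmul, LinearEquiv.prodCongr_apply,
        LinearEquiv.refl_apply]
      refine Prod.ext ?_ ?_ <;> exact (matrixEquivTensor_apply_symm _ _ _ _ _).symm
  have hbij : Function.Bijective g := by
    rw [show ⇑g = L from funext hL]; exact L.bijective
  refine ⟨⟨AlgEquiv.ofBijective g hbij, fun x => ?_⟩⟩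
  change g _ = exchange (g x)
  induction x with
  | zero =>
    rw [map_zero, map_zero]
    rfl
  | add x y hx hy => simp only [map_add, hx, hy, exchange, Prod.fst_add, Prod.snd_add,
      Matrix.transpose_add, Prod.mk_add_mk]
  | tmul t b =>
    have := φ.map_involution (1 ⊗ₜ b)
    rw [LinearMap.baseChange_tmul] at this
    rw [LinearMap.baseChange_tmul, hg, hg, this]
    rfl

end Existence

/-! ### The sandwich identity and its base change -/

section Sandwich

variable {k : Type*} [CommRing k] {A ι : Type*} [Ring A] [Algebra k A]
  {S S' : Type*} [CommRing S] [Algebra k S] [CommRing S'] [Algebra k S']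

/-- The ideal generated by the coordinates of the elements `l₁ x l₂ y l₃ - l₁ y l₂ x l₃`, for
`l₁, l₂, l₃ ∈ N` and `x, y ∈ A`; it vanishes exactly when `N` satisfies the sandwich identity. -/
def sandwichIdeal (b : Module.Basis ι k A) (N : Submodule S (S ⊗[k] A)) : Ideal S :=
  Ideal.span {c | ∃ l₁ ∈ N, ∃ l₂ ∈ N, ∃ l₃ ∈ N, ∃ x y : A, ∃ i,
    (b.baseChange S).repr (l₁ * (1 ⊗ₜ x) * l₂ * (1 ⊗ₜ y) * l₃ -
      l₁ * (1 ⊗ₜ y) * l₂ * (1 ⊗ₜ x) * l₃) i = c}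

lemma sandwichIdeal_le_iff {b : Module.Basis ι k A} {N : Submodule S (S ⊗[k] A)} {Q : Ideal S} :
    sandwichIdeal b N ≤ Q ↔ ∀ l₁ ∈ N, ∀ l₂ ∈ N, ∀ l₃ ∈ N, ∀ (x y : A) (i : ι),
      (b.baseChange S).repr (l₁ * (1 ⊗ₜ x) * l₂ * (1 ⊗ₜ y) * l₃ -
        l₁ * (1 ⊗ₜ y) * l₂ * (1 ⊗ₜ x) * l₃) i ∈ Q := by
  rw [sandwichIdeal, Ideal.span_le]
  constructor
  · intro h l₁ h₁ l₂ h₂ l₃ h₃ x y i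
    exact h ⟨l₁, h₁, l₂, h₂, l₃, h₃, x, y, i, rfl⟩
  · rintro h _ ⟨l₁, h₁, l₂, h₂, l₃, h₃, x, y, i, rfl⟩
    exact h l₁ h₁ l₂ h₂ l₃ h₃ x y i

lemma sandwichIdeal_eq_bot_iff {b : Module.Basis ι k A} {N : Submodule S (S ⊗[k] A)} :
    sandwichIdeal b N = ⊥ ↔ IsSandwichSymm N := by
  rw [← le_bot_iff, sandwichIdeal_le_iff]
  constructor
  · intro h
    have h' : ∀ l₁ ∈ N, ∀ l₂ ∈ N, ∀ l₃ ∈ N, ∀ x y : A, l₁ * (1 ⊗ₜ x) * l₂ * (1 ⊗ₜ y) * l₃ =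
        l₁ * (1 ⊗ₜ y) * l₂ * (1 ⊗ₜ x) * l₃ := by
      intro l₁ h₁ l₂ h₂ l₃ h₃ x y
      rw [← sub_eq_zero]
      apply (b.baseChange S).repr.injective
      ext i
      rw [map_zero]
      exact h l₁ h₁ l₂ h₂ l₃ h₃ x y i
    intro l₁ h₁ l₂ h₂ l₃ h₃ x y
    induction x with
    | zero => simp
    | add x x' hx hx' => simp only [mul_add, add_mul, hx, hx']
    | tmul s a =>
      induction y with
      | zero => simp
      | add y y' hy hy' => simp only [mul_add, add_mul, hy, hy']
      | tmul s' a' =>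
        have h1 : ∀ (s : S) (a : A), s ⊗ₜ[k] a = s • ((1 : S) ⊗ₜ a) := fun s a => by
          simp [smul_tmul']
        rw [h1 s, h1 s']
        simp only [mul_smul_comm, smul_mul_assoc]
        rw [h' l₁ h₁ l₂ h₂ l₃ h₃, smul_comm]
  · intro h l₁ h₁ l₂ h₂ l₃ h₃ x y i
    rw [h l₁ h₁ l₂ h₂ l₃ h₃, sub_self]
    simp

/-- The formation of the ideal commutes with base change, because the identity is linear in each of
`ℓ₁`, `ℓ₂`, `ℓ₃`. -/
lemma sandwichIdeal_extend (b : Module.Basis ι k A) (f : S →ₐ[k] S')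
    (N : Submodule S (S ⊗[k] A)) :
    sandwichIdeal b (extendSubmodule f N) = (sandwichIdeal b N).map f := by
  apply le_antisymm
  · set Q := (sandwichIdeal b N).map f with hQ
    let P : Submodule S' (S' ⊗[k] A) :=
      { carrier := {z | ∀ i, (b.baseChange S').repr z i ∈ Q}
        add_mem' := fun hx hy i => by
          rw [map_add]; exact add_mem (hx i) (hy i)
        zero_mem' := fun i => by simp
        smul_mem' := fun c x hx i => by
          rw [map_smul]; exact Q.mul_mem_left c (hx i) }
    have h0 : ∀ l₁ ∈ N, ∀ l₂ ∈ N, ∀ l₃ ∈ N, ∀ x y : A,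
        f.toLinearMap.rTensor A l₁ * (1 ⊗ₜ x) * f.toLinearMap.rTensor A l₂ * (1 ⊗ₜ y) *
          f.toLinearMap.rTensor A l₃ -
        f.toLinearMap.rTensor A l₁ * (1 ⊗ₜ y) * f.toLinearMap.rTensor A l₂ * (1 ⊗ₜ x) *
          f.toLinearMap.rTensor A l₃ ∈ P := by
      intro l₁ h₁ l₂ h₂ l₃ h₃ x y i
      have h1 : ∀ a : A, (1 : S') ⊗ₜ[k] a = f.toLinearMap.rTensor A (1 ⊗ₜ a) := fun a => by simp
      rw [h1, h1, ← rTensor_mul, ← rTensor_mul, ← rTensor_mul, ← rTensor_mul, ← rTensor_mul,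
        ← rTensor_mul, ← rTensor_mul, ← rTensor_mul, ← map_sub, repr_rTensor]
      exact Ideal.mem_map_of_mem f (Ideal.subset_span ⟨l₁, h₁, l₂, h₂, l₃, h₃, x, y, i, rfl⟩)
    rw [sandwichIdeal_le_iff]
    intro l₁ h₁ l₂ h₂ l₃ h₃ x y
    change _ ∈ P
    induction h₁ using Submodule.span_induction with
    | zero => simp
    | add a c _ _ ha hc =>
      simp only [add_mul, add_sub_add_comm]; exact add_mem ha hc
    | smul t a _ ha =>
      simp only [smul_mul_assoc, ← smul_sub]; exact P.smul_mem t ha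
    | mem l₁ h₁ =>
    obtain ⟨l₁, h₁, rfl⟩ := h₁
    induction h₂ using Submodule.span_induction with
    | zero => simp
    | add a c _ _ ha hc =>
      simp only [add_mul, mul_add, add_sub_add_comm]; exact add_mem ha hc
    | smul t a _ ha =>
      simp only [smul_mul_assoc, mul_smul_comm, ← smul_sub]; exact P.smul_mem t ha
    | mem l₂ h₂ =>
    obtain ⟨l₂, h₂, rfl⟩ := h₂
    induction h₃ using Submodule.span_induction with
    | zero => simp
    | add a c _ _ ha hc =>
      simp only [mul_add, add_sub_add_comm]; exact add_mem ha hc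
    | smul t a _ ha =>
      simp only [mul_smul_comm, ← smul_sub]; exact P.smul_mem t ha
    | mem l₃ h₃ =>
    obtain ⟨l₃, h₃, rfl⟩ := h₃
    exact h0 l₁ h₁ l₂ h₂ l₃ h₃ x y
  · rw [Ideal.map_le_iff_le_comap, sandwichIdeal_le_iff]
    intro l₁ h₁ l₂ h₂ l₃ h₃ x y i
    refine Ideal.subset_span ⟨_, rTensor_mem_extendSubmodule f h₁, _,
      rTensor_mem_extendSubmodule f h₂, _, rTensor_mem_extendSubmodule f h₃, x, y, i, ?_⟩
    have h1 : ∀ a : A, (1 : S') ⊗ₜ[k] a = f.toLinearMap.rTensor A (1 ⊗ₜ a) := fun a => by simp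
    rw [h1, h1, ← rTensor_mul, ← rTensor_mul, ← rTensor_mul, ← rTensor_mul, ← rTensor_mul,
        ← rTensor_mul, ← rTensor_mul, ← rTensor_mul, ← map_sub, repr_rTensor]

end Sandwich

/-! ### The morphism `s` -/

section Morphism

variable {F K B : Type u} [Field F] [CommRing K] [Algebra F K] [Ring B] [Algebra K B]
  [Algebra F B] {τ : B →ₗ[F] B} {R R' : Type u} [CommRing R] [Algebra F R]
  [CommRing R'] [Algebra F R']

variable (τ R) in
/-- The inclusion of `R ⊗ Sym(B, τ)` in `R ⊗ B`. -/
noncomputable abbrev symInclusion : R ⊗[F] symElems τ →ₗ[R] R ⊗[F] B :=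
  (symElems τ).subtype.baseChange R

lemma symInclusion_injective : Function.Injective (symInclusion τ R) :=
  Module.Flat.lTensor_preserves_injective_linearMap (M := R) _ (symElems τ).injective_subtype

lemma range_symInclusion : LinearMap.range (symInclusion τ R) = symElems (τ.baseChange R) := by
  have := Module.Flat.eqLocus_lTensor_eq (R := F) R R τ LinearMap.id
  have hid : AlgebraTensorModule.lTensor R R (LinearMap.id : B →ₗ[F] B) = LinearMap.id := by
    ext; simp
  rw [hid] at this
  exact this.symm

variable (τ) in
/-- `(J · τ J) ∩ Sym`, as a submodule of `R ⊗ Sym(B, τ)`. -/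
noncomputable def lineSym (J : Submodule R (R ⊗[F] B)) : Submodule R (R ⊗[F] symElems τ) :=
  (symPart (τ.baseChange R) J).comap (symInclusion τ R)

lemma map_lineSym (J : Submodule R (R ⊗[F] B)) :
    (lineSym τ J).map (symInclusion τ R) = symPart (τ.baseChange R) J := by
  refine Submodule.map_comap_eq_self ?_
  rw [range_symInclusion]
  exact inf_le_right

lemma extendSubmodule_map_symInclusion (f : R →ₐ[F] R') (N : Submodule R (R ⊗[F] symElems τ)) :
    extendSubmodule f (N.map (symInclusion τ R)) =
      (extendSubmodule f N).map (symInclusion τ R') :=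
  extendSubmodule_map f _ N

/-- After splitting, symmetric elements are matrices. -/
noncomputable def Splitting.symEquiv (φ : Splitting τ R) :
    R ⊗[F] symElems τ ≃ₗ[R] Matrix (Fin 3) (Fin 3) R :=
  LinearEquiv.ofBijective
    (LinearMap.fst R _ _ ∘ₗ φ.equiv.toLinearMap ∘ₗ symInclusion τ R) (by
    have hfix : ∀ x, φ.equiv (symInclusion τ R x) = exchange (φ.equiv (symInclusion τ R x)) := by
      intro x
      have : symInclusion τ R x ∈ symElems (τ.baseChange R) := by
        rw [← range_symInclusion]; exact ⟨x, rfl⟩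
      rw [← φ.map_involution]
      exact congrArg φ.equiv this.symm
    constructor
    · refine (injective_iff_map_eq_zero (LinearMap.fst R (Matrix (Fin 3) (Fin 3) R)
        (Matrix (Fin 3) (Fin 3) R) ∘ₗ φ.equiv.toLinearMap ∘ₗ symInclusion τ R)).2 fun x hx => ?_
      replace hx : (φ.equiv (symInclusion τ R x)).1 = 0 := hx
      apply symInclusion_injective
      apply φ.equiv.injective
      rw [map_zero, map_zero, hfix, exchange]
      refine Prod.ext ?_ ?_
      · have h2 : (φ.equiv (symInclusion τ R x)).2 = _ := congrArg Prod.snd (hfix x)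
        rw [h2]
        simp [exchange, hx]
      · simp [hx]
    · intro m
      have hm : φ.equiv.symm (m, m.transpose) ∈ symElems (τ.baseChange R) := by
        change τ.baseChange R _ = _
        apply φ.equiv.injective
        rw [φ.map_involution]
        simp [exchange]
      rw [← range_symInclusion] at hm
      obtain ⟨x, hx⟩ := hm
      refine ⟨x, ?_⟩
      change (φ.equiv (symInclusion τ R x)).1 = m
      rw [hx]
      simp)

lemma Splitting.symEmbedding_symEquiv (φ : Splitting τ R) (x : R ⊗[F] symElems τ) :
    symEmbedding (φ.symEquiv x) = φ.equiv (symInclusion τ R x) := by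
  have hfix : φ.equiv (symInclusion τ R x) = exchange (φ.equiv (symInclusion τ R x)) := by
    have : symInclusion τ R x ∈ symElems (τ.baseChange R) := by
      rw [← range_symInclusion]; exact ⟨x, rfl⟩
    rw [← φ.map_involution]
    exact congrArg φ.equiv this.symm
  exact Prod.ext rfl (congrArg Prod.snd hfix).symm

lemma Splitting.map_symEmbedding_map_symEquiv (φ : Splitting τ R)
    (N : Submodule R (R ⊗[F] symElems τ)) :
    (N.map φ.symEquiv.toLinearMap).map symEmbedding =
      (N.map (symInclusion τ R)).map φ.equiv.toLinearMap := by
  rw [← Submodule.map_comp, ← Submodule.map_comp]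
  congr 1
  exact LinearMap.ext φ.symEmbedding_symEquiv

lemma symEmbedding_injective : Function.Injective (symEmbedding (R := R)) :=
  fun _ _ h => congrArg Prod.fst h

/-- In terms of a splitting, `lineSym` is the Segre product. -/
lemma map_symEquiv_lineSym (φ : Splitting τ R) {J : Submodule R (R ⊗[F] B)}
    {U W : Submodule R (Fin 3 → R)} (h : J.map φ.equiv.toLinearMap = splitIdeal U W) :
    (lineSym τ J).map φ.symEquiv.toLinearMap = segreProduct U W := by
  apply Submodule.map_injective_of_injective symEmbedding_injective
  rw [φ.map_symEmbedding_map_symEquiv, map_lineSym, map_symPart φ J h]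

variable [IsScalarTower F K B] [IsSemisimpleRing K] [IsAzumaya K B]

/-- After splitting, a point of the Weil restriction is given by two lines. -/
lemma exists_lines_of_splitting (φ : Splitting τ R) (I : (weilSB F K B).obj (.of F R)) :
    ∃ U W, IsSummandOfRank 1 U ∧ IsSummandOfRank 1 W ∧
      (idealOf I).map φ.equiv.toLinearMap = splitIdeal U W := by
  obtain ⟨U, W, h⟩ := exists_eq_splitIdeal (isRightIdeal_map φ (isRightIdeal_idealOf I))
  obtain ⟨hU, hW⟩ := (isWeilPoint_iff_of_splitting φ (isRightIdeal_idealOf I) h).1 ⟨I, rfl⟩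
  exact ⟨U, W, hU, hW, h⟩

lemma isSummandOfRank_lineSym_of_splitting (φ : Splitting τ R)
    (I : (weilSB F K B).obj (.of F R)) : IsSummandOfRank 1 (lineSym τ (idealOf I)) := by
  obtain ⟨U, W, hU, hW, h⟩ := exists_lines_of_splitting φ I
  have := (isSummandOfRank_segreProduct hU hW).map_equiv φ.symEquiv.symm
  rwa [← map_symEquiv_lineSym φ h, ← Submodule.map_comp, LinearEquiv.comp_coe,
    LinearEquiv.self_trans_symm, LinearEquiv.refl_toLinearMap, Submodule.map_id] at this

end Morphism

/-! ### Descent from the split case and the image of the morphism -/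

section Morphism

variable {F K B : Type u} [Field F] [CommRing K] [Algebra F K] [Ring B] [Algebra K B]
  [Algebra F B] {τ : B →ₗ[F] B} {R R' E : Type u} [CommRing R] [Algebra F R]
  [CommRing R'] [Algebra F R'] [Field E] [Algebra F E]

variable (F R E) in
/-- `R` is a direct summand of the `R`-module `R ⊗ E`. -/
lemma exists_retraction_tensor : ∃ ρ : R ⊗[F] E →ₗ[R] R, ρ 1 = 1 := by
  obtain ⟨l, hl⟩ := exists_linearMap_one_eq_one (K := F) (B := E)
  refine ⟨(TensorProduct.AlgebraTensorModule.rid F R R).toLinearMap ∘ₗ l.baseChange R, ?_⟩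
  simp [Algebra.TensorProduct.one_def, hl]

variable (R) in
lemma Splitting.nonempty_tensor (φ : Splitting τ E) : Nonempty (Splitting τ (R ⊗[F] E)) := by
  let : Algebra E (R ⊗[F] E) := Algebra.TensorProduct.rightAlgebra
  have : IsScalarTower F E (R ⊗[F] E) := inferInstance
  exact φ.nonempty_baseChange

lemma extendSubmodule_lineSym_le (f : R →ₐ[F] R') (J : Submodule R (R ⊗[F] B)) :
    extendSubmodule f (lineSym τ J) ≤ lineSym τ (extendSubmodule f J) := by
  refine Submodule.map_le_iff_le_comap.1 ?_
  rw [← extendSubmodule_map_symInclusion, map_lineSym]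
  exact extendSubmodule_symPart_le _ _ _

lemma extendSubmodule_lineSym_tensor (J : Submodule R (R ⊗[F] B)) :
    extendSubmodule (IsScalarTower.toAlgHom F R (R ⊗[F] E)) (lineSym τ J) =
      lineSym τ (extendSubmodule (IsScalarTower.toAlgHom F R (R ⊗[F] E)) J) := by
  apply Submodule.map_injective_of_injective symInclusion_injective
  rw [← extendSubmodule_map_symInclusion, map_lineSym, map_lineSym,
    extendSubmodule_symPart ((Module.Free.chooseBasis F E).baseChange R)]

variable [IsScalarTower F K B] [IsSemisimpleRing K] [IsAzumaya K B]

/-- `(I · τ I) ∩ Sym` is a line over every `R`, by descent from `R ⊗ E`, where `(B, τ)` splits. -/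
lemma isSummandOfRank_lineSym (φ : Splitting τ E) (I : (weilSB F K B).obj (.of F R)) :
    IsSummandOfRank 1 (lineSym τ (idealOf I)) := by
  obtain ⟨φT⟩ := φ.nonempty_tensor R
  obtain ⟨ρ, hρ⟩ := exists_retraction_tensor F R E
  let b := Module.Free.chooseBasis F (symElems τ)
  refine IsLine.isSummandOfRank (b := b.baseChange R) (IsLine.of_extend (T := R ⊗[F] E) hρ ?_)
  rw [extendSubmodule_lineSym_tensor, ← idealOf_map]
  exact (isSummandOfRank_lineSym_of_splitting φT _).isLine _

/-- The morphism `I ↦ (I · τ I) ∩ Sym`. -/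
noncomputable def segreMorphism (φ : Splitting τ E) :
    weilSB F K B ⟶ projectiveSpace F (symElems τ) where
  app R := ↾fun I => ⟨lineSym τ (idealOf (R := R) I), isSummandOfRank_lineSym φ I⟩
  naturality R R' f := by
    refine ConcreteCategory.hom_ext _ _ fun I => Subtype.ext ?_
    let b := Module.Free.chooseBasis F (symElems τ)
    change lineSym τ (idealOf (R := R') ((weilSB F K B).map f I)) =
      extendSubmodule f.hom (lineSym τ (idealOf (R := R) I))
    have h : idealOf (R := R') ((weilSB F K B).map f I) =
        extendSubmodule f.hom (idealOf (R := R) I) :=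
      idealOf_map f.hom I
    refine (IsLine.eq_of_le (b := b.baseChange R') ?_ ?_ ?_).symm
    · exact ((isSummandOfRank_lineSym φ I).extend f.hom).isLine _
    · exact (isSummandOfRank_lineSym (R := R') φ _).isLine _
    · rw [h]
      exact extendSubmodule_lineSym_le _ _

lemma lineOf_segreMorphism (φ : Splitting τ E) (I : (weilSB F K B).obj (.of F R)) :
    lineOf ((segreMorphism φ).app (.of F R) I) = symPart (τ.baseChange R) (idealOf I) :=
  map_lineSym _

/-- The ideal `I` is recovered from the line `(I · τ I) ∩ Sym` as the right ideal that this line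
generates. -/
lemma symPart_mul_top (φ : Splitting τ E) (I : (weilSB F K B).obj (.of F R)) :
    symPart (τ.baseChange R) (idealOf I) * ⊤ = idealOf I := by
  obtain ⟨φT⟩ := φ.nonempty_tensor R
  obtain ⟨ρ, hρ⟩ := exists_retraction_tensor F R E
  apply extendSubmodule_injective hρ
  rw [extendSubmodule_mul, extendSubmodule_top,
    extendSubmodule_symPart ((Module.Free.chooseBasis F E).baseChange R), ← idealOf_map]
  obtain ⟨U, W, hU, hW, h⟩ := exists_lines_of_splitting φT
    ((weilSB F K B).map (CommAlgCat.ofHom (IsScalarTower.toAlgHom F R (R ⊗[F] E))) I)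
  apply Submodule.map_injective_of_injective (f := φT.equiv.toLinearMap) φT.equiv.injective
  refine (Submodule.map_mul _ _ φT.equiv.toAlgHom).trans ?_
  have h2 := map_symPart φT _ h
  have h3 : (⊤ : Submodule (R ⊗[F] E) ((R ⊗[F] E) ⊗[F] B)).map φT.equiv.toLinearMap = ⊤ := by
    rw [Submodule.map_top]
    exact LinearMap.range_eq_top.2 φT.equiv.surjective
  refine Eq.trans (congrArg₂ (· * ·) h2 h3) ?_
  exact (map_symEmbedding_mul_top hU hW).trans h.symm

lemma segreMorphism_app_injective (φ : Splitting τ E) :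
    Function.Injective ((segreMorphism (K := K) φ).app (.of F R)) := by
  intro I I' h
  apply idealOf_injective
  rw [← symPart_mul_top φ I, ← symPart_mul_top φ I', ← lineOf_segreMorphism φ,
    ← lineOf_segreMorphism φ, h]

/-- The identity in the second factor is the transpose of the identity in the first. -/
lemma isSandwichSymm_map_symEmbedding_iff {M : Submodule R (Matrix (Fin 3) (Fin 3) R)} :
    IsSandwichSymm (M.map symEmbedding) ↔ IsSandwichSymm M := by
  constructor
  · intro h l₁ h₁ l₂ h₂ l₃ h₃ x y
    exact congrArg Prod.fst (h _ ⟨l₁, h₁, rfl⟩ _ ⟨l₂, h₂, rfl⟩ _ ⟨l₃, h₃, rfl⟩ (x, 0) (y, 0))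
  · rintro h _ ⟨l₁, h₁, rfl⟩ _ ⟨l₂, h₂, rfl⟩ _ ⟨l₃, h₃, rfl⟩ x y
    refine Prod.ext (h l₁ h₁ l₂ h₂ l₃ h₃ x.1 y.1) ?_
    have := congrArg Matrix.transpose (h l₃ h₃ l₂ h₂ l₁ h₁ y.2.transpose x.2.transpose)
    simpa [Matrix.transpose_mul, symEmbedding, mul_assoc] using this

lemma isSandwichSymm_map_equiv_iff (φ : Splitting τ R) {N : Submodule R (R ⊗[F] B)} :
    IsSandwichSymm (N.map φ.equiv.toLinearMap) ↔ IsSandwichSymm N := by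
  constructor
  · intro h l₁ h₁ l₂ h₂ l₃ h₃ x y
    apply φ.equiv.injective
    simpa using h _ ⟨l₁, h₁, rfl⟩ _ ⟨l₂, h₂, rfl⟩ _ ⟨l₃, h₃, rfl⟩ (φ.equiv x) (φ.equiv y)
  · rintro h _ ⟨l₁, h₁, rfl⟩ _ ⟨l₂, h₂, rfl⟩ _ ⟨l₃, h₃, rfl⟩ x y
    obtain ⟨x, rfl⟩ := φ.equiv.surjective x
    obtain ⟨y, rfl⟩ := φ.equiv.surjective y
    simpa using congrArg φ.equiv (h l₁ h₁ l₂ h₂ l₃ h₃ x y)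

/-- After splitting, the lines that satisfy the sandwich identity are the Segre products. -/
lemma isSandwichSymm_iff_of_splitting (φ : Splitting τ R)
    {N : Submodule R (R ⊗[F] symElems τ)} (hN : IsSummandOfRank 1 N) :
    IsSandwichSymm (N.map (symInclusion τ R)) ↔
      ∃ U W, IsSummandOfRank 1 U ∧ IsSummandOfRank 1 W ∧
        N.map φ.symEquiv.toLinearMap = segreProduct U W := by
  rw [← isSandwichSymm_map_equiv_iff φ, ← φ.map_symEmbedding_map_symEquiv,
    isSandwichSymm_map_symEmbedding_iff]
  have hM := hN.map_equiv φ.symEquiv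
  constructor
  · exact fun h => (h.isRankOne hM).exists_eq_segreProduct hM
  · rintro ⟨U, W, hU, hW, h⟩
    rw [h] at hM ⊢
    exact (isRankOne_segreProduct hW).isSandwichSymm hM

/-- The image of the morphism consists of the lines which satisfy the sandwich identity. -/
theorem mem_range_segreMorphism_iff (φ : Splitting τ E)
    (L : (projectiveSpace F (symElems τ)).obj (.of F R)) :
    (∃ I, (segreMorphism (K := K) φ).app (.of F R) I = L) ↔ IsSandwichSymm (lineOf L) := by
  obtain ⟨φT⟩ := φ.nonempty_tensor R
  obtain ⟨ρ, hρ⟩ := exists_retraction_tensor F R E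
  let b := Module.Free.chooseBasis F B
  let f := IsScalarTower.toAlgHom F R (R ⊗[F] E)
  have hdesc : IsSandwichSymm (lineOf L) ↔ IsSandwichSymm (extendSubmodule f (lineOf L)) := by
    rw [← sandwichIdeal_eq_bot_iff (b := b), ← sandwichIdeal_eq_bot_iff (b := b),
      sandwichIdeal_extend]
    exact (Ideal.map_eq_bot_iff_of_injective (algebraMap_injective_of_retraction hρ)).symm
  rw [hdesc, lineOf, extendSubmodule_map_symInclusion]
  have hLT := L.2.extend f
  constructor
  · rintro ⟨I, rfl⟩
    have h1 : extendSubmodule f ((segreMorphism (K := K) φ).app (.of F R) I).1 =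
        lineSym τ (idealOf (R := R ⊗[F] E) ((weilSB F K B).map (CommAlgCat.ofHom f) I)) := by
      rw [idealOf_map]
      exact extendSubmodule_lineSym_tensor _
    obtain ⟨U, W, hU, hW, h⟩ := exists_lines_of_splitting φT
      ((weilSB F K B).map (CommAlgCat.ofHom f) I)
    rw [isSandwichSymm_iff_of_splitting φT hLT]
    refine ⟨U, W, hU, hW, ?_⟩
    rw [← map_symEquiv_lineSym φT h]
    exact congrArg _ h1
  · intro h
    obtain ⟨U, W, hU, hW, h⟩ := (isSandwichSymm_iff_of_splitting φT hLT).1 h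
    -- the right ideal generated by the line is a point of the Weil restriction
    have hJ : IsRightIdeal (lineOf L * ⊤) := by
      intro x hx d
      have : lineOf L * ⊤ * ⊤ ≤ lineOf L * ⊤ := by
        rw [mul_assoc]
        exact mul_le_mul' le_rfl le_top
      exact this (Submodule.mul_mem_mul hx trivial)
    have hsplit : (extendSubmodule f (lineOf L * ⊤)).map φT.equiv.toLinearMap =
        splitIdeal U W := by
      have h3 : (⊤ : Submodule (R ⊗[F] E) ((R ⊗[F] E) ⊗[F] B)).map φT.equiv.toLinearMap = ⊤ := by
        rw [Submodule.map_top]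
        exact LinearMap.range_eq_top.2 φT.equiv.surjective
      rw [← map_symEmbedding_mul_top hU hW, ← h, φT.map_symEmbedding_map_symEquiv,
        ← extendSubmodule_map_symInclusion, extendSubmodule_mul, extendSubmodule_top]
      refine (Submodule.map_mul _ _ φT.equiv.toAlgHom).trans ?_
      exact congrArg₂ (· * ·) rfl h3
    have hWT : IsWeilPoint K (extendSubmodule f (lineOf L * ⊤)) :=
      (isWeilPoint_iff_of_splitting φT (hJ.extend f) hsplit).2 ⟨hU, hW⟩
    obtain ⟨I, hI⟩ := isWeilPoint_of_extend hJ hWT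
    refine ⟨I, Subtype.ext ?_⟩
    change lineSym τ (idealOf I) = L.1
    apply extendSubmodule_injective hρ
    rw [extendSubmodule_lineSym_tensor, hI]
    apply Submodule.map_injective_of_injective φT.symEquiv.injective
    exact (map_symEquiv_lineSym φT hsplit).trans h.symm

/-- After splitting, the morphism is the Segre embedding. -/
theorem exists_equiv_of_splitting (φ : Splitting τ E) (φR : Splitting τ R) :
    ∃ e : (weilSB F K B).obj (.of F R) ≃ P2 R × P2 R, ∀ I : (weilSB F K B).obj (.of F R),
      (idealOf I).map φR.equiv.toLinearMap = splitIdeal (e I).1.1 (e I).2.1 ∧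
      (lineOf ((segreMorphism φ).app (.of F R) I)).map φR.equiv.toLinearMap =
        (segreProduct (e I).1.1 (e I).2.1).map symEmbedding := by
  choose U W hU hW h using exists_lines_of_splitting (K := K) φR
  refine ⟨Equiv.ofBijective (fun I => (⟨U I, hU I⟩, ⟨W I, hW I⟩)) ⟨?_, ?_⟩, fun I => ⟨h I, ?_⟩⟩
  · intro I I' hII
    apply idealOf_injective
    apply Submodule.map_injective_of_injective (f := φR.equiv.toLinearMap) φR.equiv.injective
    obtain ⟨h1, h2⟩ := Prod.ext_iff.1 hII
    refine (h I).trans (Eq.trans ?_ (h I').symm)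
    rw [show U I = U I' from congrArg Subtype.val h1, show W I = W I' from congrArg Subtype.val h2]
  · rintro ⟨⟨U', hU'⟩, ⟨W', hW'⟩⟩
    let J := (splitIdeal U' W').map φR.equiv.symm.toLinearMap
    have hJφ : J.map φR.equiv.toLinearMap = splitIdeal U' W' := by
      rw [← Submodule.map_comp]
      convert Submodule.map_id _
      ext x <;> simp
    have hJ : IsRightIdeal J := by
      rintro _ ⟨x, hx, rfl⟩ d
      refine ⟨x * φR.equiv d, isRightIdeal_splitIdeal U' W' x hx _, ?_⟩
      simp
    obtain ⟨I, hI⟩ := (isWeilPoint_iff_of_splitting (K := K) φR hJ hJφ).2 ⟨hU', hW'⟩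
    refine ⟨I, ?_⟩
    have h1 := h I
    rw [hI, hJφ] at h1
    obtain ⟨h2, h3⟩ := splitIdeal_injective h1
    exact Prod.ext (Subtype.ext h2.symm) (Subtype.ext h3.symm)
  · rw [lineOf_segreMorphism φ I]
    exact map_symPart φR _ (h I)

end Morphism

/-! ### Charts of projective space -/

section Chart

open MvPolynomial HomogeneousLocalization

attribute [local instance] MvPolynomial.gradedAlgebra

variable {F : Type u} [Field F] {n : ℕ} {R R' : Type u} [CommRing R] [Algebra F R]
  [CommRing R'] [Algebra F R']

lemma aeval_mul_of_isHomogeneous {σ : Type*} [Fintype σ] {S : Type*} [CommRing S] [Algebra F S]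
    {p : MvPolynomial σ F} {m : ℕ} (hp : p.IsHomogeneous m) (c : S) (x : σ → S) :
    aeval (fun j => c * x j) p = c ^ m * aeval x p := by
  rw [aeval_def, aeval_def, eval₂_eq', eval₂_eq', Finset.mul_sum]
  refine Finset.sum_congr rfl fun d hd => ?_
  have h : ∑ i, d i = m := by
    rw [← hp (mem_support_iff.1 hd), Finsupp.weight_apply, Finsupp.sum_fintype _ _ (by simp)]
    simp
  simp only [mul_pow, Finset.prod_mul_distrib, Finset.prod_pow_eq_pow_sum, h]
  ring

variable (F n) in
/-- The grading of the coordinate ring of projective space. -/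
abbrev coordGrading : ℕ → Submodule F (MvPolynomial (Fin n) F) := homogeneousSubmodule (Fin n) F

lemma X_mem_coordGrading (i : Fin n) : X i ∈ coordGrading F n 1 := isHomogeneous_X F i

variable (F n) in
/-- The projective space `ℙⁿ⁻¹` over `F`. -/
noncomputable abbrev projScheme : Scheme.{u} := Proj (coordGrading F n)

variable (F n) in
/-- The structure morphism of projective space. -/
noncomputable def projToSpec : projScheme F n ⟶ Spec (.of F) :=
  Proj.toSpecZero (coordGrading F n) ≫
    Spec.map (CommRingCat.ofHom (algebraMap F (coordGrading F n 0)))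

/-- Evaluation of homogeneous fractions `p / fᵐ` at the point `v`, where `f(v)` is a unit. -/
noncomputable def evalAway (v : Fin n → R) (f : MvPolynomial (Fin n) F)
    (hf : IsUnit (aeval v f)) : Away (coordGrading F n) f →+* R :=
  (Localization.awayLift (aeval v : MvPolynomial (Fin n) F →ₐ[F] R).toRingHom f hf).comp
    (algebraMap (Away (coordGrading F n) f) (Localization.Away f))

lemma evalAway_mk (v : Fin n → R) {f : MvPolynomial (Fin n) F} (hf : IsUnit (aeval v f)) {d : ℕ}
    (hd : f ∈ coordGrading F n d) (m : ℕ) (p : MvPolynomial (Fin n) F)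
    (hp : p ∈ coordGrading F n (m • d)) :
    evalAway v f hf (Away.mk (coordGrading F n) hd m p hp) * aeval v f ^ m = aeval v p := by
  have h := IsLocalization.mk'_spec (Localization.Away f) p (⟨f ^ m, m, rfl⟩ : Submonoid.powers f)
  have h' := congrArg
    (Localization.awayLift (aeval v : MvPolynomial (Fin n) F →ₐ[F] R).toRingHom f hf) h
  rw [map_mul, Localization.awayLift, IsLocalization.Away.lift_eq,
    IsLocalization.Away.lift_eq] at h'
  rw [evalAway, RingHom.comp_apply, HomogeneousLocalization.algebraMap_apply, Away.val_mk,
    Localization.mk_eq_mk', ← map_pow]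
  exact h'

lemma evalAway_X_mk (v : Fin n → R) {i : Fin n} (hi : IsUnit (aeval (R := F) v (X i))) (m : ℕ)
    (p : MvPolynomial (Fin n) F) (hp : p ∈ coordGrading F n (m • 1)) :
    evalAway v (X i) hi (Away.mk (coordGrading F n) (X_mem_coordGrading i) m p hp) * v i ^ m =
      aeval v p :=
  (congrArg (_ * · ^ m) (aeval_X v i).symm).trans (evalAway_mk v hi _ m p hp)

lemma comp_evalAway (h : R →ₐ[F] R') (v : Fin n → R) {f : MvPolynomial (Fin n) F}
    (hf : IsUnit (aeval v f)) (hf' : IsUnit (aeval (h ∘ v) f)) :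
    h.toRingHom.comp (evalAway v f hf) = evalAway (h ∘ v) f hf' := by
  rw [evalAway, evalAway, ← RingHom.comp_assoc]
  congr 1
  apply IsLocalization.ringHom_ext (Submonoid.powers f)
  ext p
  · simp
  · simp

/-- Evaluation is compatible with the passage from a chart to a smaller one. -/
lemma evalAway_awayMap (v : Fin n → R) {f g x : MvPolynomial (Fin n) F} {e : ℕ}
    (hg : g ∈ coordGrading F n e) (hx : x = f * g) (hf : IsUnit (aeval v f))
    (hxu : IsUnit (aeval v x)) :
    (evalAway v x hxu).comp (awayMap (coordGrading F n) hg hx) = evalAway v f hf := by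
  ext a
  rw [evalAway, evalAway, RingHom.comp_apply, RingHom.comp_apply, RingHom.comp_apply,
    HomogeneousLocalization.algebraMap_apply, HomogeneousLocalization.algebraMap_apply,
    val_awayMap, ← RingHom.comp_apply]
  congr 1
  apply IsLocalization.ringHom_ext (Submonoid.powers f)
  ext p
  · simp
  · simp

lemma evalAway_fromZeroRingHom (v : Fin n → R) {f : MvPolynomial (Fin n) F}
    (hf : IsUnit (aeval v f)) (c : F) :
    evalAway v f hf (fromZeroRingHom (coordGrading F n) _ (algebraMap F _ c)) =
      algebraMap F R c := by
  rw [evalAway, RingHom.comp_apply, HomogeneousLocalization.algebraMap_apply]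
  have : (fromZeroRingHom (coordGrading F n) (Submonoid.powers f)
      (algebraMap F (coordGrading F n 0) c)).val =
      algebraMap (MvPolynomial (Fin n) F) (Localization.Away f) (C c) := by
    rw [← Localization.mk_one_eq_algebraMap]
    rfl
  rw [this]
  simp

/-- Proportional vectors define the same point of a chart. -/
lemma evalAway_congr {v w : Fin n → R} {i : Fin n} (hv : IsUnit (aeval (R := F) v (X i)))
    (hw : IsUnit (aeval (R := F) w (X i))) (h : ∀ j, v i * w j = w i * v j) :
    evalAway v (X i) hv = evalAway w (X i) hw := by
  ext a
  obtain ⟨m, p, hp, rfl⟩ := Away.mk_surjective _ (X_mem_coordGrading i) a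
  have h1 := evalAway_X_mk v hv m p hp
  have h2 := evalAway_X_mk w hw m p hp
  have hp' : p.IsHomogeneous m := by simpa using hp
  have h3 : (v i) ^ m * aeval w p = (w i) ^ m * aeval v p := by
    rw [← aeval_mul_of_isHomogeneous hp', ← aeval_mul_of_isHomogeneous hp', funext h]
  rw [← h1, ← h2] at h3
  rw [aeval_X] at hv hw
  apply ((hv.pow m).mul (hw.pow m)).mul_left_cancel
  linear_combination -h3

/-- `p(X) / Xᵢᵐ` is `p` evaluated at the fractions `Xⱼ / Xᵢ`. -/
lemma Away.mk_eq_eval₂ {i : Fin n} (m : ℕ) (p : MvPolynomial (Fin n) F)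
    (hp : p ∈ coordGrading F n (m • 1)) :
    Away.mk (coordGrading F n) (X_mem_coordGrading i) m p hp =
      eval₂ ((fromZeroRingHom (coordGrading F n) (Submonoid.powers (X i))).comp
        (algebraMap F (coordGrading F n 0)))
        (fun j => Away.mk (coordGrading F n) (X_mem_coordGrading i) 1 (X j)
          (X_mem_coordGrading j)) p := by
  apply val_injective
  have hp' : p.IsHomogeneous m := by simpa using hp
  let c : Localization.Away (X i : MvPolynomial (Fin n) F) :=
    Localization.mk 1 ⟨X i, 1, pow_one _⟩
  have hc : ∀ q (k : ℕ) h, Localization.mk q (⟨X i ^ k, h⟩ : Submonoid.powers (X i)) =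
      c ^ k * algebraMap (MvPolynomial (Fin n) F) _ q := by
    intro q k h
    rw [Localization.mk_pow, ← Localization.mk_one_eq_algebraMap, Localization.mk_mul]
    simp
    rfl
  rw [Away.val_mk, hc]
  have hval : ∀ x, HomogeneousLocalization.val x = algebraMap (Away (coordGrading F n) (X i))
    (Localization.Away (X i)) x := fun _ => rfl
  rw [hval, hom_eval₂]
  have h1 : algebraMap (MvPolynomial (Fin n) F) (Localization.Away (X i)) p =
      aeval (R := F) (fun j => algebraMap (MvPolynomial (Fin n) F)
        (Localization.Away (X i : MvPolynomial (Fin n) F)) (X j)) p := by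
    have := aeval_algebraMap_apply (R := F) (Localization.Away (X i : MvPolynomial (Fin n) F))
      (X : Fin n → MvPolynomial (Fin n) F) p
    rw [aeval_X_left_apply] at this
    exact this.symm
  rw [h1, ← aeval_mul_of_isHomogeneous hp', aeval_def]
  congr 1
  ext j
  rw [← hval, Away.val_mk, hc, pow_one]

/-- Every `R`-point of a chart is given by evaluation at a vector. -/
lemma exists_eq_evalAway {i : Fin n} (χ : Away (coordGrading F n) (X i) →+* R)
    (hχ : ∀ c : F, χ (fromZeroRingHom (coordGrading F n) _ (algebraMap F _ c)) =
      algebraMap F R c) :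
    ∃ (v : Fin n → R) (hv : v i = 1), χ = evalAway v (X i) (by simp [hv]) := by
  let w : Fin n → R := fun j =>
    χ (Away.mk (coordGrading F n) (X_mem_coordGrading i) 1 (X j) (X_mem_coordGrading j))
  have hwi : w i = 1 := by
    have : Away.mk (coordGrading F n) (X_mem_coordGrading i) 1 (X i)
        (X_mem_coordGrading i) = 1 := by
      apply val_injective
      rw [Away.val_mk, val_one]
      simp only [pow_one]
      exact Localization.mk_self
        (⟨X i, 1, pow_one _⟩ : Submonoid.powers (X i : MvPolynomial (Fin n) F))
    change χ _ = 1
    rw [this, map_one]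
  refine ⟨w, hwi, ?_⟩
  ext a
  obtain ⟨m, p, hp, rfl⟩ := Away.mk_surjective _ (X_mem_coordGrading i) a
  have h1 := evalAway_X_mk (i := i) w (by simp [hwi]) m p hp
  simp only [hwi, one_pow, mul_one] at h1
  rw [h1, Away.mk_eq_eval₂, hom_eval₂, aeval_def]
  congr 1
  ext c
  exact hχ c

/-- The `R`-point of projective space with homogeneous coordinates `v`, where `vᵢ` is a unit. -/
noncomputable def chartPoint (F : Type u) [Field F] {n : ℕ} {R : Type u} [CommRing R] [Algebra F R]
    (v : Fin n → R) (i : Fin n) (hv : IsUnit (v i)) : Spec (.of R) ⟶ projScheme F n :=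
  Spec.map (CommRingCat.ofHom (evalAway v (X i) (by rwa [aeval_X]))) ≫
    Proj.awayι (coordGrading F n) (X i) (X_mem_coordGrading i) one_pos

lemma SpecMap_chartPoint (h : R →ₐ[F] R') (v : Fin n → R) (i : Fin n) (hv : IsUnit (v i)) :
    Spec.map (CommRingCat.ofHom h.toRingHom) ≫ chartPoint F v i hv =
      chartPoint F (h ∘ v) i (hv.map h) := by
  rw [chartPoint, chartPoint, ← Spec.map_comp_assoc, ← CommRingCat.ofHom_comp, comp_evalAway]

lemma chartPoint_projToSpec (v : Fin n → R) (i : Fin n) (hv : IsUnit (v i)) :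
    chartPoint F v i hv ≫ projToSpec F n = Spec.map (CommRingCat.ofHom (algebraMap F R)) := by
  rw [chartPoint, projToSpec, Category.assoc, Proj.awayι_toSpecZero_assoc, ← Spec.map_comp,
    ← Spec.map_comp, ← CommRingCat.ofHom_comp, ← CommRingCat.ofHom_comp]
  congr 2
  ext c
  exact evalAway_fromZeroRingHom v (by rwa [aeval_X]) c

lemma chartPoint_congr {v w : Fin n → R} {i : Fin n} (hv : IsUnit (v i)) (hw : IsUnit (w i))
    (h : ∀ j, v i * w j = w i * v j) : chartPoint F v i hv = chartPoint F w i hw := by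
  rw [chartPoint, chartPoint, evalAway_congr _ _ h]

/-- The point with homogeneous coordinates `v` does not depend on the chart. -/
lemma chartPoint_eq_chartPoint (v : Fin n → R) {i j : Fin n} (hi : IsUnit (v i))
    (hj : IsUnit (v j)) : chartPoint F v i hi = chartPoint F v j hj := by
  have hu : IsUnit (aeval (R := F) v (X i * X j)) := by simpa using hi.mul hj
  rw [chartPoint, chartPoint, ← evalAway_awayMap v (X_mem_coordGrading j) rfl _ hu,
    ← evalAway_awayMap v (X_mem_coordGrading i) (mul_comm (X i) (X j)) _ hu,
    CommRingCat.ofHom_comp, CommRingCat.ofHom_comp, Spec.map_comp, Spec.map_comp, Category.assoc,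
    Category.assoc, Proj.SpecMap_awayMap_awayι, Proj.SpecMap_awayMap_awayι]

lemma basicOpen_eq_top_of_isUnit {r : R} (hr : IsUnit r) : PrimeSpectrum.basicOpen r = ⊤ :=
  eq_top_iff.2 fun p _ h => p.2.ne_top (Ideal.eq_top_of_isUnit_mem _ h hr)

lemma isUnit_of_basicOpen_eq_top {r : R} (hr : PrimeSpectrum.basicOpen r = ⊤) : IsUnit r := by
  by_contra h
  obtain ⟨m, hm, hrm⟩ := exists_max_ideal_of_mem_nonunits h
  have : (⟨m, hm.isPrime⟩ : PrimeSpectrum R) ∈ PrimeSpectrum.basicOpen r := by rw [hr]; trivial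
  exact this hrm

/-- The point with homogeneous coordinates `v` lies in the `j`-th chart where `vⱼ ≠ 0`. -/
lemma chartPoint_preimage_basicOpen (v : Fin n → R) {i : Fin n} (hi : IsUnit (v i)) (j : Fin n) :
    (chartPoint F v i hi ⁻¹ᵁ Proj.basicOpen (coordGrading F n) (X j) :
      (Spec (.of R)).Opens) = PrimeSpectrum.basicOpen (v j) := by
  rw [chartPoint, Scheme.Hom.comp_preimage,
    Proj.awayι_preimage_basicOpen _ _ _ (X_mem_coordGrading j) one_pos]
  set e := Away.isLocalizationElem (𝒜 := coordGrading F n) (X_mem_coordGrading i)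
    (X_mem_coordGrading j)
  change PrimeSpectrum.basicOpen (evalAway v (X i) _ e) = _
  have h1 := evalAway_X_mk (F := F) v (by rwa [aeval_X]) 1 (X j ^ 1)
    (by simpa using X_mem_coordGrading (F := F) j)
  replace h1 := h1.trans (show _ = v j by rw [map_pow, aeval_X, pow_one])
  rw [← h1, PrimeSpectrum.basicOpen_mul, basicOpen_eq_top_of_isUnit (hi.pow 1), inf_top_eq]

/-- Equal points have proportional coordinates. -/
lemma proportional_of_chartPoint_eq {v w : Fin n → R} {i j : Fin n} {hi : IsUnit (v i)}
    {hj : IsUnit (w j)} (h : chartPoint F v i hi = chartPoint F w j hj) (a b : Fin n) :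
    v a * w b = v b * w a := by
  have hwi : IsUnit (w i) := by
    have h1 := chartPoint_preimage_basicOpen (F := F) w hj i
    rw [← h, chartPoint_preimage_basicOpen, basicOpen_eq_top_of_isUnit hi] at h1
    exact isUnit_of_basicOpen_eq_top h1.symm
  rw [← chartPoint_eq_chartPoint w hwi hj, chartPoint, chartPoint, cancel_mono] at h
  have h2 := Spec.map_injective h
  have h3 : evalAway v (X i) _ = evalAway w (X i) _ := congrArg CommRingCat.Hom.hom h2
  have h4 : ∀ a, v a * w i = w a * v i := by
    intro a
    have h5 := evalAway_X_mk (F := F) v (by rwa [aeval_X]) 1 (X a) (X_mem_coordGrading a)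
    have h6 := evalAway_X_mk (F := F) w (by rwa [aeval_X]) 1 (X a) (X_mem_coordGrading a)
    replace h5 := h5.trans (aeval_X v a)
    replace h6 := h6.trans (aeval_X w a)
    rw [pow_one] at h5 h6
    rw [← h5, ← h6, h3]
    ring
  apply (hi.mul hwi).mul_left_cancel
  linear_combination (w b * v i) * h4 a - (w a * v i) * h4 b

end Chart

/-! ### Points of projective space and lines -/

section Local

variable (F : Type u) [Field F] {R R' R'' : Type u} [CommRing R] [Algebra F R]
  [CommRing R'] [Algebra F R'] [CommRing R''] [Algebra F R'']

variable {F} in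
/-- The morphism `Spec R' ⟶ Spec R` defined by a homomorphism of `F`-algebras. -/
noncomputable abbrev specMap (h : R →ₐ[F] R') : Spec (.of R') ⟶ Spec (.of R) :=
  Spec.map (CommRingCat.ofHom h.toRingHom)

variable {F} in
lemma specMap_comp (h : R →ₐ[F] R') (h' : R' →ₐ[F] R'') :
    specMap (h'.comp h) = specMap h' ≫ specMap h := by
  rw [specMap, specMap, specMap, ← Spec.map_comp, ← CommRingCat.ofHom_comp]
  rfl

/-- The localization map `R → R_f` as a homomorphism of `F`-algebras. -/
noncomputable abbrev toAway (f : R) : R →ₐ[F] Localization.Away f :=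
  IsScalarTower.toAlgHom F R (Localization.Away f)

variable {F} in
lemma exists_comp_toAway (h : R →ₐ[F] R') (f : R) :
    ∃ k : Localization.Away f →ₐ[F] Localization.Away (h f),
      k.comp (toAway F f) = (toAway F (h f)).comp h := by
  have hu : ∀ y : Submonoid.powers f, IsUnit (((toAway F (h f)).comp h) y) := by
    rintro ⟨_, m, rfl⟩
    simp only [map_pow]
    exact (IsLocalization.Away.algebraMap_isUnit (S := Localization.Away (h f)) (h f)).pow m
  refine ⟨IsLocalization.liftAlgHom (M := Submonoid.powers f) (S := Localization.Away f)
    (f := (toAway F (h f)).comp h) hu, ?_⟩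
  ext x
  simp

lemma span_range_eq_top_of_notMem {f : PrimeSpectrum R → R} (hf : ∀ p, f p ∉ p.asIdeal) :
    Ideal.span (Set.range f) = ⊤ := by
  by_contra h
  obtain ⟨m, hm, hle⟩ := Ideal.exists_le_maximal _ h
  exact hf ⟨m, hm.isPrime⟩ (hle (Ideal.subset_span ⟨_, rfl⟩))

/-- Morphisms from `Spec R` are determined locally. -/
lemma spec_hom_ext {Y : Scheme.{u}} {g g' : Spec (.of R) ⟶ Y}
    (h : ∀ p : PrimeSpectrum R, ∃ f ∉ p.asIdeal,
      specMap (toAway F f) ≫ g = specMap (toAway F f) ≫ g') : g = g' := by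
  choose f hf hfg using h
  exact (Scheme.affineOpenCoverOfSpanRangeEqTop (R := .of R) f
    (span_range_eq_top_of_notMem hf)).openCover.hom_ext _ _ hfg

/-- Elements of `R` are determined locally. -/
lemma eq_of_forall_toAway {x y : R}
    (h : ∀ p : PrimeSpectrum R, ∃ f ∉ p.asIdeal, toAway F f x = toAway F f y) : x = y := by
  choose f hf hfx using h
  let I : Ideal R := (Ideal.span {x - y}).annihilator
  have hI : I = ⊤ := by
    by_contra hI
    obtain ⟨m, hm, hle⟩ := Ideal.exists_le_maximal _ hI
    let p : PrimeSpectrum R := ⟨m, hm.isPrime⟩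
    obtain ⟨⟨_, k, rfl⟩, hk⟩ :=
      (IsLocalization.eq_iff_exists (Submonoid.powers (f p)) (Localization.Away (f p))).1 (hfx p)
    have : f p ^ k ∈ I := by
      rw [Submodule.mem_annihilator_span_singleton, smul_eq_mul, mul_sub, sub_eq_zero]
      exact hk
    exact hf p (hm.isPrime.mem_of_pow_mem k (hle this))
  have h1 : (1 : R) ∈ I := by rw [hI]; trivial
  rw [Submodule.mem_annihilator_span_singleton, one_smul] at h1
  exact sub_eq_zero.1 h1

end Local

section Represents

variable {F : Type u} [Field F] {n : ℕ} {R R' : Type u} [CommRing R] [Algebra F R]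
  [CommRing R'] [Algebra F R'] {V : Type u} [AddCommGroup V] [Module F V]
  (b : Module.Basis (Fin n) F V)

lemma chartPoint_eq_of_proportional {v w : Fin n → R} {i j : Fin n} (hi : IsUnit (v i))
    (hj : IsUnit (w j)) (h : ∀ k l, v k * w l = v l * w k) :
    chartPoint F v i hi = chartPoint F w j hj := by
  have hvj : IsUnit (v j) := by
    have := hi.mul hj
    rw [h i j] at this
    exact isUnit_of_mul_isUnit_left this
  rw [chartPoint_eq_chartPoint v hi hvj]
  exact chartPoint_congr hvj hj fun k => by rw [h j k, mul_comm]

/-- The coordinates of an element of `R ⊗ V`. -/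
noncomputable abbrev coords (x : R ⊗[F] V) : Fin n → R := fun i => (b.baseChange R).repr x i

lemma coords_rTensor (h : R →ₐ[F] R') (x : R ⊗[F] V) :
    coords b (h.toLinearMap.rTensor V x) = h ∘ coords b x :=
  funext fun i => repr_rTensor b h x i

/-- The morphism `g : Spec R ⟶ ℙⁿ⁻¹` represents `N ⊆ R ⊗ V`: over each `R`-algebra, an element of
the base change of `N` with a unit coordinate is a system of homogeneous coordinates of `g`. -/
def Represents (g : Spec (.of R) ⟶ projScheme F n) (N : Submodule R (R ⊗[F] V)) : Prop :=
  ∀ (R' : Type u) [CommRing R'] [Algebra F R'] (h : R →ₐ[F] R'), ∀ x ∈ extendSubmodule h N,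
    ∀ (i : Fin n) (hi : IsUnit (coords b x i)), specMap h ≫ g = chartPoint F (coords b x) i hi

variable {b} {g g' : Spec (.of R) ⟶ projScheme F n} {N N' : Submodule R (R ⊗[F] V)}

lemma Represents.extend (hg : Represents b g N) (h : R →ₐ[F] R') :
    Represents b (specMap h ≫ g) (extendSubmodule h N) := by
  intro R'' _ _ h' x hx i hi
  rw [← extendSubmodule_comp] at hx
  rw [← Category.assoc, ← specMap_comp]
  exact hg R'' _ x hx i hi

lemma IsLine.exists_notMem (hN : IsLine (b.baseChange R) N) (p : PrimeSpectrum R) :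
    ∃ x ∈ N, ∃ i, coords b x i ∉ p.asIdeal := by
  by_contra! h
  refine p.2.ne_top (eq_top_iff.2 ?_)
  rw [← hN.span_eq_top, Ideal.span_le]
  rintro _ ⟨v, hv, i, rfl⟩
  exact h v hv i

variable (b) in
lemma isUnit_coords_rTensor {h : R →ₐ[F] R'} {x : R ⊗[F] V} {i : Fin n}
    (hu : IsUnit (h (coords b x i))) : IsUnit (coords b (h.toLinearMap.rTensor V x) i) := by
  rwa [coords_rTensor]

lemma isUnit_toAway (f : R) : IsUnit (toAway F f f) :=
  IsLocalization.Away.algebraMap_isUnit (S := Localization.Away f) f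

/-- A line is represented by at most one morphism. -/
lemma Represents.unique (hN : IsLine (b.baseChange R) N) (hg : Represents b g N)
    (hg' : Represents b g' N) : g = g' := by
  refine spec_hom_ext F fun p => ?_
  obtain ⟨x, hx, i, hi⟩ := hN.exists_notMem p
  refine ⟨_, hi, ?_⟩
  have hu := isUnit_coords_rTensor b (isUnit_toAway (F := F) (coords b x i))
  rw [hg _ _ _ (rTensor_mem_extendSubmodule _ hx) i hu,
    hg' _ _ _ (rTensor_mem_extendSubmodule _ hx) i hu]

/-- A morphism represents at most one line. -/
lemma Represents.eq_line (hN : IsLine (b.baseChange R) N) (hN' : IsLine (b.baseChange R) N')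
    (hg : Represents b g N) (hg' : Represents b g N') : N = N' := by
  have key : ∀ v ∈ N, ∀ w ∈ N', ∀ k l,
      coords b v k * coords b w l = coords b v l * coords b w k := by
    intro v hv w hw k l
    refine eq_of_forall_toAway F fun p => ?_
    obtain ⟨x, hx, i, hi⟩ := hN.exists_notMem p
    obtain ⟨y, hy, j, hj⟩ := hN'.exists_notMem p
    refine ⟨coords b x i * coords b y j, fun h => (p.2.mem_or_mem h).elim hi hj, ?_⟩
    set h := toAway F (coords b x i * coords b y j)
    have hu : IsUnit (h (coords b x i) * h (coords b y j)) := by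
      rw [← map_mul]; exact isUnit_toAway _
    have hxu := isUnit_coords_rTensor b (isUnit_of_mul_isUnit_left hu)
    have hyu := isUnit_coords_rTensor b (isUnit_of_mul_isUnit_right hu)
    have h1 := hg _ h _ (rTensor_mem_extendSubmodule _ hx) i hxu
    rw [hg' _ h _ (rTensor_mem_extendSubmodule _ hy) j hyu] at h1
    have h2 := proportional_of_chartPoint_eq h1 l k
    rw [coords_rTensor, coords_rTensor] at h2
    simp only [Function.comp_apply] at h2
    have e1 : ∀ k, h (coords b v k) * h (coords b x i) = h (coords b v i) * h (coords b x k) :=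
      fun k => by rw [← map_mul, ← map_mul, hN.proportional v hv x hx k i]
    have e2 : ∀ k, h (coords b w k) * h (coords b y j) = h (coords b w j) * h (coords b y k) :=
      fun k => by rw [← map_mul, ← map_mul, hN'.proportional w hw y hy k j]
    apply hu.mul_right_cancel
    rw [map_mul, map_mul]
    linear_combination h (coords b w l) * h (coords b y j) * e1 k +
      h (coords b v i) * h (coords b x k) * e2 l -
      h (coords b w k) * h (coords b y j) * e1 l - h (coords b v i) * h (coords b x l) * e2 k +
      h (coords b v i) * h (coords b w j) * h2
  exact le_antisymm (hN'.le_of_proportional fun v hv w hw k l => by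
      linear_combination key w hw v hv l k) (hN.le_of_proportional key)

/-- It suffices to test locally whether `g` represents a line. -/
lemma IsLine.represents (hN : IsLine (b.baseChange R) N)
    (h : ∀ p : PrimeSpectrum R, ∃ f ∉ p.asIdeal, ∃ x ∈ extendSubmodule (toAway F f) N,
      ∃ (i : Fin n) (hi : IsUnit (coords b x i)),
        specMap (toAway F f) ≫ g = chartPoint F (coords b x) i hi) :
    Represents b g N := by
  intro R' _ _ φ y hy j hj
  refine spec_hom_ext F fun q => ?_
  obtain ⟨f, hf, x, hx, i, hi, hxg⟩ := h (q.comap φ.toRingHom)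
  refine ⟨φ f, hf, ?_⟩
  obtain ⟨k, hk⟩ := exists_comp_toAway φ f
  have hu := isUnit_coords_rTensor b (hi.map k)
  rw [← Category.assoc, ← specMap_comp, ← hk, specMap_comp, Category.assoc, hxg,
    SpecMap_chartPoint, SpecMap_chartPoint]
  refine chartPoint_eq_of_proportional _ _ fun c d => ?_
  rw [← coords_rTensor, ← coords_rTensor]
  refine (hN.extend (k.comp (toAway F f))).proportional _ ?_ _ ?_ c d
  · rw [extendSubmodule_comp]
    exact rTensor_mem_extendSubmodule _ hx
  · rw [hk, extendSubmodule_comp]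
    exact rTensor_mem_extendSubmodule _ hy

variable (F) in
/-- Compatible morphisms on a covering of `Spec R` by basic open sets can be glued. -/
lemma exists_glue {Y : Scheme.{u}} {f : PrimeSpectrum R → R} (hf : ∀ p, f p ∉ p.asIdeal)
    (γ : ∀ p, Spec (.of (Localization.Away (f p))) ⟶ Y)
    (h : ∀ p q, ∀ (T : Type u) [CommRing T] [Algebra F T]
      (α : Localization.Away (f p) →ₐ[F] T) (β : Localization.Away (f q) →ₐ[F] T),
      α.comp (toAway F (f p)) = β.comp (toAway F (f q)) → specMap α ≫ γ p = specMap β ≫ γ q) :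
    ∃ g : Spec (.of R) ⟶ Y, ∀ p, specMap (toAway F (f p)) ≫ g = γ p := by
  have key : ∀ p q : PrimeSpectrum R,
      Limits.pullback.fst
        (Spec.map (CommRingCat.ofHom (algebraMap R (Localization.Away (f p)))))
        (Spec.map (CommRingCat.ofHom (algebraMap R (Localization.Away (f q))))) ≫ γ p =
      Limits.pullback.snd
        (Spec.map (CommRingCat.ofHom (algebraMap R (Localization.Away (f p)))))
        (Spec.map (CommRingCat.ofHom (algebraMap R (Localization.Away (f q))))) ≫ γ q := by
    intro p q
    rw [← cancel_epi (pullbackSpecIso R (Localization.Away (f p)) (Localization.Away (f q))).inv,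
      pullbackSpecIso_inv_fst_assoc, pullbackSpecIso_inv_snd_assoc]
    refine h p q (Localization.Away (f p) ⊗[R] Localization.Away (f q))
      Algebra.TensorProduct.includeLeft
      ((Algebra.TensorProduct.includeRight : Localization.Away (f q) →ₐ[R]
        Localization.Away (f p) ⊗[R] Localization.Away (f q)).restrictScalars F) ?_
    ext r
    exact Algebra.TensorProduct.tmul_one_eq_one_tmul r
  let C := (Scheme.affineOpenCoverOfSpanRangeEqTop (R := .of R) f
    (span_range_eq_top_of_notMem hf)).openCover
  exact ⟨C.glueMorphisms γ key, fun p => C.ι_glueMorphisms γ key p⟩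

/-- Every line is represented by a morphism. -/
lemma IsLine.exists_represents (hN : IsLine (b.baseChange R) N) :
    ∃ g : Spec (.of R) ⟶ projScheme F n, Represents b g N ∧
      g ≫ projToSpec F n = Spec.map (CommRingCat.ofHom (algebraMap F R)) := by
  choose x hx i hi using hN.exists_notMem
  have hu := fun p => isUnit_coords_rTensor b (isUnit_toAway (F := F) (coords b (x p) (i p)))
  obtain ⟨g, hg⟩ := exists_glue F hi (fun p => chartPoint F _ (i p) (hu p)) (by
    intro p q T _ _ α β hαβ
    rw [SpecMap_chartPoint, SpecMap_chartPoint]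
    refine chartPoint_eq_of_proportional _ _ fun c d => ?_
    rw [← coords_rTensor, ← coords_rTensor]
    refine (hN.extend (α.comp (toAway F _))).proportional _ ?_ _ ?_ c d
    · rw [extendSubmodule_comp]
      exact rTensor_mem_extendSubmodule _ (rTensor_mem_extendSubmodule _ (hx p))
    · rw [hαβ, extendSubmodule_comp]
      exact rTensor_mem_extendSubmodule _ (rTensor_mem_extendSubmodule _ (hx q)))
  refine ⟨g, hN.represents fun p =>
    ⟨_, hi p, _, rTensor_mem_extendSubmodule _ (hx p), i p, hu p, hg p⟩,
    spec_hom_ext F fun p => ⟨_, hi p, ?_⟩⟩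
  rw [← Category.assoc, hg p, chartPoint_projToSpec, ← Spec.map_comp, ← CommRingCat.ofHom_comp]
  rfl

end Represents

/-! ### Local homogeneous coordinates of points -/

section Chart

open MvPolynomial HomogeneousLocalization

attribute [local instance] MvPolynomial.gradedAlgebra

variable {F : Type u} [Field F] {n : ℕ} {R R' : Type u} [CommRing R] [Algebra F R]
  [CommRing R'] [Algebra F R']

lemma adjoin_range_X : Algebra.adjoin (coordGrading F n 0)
    (Set.range (X : Fin n → MvPolynomial (Fin n) F)) = ⊤ := by
  rw [eq_top_iff]
  rintro p -
  induction p using MvPolynomial.induction_on with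
  | C a =>
    exact Subalgebra.algebraMap_mem (Algebra.adjoin (coordGrading F n 0) _)
      (⟨C a, isHomogeneous_C _ a⟩ : coordGrading F n 0)
  | add p q hp hq => exact add_mem hp hq
  | mul_X p i hp => exact mul_mem hp (Algebra.subset_adjoin ⟨i, rfl⟩)

lemma iSup_basicOpen_X : ⨆ i, Proj.basicOpen (coordGrading F n) (X i) = ⊤ :=
  Proj.iSup_basicOpen_eq_top' _ X (fun i => ⟨1, X_mem_coordGrading i⟩) adjoin_range_X

/-- The points of projective space have homogeneous coordinates locally. -/
lemma exists_eq_chartPoint {g : Spec (.of R) ⟶ projScheme F n}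
    (hg : g ≫ projToSpec F n = Spec.map (CommRingCat.ofHom (algebraMap F R)))
    (p : PrimeSpectrum R) :
    ∃ f ∉ p.asIdeal, ∃ (v : Fin n → Localization.Away f) (i : Fin n) (hv : IsUnit (v i)),
      specMap (toAway F f) ≫ g = chartPoint F v i hv := by
  have h1 : g p ∈ ⨆ i, Proj.basicOpen (coordGrading F n) (X i) := by
    rw [iSup_basicOpen_X]; trivial
  obtain ⟨i, hi⟩ := TopologicalSpace.Opens.mem_iSup.1 h1
  obtain ⟨_, ⟨_, ⟨f, rfl⟩, rfl⟩, hpf, hfU⟩ :=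
    PrimeSpectrum.isBasis_basic_opens.exists_subset_of_mem_open
      (show p ∈ (g ⁻¹ᵁ Proj.basicOpen (coordGrading F n) (X i) : (Spec (.of R)).Opens).1 from hi)
      (g ⁻¹ᵁ Proj.basicOpen (coordGrading F n) (X i)).2
  have hrange : Set.range (specMap (toAway F f) ≫ g) ⊆
      Set.range (Proj.awayι (coordGrading F n) (X i) (X_mem_coordGrading i) one_pos) := by
    have h2 := congrArg (fun U : (projScheme F n).Opens => (U : Set (projScheme F n)))
      (Proj.opensRange_awayι (coordGrading F n) (X i) (X_mem_coordGrading i) one_pos)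
    rw [Scheme.Hom.coe_opensRange] at h2
    rw [h2]
    rintro _ ⟨q, rfl⟩
    have hq : specMap (toAway F f) q ∈ Set.range (PrimeSpectrum.comap
      (algebraMap R (Localization.Away f))) := ⟨q, rfl⟩
    rw [PrimeSpectrum.localization_away_comap_range (Localization.Away f) f] at hq
    exact hfU hq
  let φ := IsOpenImmersion.lift _ _ hrange
  have hφ : φ ≫ _ = _ := IsOpenImmersion.lift_fac _ _ hrange
  let χ := (Spec.preimage φ).hom
  have hχφ : Spec.map (CommRingCat.ofHom χ) = φ := Spec.map_preimage φ
  have hχ : ∀ c : F, χ (fromZeroRingHom (coordGrading F n) _ (algebraMap F _ c)) =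
      algebraMap F (Localization.Away f) c := by
    have h3 : φ ≫ Proj.awayι (coordGrading F n) (X i) (X_mem_coordGrading i) one_pos ≫
        projToSpec F n =
        Spec.map (CommRingCat.ofHom (algebraMap F (Localization.Away f))) := by
      rw [← Category.assoc, hφ, Category.assoc, hg, ← Spec.map_comp, ← CommRingCat.ofHom_comp]
      rfl
    rw [projToSpec, Proj.awayι_toSpecZero_assoc, ← hχφ, ← Spec.map_comp, ← Spec.map_comp,
      ← CommRingCat.ofHom_comp, ← CommRingCat.ofHom_comp] at h3
    have h4 := congrArg CommRingCat.Hom.hom (Spec.map_injective h3)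
    exact fun c => congrArg (fun ψ : F →+* Localization.Away f => ψ c) h4
  obtain ⟨v, hv, hχv⟩ := exists_eq_evalAway χ hχ
  refine ⟨f, hpf, v, i, by simp [hv], ?_⟩
  rw [chartPoint, ← hφ, ← hχφ, hχv]

lemma algebraMap_zero_surjective : Function.Surjective (algebraMap F (coordGrading F n 0)) := by
  rintro ⟨p, hp⟩
  have hp' : p.totalDegree = 0 := (totalDegree_zero_iff_isHomogeneous _).2 hp
  rw [totalDegree_eq_zero_iff_eq_C] at hp'
  exact ⟨coeff 0 p, Subtype.ext hp'.symm⟩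

instance : Algebra.FiniteType (coordGrading F n 0) (MvPolynomial (Fin n) F) :=
  have : IsScalarTower F (coordGrading F n 0) (MvPolynomial (Fin n) F) :=
    ⟨fun a x y => smul_mul_assoc a (x : MvPolynomial (Fin n) F) y⟩
  Algebra.FiniteType.of_restrictScalars_finiteType F _ _

lemma isVariety_projScheme : IsVariety (Over.mk (projToSpec F n)) := by
  have : IsClosedImmersion (Spec.map (CommRingCat.ofHom (algebraMap F (coordGrading F n 0)))) :=
    IsClosedImmersion.spec_of_surjective _ algebraMap_zero_surjective
  refine ⟨?_, ?_, ?_⟩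
  · exact inferInstanceAs (IsSeparated (Proj.toSpecZero (coordGrading F n) ≫
      Spec.map (CommRingCat.ofHom (algebraMap F (coordGrading F n 0)))))
  · exact inferInstanceAs (LocallyOfFiniteType (Proj.toSpecZero (coordGrading F n) ≫
      Spec.map (CommRingCat.ofHom (algebraMap F (coordGrading F n 0)))))
  · exact inferInstanceAs (QuasiCompact (Proj.toSpecZero (coordGrading F n) ≫
      Spec.map (CommRingCat.ofHom (algebraMap F (coordGrading F n 0)))))

end Chart

/-! ### The line represented by a point of projective space -/

section Represents

variable {F : Type u} [Field F] {n : ℕ} {R : Type u} [CommRing R] [Algebra F R]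
  {V : Type u} [AddCommGroup V] [Module F V] {b : Module.Basis (Fin n) F V}
  {g : Spec (.of R) ⟶ projScheme F n}

variable (b) in
lemma coords_add (x y : R ⊗[F] V) (k : Fin n) :
    coords b (x + y) k = coords b x k + coords b y k := by
  simp [coords]

variable (b) in
lemma coords_smul (c : R) (x : R ⊗[F] V) (k : Fin n) :
    coords b (c • x) k = c * coords b x k := by
  simp [coords]

lemma notMem_of_isUnit_toAway {f r : R} (hr : IsUnit (toAway F f r)) (p : PrimeSpectrum R)
    (hf : f ∉ p.asIdeal) : r ∉ p.asIdeal := by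
  have hp : p ∈ Set.range (PrimeSpectrum.comap (algebraMap R (Localization.Away f))) := by
    rw [PrimeSpectrum.localization_away_comap_range (Localization.Away f) f]
    exact hf
  obtain ⟨q, rfl⟩ := hp
  exact fun h => q.2.ne_top (Ideal.eq_top_of_isUnit_mem _ h hr)

/-- `Spec R` is quasi-compact: finitely many of the basic open sets given by `f` cover it. -/
lemma exists_finset_notMem {f : PrimeSpectrum R → R} (hf : ∀ p, f p ∉ p.asIdeal) :
    ∃ t : Finset (PrimeSpectrum R), ∀ p : PrimeSpectrum R, ∃ q ∈ t, f q ∉ p.asIdeal := by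
  have h1 : (1 : R) ∈ Ideal.span (Set.range f) := by
    rw [span_range_eq_top_of_notMem hf]; trivial
  obtain ⟨c, hc⟩ := Finsupp.mem_ideal_span_range_iff_exists_finsupp.1 h1
  refine ⟨c.support, fun p => ?_⟩
  by_contra! h
  refine p.2.ne_top ((Ideal.eq_top_iff_one _).2 ?_)
  rw [← hc]
  exact Ideal.sum_mem _ fun q hq => Ideal.mul_mem_left _ _ (h q hq)

/-- Every point of projective space represents a line: locally the line is spanned by a vector of
homogeneous coordinates. -/
lemma exists_isLine_represents
    (hg : g ≫ projToSpec F n = Spec.map (CommRingCat.ofHom (algebraMap F R))) :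
    ∃ N : Submodule R (R ⊗[F] V), IsLine (b.baseChange R) N ∧ Represents b g N := by
  choose f hf v i hv hgv using exists_eq_chartPoint hg
  -- on overlaps the local vectors of coordinates are proportional
  have overlap : ∀ p q (T : Type u) [CommRing T] [Algebra F T]
      (α : Localization.Away (f p) →ₐ[F] T) (β : Localization.Away (f q) →ₐ[F] T),
      α.comp (toAway F (f p)) = β.comp (toAway F (f q)) →
      ∀ k l, α (v p k) * β (v q l) = α (v p l) * β (v q k) := by
    intro p q T _ _ α β hαβ k l
    have h1 : specMap α ≫ chartPoint F (v p) (i p) (hv p) =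
        specMap β ≫ chartPoint F (v q) (i q) (hv q) := by
      rw [← hgv p, ← hgv q, ← Category.assoc, ← Category.assoc, ← specMap_comp, ← specMap_comp,
        hαβ]
    rw [SpecMap_chartPoint, SpecMap_chartPoint] at h1
    exact proportional_of_chartPoint_eq h1 k l
  obtain ⟨t, ht⟩ := exists_finset_notMem hf
  -- `N` consists of the elements that are proportional to `v q` on each set of a finite covering
  let N : Submodule R (R ⊗[F] V) :=
    { carrier := {x | ∀ q ∈ t, ∀ k l, toAway F (f q) (coords b x k) * v q l =
        toAway F (f q) (coords b x l) * v q k}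
      zero_mem' := by simp [coords]
      add_mem' := by
        intro x y hx hy q hq k l
        simp only [coords_add, map_add, add_mul, hx q hq k l, hy q hq k l]
      smul_mem' := by
        intro c x hx q hq k l
        simp only [coords_smul, map_mul, mul_assoc, hx q hq k l] }
  -- up to a power of `f p`, the vector `v p` lifts to an element of `N`
  have lift : ∀ p, ∃ x ∈ N, ∃ m : ℕ, ∀ k,
      toAway F (f p) (coords b x k) = toAway F (f p) (f p) ^ m * v p k := by
    intro p
    obtain ⟨⟨_, m, rfl⟩, hm⟩ :=
      IsLocalization.exist_integer_multiples_of_finite (Submonoid.powers (f p)) (v p)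
    choose c hc using hm
    simp only [Algebra.smul_def, map_pow] at hc
    -- the numerators `c` are proportional to `v q` only up to a power of `f p`; a common exponent
    -- exists because the covering is finite
    have hM : ∀ z : PrimeSpectrum R × Fin n × Fin n, ∃ M : ℕ,
        toAway F (f z.1) (f p) ^ M * (toAway F (f z.1) (c z.2.1) * v z.1 z.2.2) =
        toAway F (f z.1) (f p) ^ M * (toAway F (f z.1) (c z.2.2) * v z.1 z.2.1) := by
      rintro ⟨q, k, l⟩
      obtain ⟨α, hα⟩ := exists_comp_toAway (toAway F (f q)) (f p)
      let β := toAway F (toAway F (f q) (f p))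
      have h1 : ∀ k, β (toAway F (f q) (c k)) = α (toAway F (f p) (f p)) ^ m * α (v p k) := by
        intro k
        rw [← map_pow, ← map_mul]
        have : (algebraMap R (Localization.Away (f p))) (c k) =
          toAway F (f p) (f p) ^ m * v p k := hc k
        rw [← this]
        exact (congrArg (fun ψ : R →ₐ[F] _ => ψ (c k)) hα).symm
      have h2 : β (toAway F (f q) (c k) * v q l) = β (toAway F (f q) (c l) * v q k) := by
        rw [map_mul, map_mul, h1, h1, mul_assoc, mul_assoc, overlap p q _ α β hα k l]
      obtain ⟨⟨_, M, rfl⟩, h3⟩ := (IsLocalization.eq_iff_exists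
        (Submonoid.powers (toAway F (f q) (f p)))
        (Localization.Away (toAway F (f q) (f p)))).1 h2
      exact ⟨M, h3⟩
    choose M hM using hM
    let M₀ := (t ×ˢ (Finset.univ : Finset (Fin n × Fin n))).sup M
    let x := (b.baseChange R).equivFun.symm fun k => f p ^ M₀ * c k
    have hx : ∀ k, coords b x k = f p ^ M₀ * c k :=
      congrFun ((b.baseChange R).equivFun.apply_symm_apply _)
    refine ⟨x, ?_, M₀ + m, fun k => ?_⟩
    · intro q hq k l
      have hle : M (q, k, l) ≤ M₀ := Finset.le_sup (f := M) (by simp [hq])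
      obtain ⟨e, he⟩ := Nat.exists_eq_add_of_le hle
      simp only [hx, map_mul, map_pow, he, pow_add]
      have := hM (q, k, l)
      dsimp only at this
      linear_combination (toAway F (f q) (f p)) ^ e * this
    · have : (algebraMap R (Localization.Away (f p))) (c k) =
        toAway F (f p) (f p) ^ m * v p k := hc k
      have h4 : toAway F (f p) (c k) = toAway F (f p) (f p) ^ m * v p k := this
      rw [hx, map_mul, map_pow, h4, pow_add, mul_assoc]
  have lift_unit : ∀ p, ∃ x ∈ N, IsUnit (toAway F (f p) (coords b x (i p))) ∧
      ∀ k l, toAway F (f p) (coords b x k) * v p l = toAway F (f p) (coords b x l) * v p k := by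
    intro p
    obtain ⟨x, hx, m, hm⟩ := lift p
    refine ⟨x, hx, ?_, fun k l => ?_⟩
    · rw [hm]
      exact ((isUnit_toAway (f p)).pow m).mul (hv p)
    · rw [hm, hm]
      ring
  have hN : IsLine (b.baseChange R) N := by
    constructor
    · intro x hx y hy k l
      refine eq_of_forall_toAway F fun p => ?_
      obtain ⟨q, hq, hfq⟩ := ht p
      refine ⟨f q, hfq, ((hv q).mul (hv q)).mul_right_cancel ?_⟩
      rw [map_mul, map_mul]
      have hx' := hx q hq
      have hy' := hy q hq
      linear_combination toAway F (f q) (coords b y l) * v q (i q) * hx' k (i q) +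
        toAway F (f q) (coords b x (i q)) * v q k * hy' l (i q) -
        toAway F (f q) (coords b y k) * v q (i q) * hx' l (i q) -
        toAway F (f q) (coords b x (i q)) * v q l * hy' k (i q)
    · by_contra h
      obtain ⟨m, hm, hle⟩ := Ideal.exists_le_maximal _ h
      obtain ⟨q, hq, hfq⟩ := ht ⟨m, hm.isPrime⟩
      obtain ⟨x, hx, hu, -⟩ := lift_unit q
      exact notMem_of_isUnit_toAway hu _ hfq (hle (Ideal.subset_span ⟨x, hx, _, rfl⟩))
  refine ⟨N, hN, hN.represents fun p => ?_⟩
  obtain ⟨x, hx, hu, hxv⟩ := lift_unit p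
  refine ⟨f p, hf p, _, rTensor_mem_extendSubmodule _ hx, i p, isUnit_coords_rTensor b hu, ?_⟩
  rw [hgv p]
  refine chartPoint_eq_of_proportional _ _ fun k l => ?_
  rw [coords_rTensor, Function.comp_apply, Function.comp_apply]
  linear_combination -hxv k l

end Represents

/-! ### Closed subschemes from natural families of ideals -/

section ClosedSubscheme

open Opposite

/-- The restriction map from `A` to the sections on an open subset of `Spec A`. -/
noncomputable abbrev resTo {A : CommRingCat.{u}} (V : (Spec A).Opens) : A ⟶ Γ(Spec A, V) :=
  (Scheme.ΓSpecIso A).inv ≫ (Spec A).presheaf.map (homOfLE le_top).op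

lemma SpecMap_resTo {A : CommRingCat.{u}} {V : (Spec A).Opens} (hV : IsAffineOpen V) :
    Spec.map (resTo V) = hV.fromSpec := by
  rw [Spec.map_comp, ← hV.fromSpec_toSpecΓ, ← SpecMap_ΓSpecIso_hom, Category.assoc,
    ← Spec.map_comp, Iso.inv_hom_id, Spec.map_id, Category.comp_id]

lemma exists_affine_le_preimage {A : CommRingCat.{u}} {Y : Scheme.{u}} (g : Spec A ⟶ Y)
    (U : Y.Opens) (x : Spec A) (hx : g x ∈ U) :
    ∃ V : (Spec A).Opens, IsAffineOpen V ∧ x ∈ V ∧ V ≤ g ⁻¹ᵁ U := by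
  obtain ⟨_, ⟨V, hV, rfl⟩, hxV, hVU⟩ := (Spec A).isBasis_affineOpens.exists_subset_of_mem_open
    (show x ∈ (g ⁻¹ᵁ U : (Spec A).Opens).1 from hx) (g ⁻¹ᵁ U).2
  exact ⟨V, hV, hxV, hVU⟩

lemma section_eq_zero {X : Scheme.{u}} {U : X.Opens} (s : Γ(X, U))
    (h : ∀ x ∈ U, ∃ (V : X.Opens) (hV : V ≤ U), x ∈ V ∧
      (X.presheaf.map (homOfLE hV).op).hom s = 0) : s = 0 := by
  refine TopCat.Presheaf.IsSheaf.section_ext X.sheaf.2 fun x hx => ?_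
  obtain ⟨V, hV, hxV, hs⟩ := h x hx
  refine ⟨V, hV, hxV, ?_⟩
  exact Eq.trans hs (map_zero (X.presheaf.map (homOfLE hV).op).hom).symm

/-- A family of ideals on the affine points of a scheme `Y` that is compatible with base change
is the family of ideals of a closed subscheme, whose affine points are those where the ideal
vanishes. -/
theorem exists_closed_subscheme {Y : Scheme.{u}}
    (c : ∀ {A : CommRingCat.{u}} (_ : Spec A ⟶ Y), Ideal A)
    (hc : ∀ {A A' : CommRingCat.{u}} (ψ : A ⟶ A') (g : Spec A ⟶ Y),
      c (Spec.map ψ ≫ g) = (c g).map ψ.hom) :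
    ∃ (Z : Scheme.{u}) (ι : Z ⟶ Y), IsClosedImmersion ι ∧
      ∀ {A : CommRingCat.{u}} (g : Spec A ⟶ Y), (∃ δ, δ ≫ ι = g) ↔ c g = ⊥ := by
  let I : Y.IdealSheafData :=
    { ideal := fun U => c U.2.fromSpec
      map_ideal_basicOpen := fun U f => by
        rw [← hc]
        exact congrArg c (IsAffineOpen.map_fromSpec U.2 (Y.affineBasicOpen f).2 _) }
  -- On an affine open set `V` mapping to `U`, the ideals of `g` and of `U` generate the same ideal.
  have key : ∀ {A : CommRingCat.{u}} (g : Spec A ⟶ Y) (U : Y.affineOpens) (V : (Spec A).Opens)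
      (hV : IsAffineOpen V) (hVU : V ≤ g ⁻¹ᵁ U.1),
      (c g).map (resTo V).hom = (I.ideal U).map (g.appLE U.1 V hVU).hom := by
    intro A g U V hV hVU
    rw [← hc, SpecMap_resTo hV, ← U.2.SpecMap_appLE_fromSpec g hV hVU, hc]
  have hker : ∀ {A : CommRingCat.{u}} (g : Spec A ⟶ Y), I ≤ g.ker ↔ c g = ⊥ := by
    intro A g
    constructor
    · intro h
      rw [eq_bot_iff]
      intro x hx
      have h0 : (Scheme.ΓSpecIso A).inv x = 0 := by
        refine section_eq_zero _ fun y _ => ?_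
        obtain ⟨_, ⟨U, hU, rfl⟩, hyU, -⟩ := Y.isBasis_affineOpens.exists_subset_of_mem_open
          (Set.mem_univ (g y)) isOpen_univ
        obtain ⟨V, hV, hyV, hVU⟩ := exists_affine_le_preimage g U y hyU
        refine ⟨V, le_top, hyV, ?_⟩
        have h1 : (resTo V).hom x ∈ (c g).map (resTo V).hom := Ideal.mem_map_of_mem _ hx
        rw [key g ⟨U, hU⟩ V hV hVU] at h1
        have h2 : (I.ideal ⟨U, hU⟩).map (g.appLE U V hVU).hom = ⊥ := by
          rw [Ideal.map_eq_bot_iff_le_ker]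
          intro y hy
          have h3 : (g.app U).hom y = 0 := g.ideal_ker_le ⟨U, hU⟩ (h ⟨U, hU⟩ hy)
          rw [RingHom.mem_ker, Scheme.Hom.appLE, CommRingCat.hom_comp, RingHom.comp_apply, h3,
            map_zero]
        rw [h2] at h1
        exact h1
      have := congrArg (Scheme.ΓSpecIso A).hom h0
      simpa using this
    · intro h
      refine (Scheme.IdealSheafData.gci.gc _ _).1 fun U y hy => ?_
      refine section_eq_zero _ fun x hx => ?_
      obtain ⟨V, hV, hxV, hVU⟩ := exists_affine_le_preimage g U.1 x hx
      refine ⟨V, hVU, hxV, ?_⟩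
      have h1 : (g.appLE U.1 V hVU).hom y ∈ (I.ideal U).map (g.appLE U.1 V hVU).hom :=
        Ideal.mem_map_of_mem _ hy
      rw [← key g U V hV hVU, h, Ideal.map_bot] at h1
      exact h1
  refine ⟨I.subscheme, I.subschemeι, inferInstance, fun g => ?_⟩
  rw [← hker]
  constructor
  · rintro ⟨δ, rfl⟩
    have := Scheme.Hom.le_ker_comp δ I.subschemeι
    rwa [Scheme.IdealSheafData.ker_subschemeι] at this
  · intro h
    rw [← I.ker_subschemeι] at h
    exact ⟨IsClosedImmersion.lift I.subschemeι g h, IsClosedImmersion.lift_fac _ _ h⟩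

end ClosedSubscheme

/-! ### Functors of points and closed embeddings -/

section Functors

open Opposite

variable {F : Type u} [Field F]

/-- A monomorphism of functors whose image is cut out by a closed subscheme is a closed
embedding. -/
lemma isClosedEmbedding_of_closed_subscheme {X Y : CommAlgCat.{u} F ⥤ Type u} (s : X ⟶ Y)
    (hs : ∀ S, Function.Injective (s.app S)) {Y' : Over (Spec (.of F))} (hY' : IsVariety Y')
    (eY : points Y' ≅ Y) {Z : Scheme.{u}} (ι : Z ⟶ Y'.left) [IsClosedImmersion ι]
    (h : ∀ (S : CommAlgCat.{u} F) (γ : (algSpec (.of F)).obj (op S) ⟶ Y'),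
      (∃ δ, δ ≫ ι = γ.left) ↔ ∃ x, s.app S x = eY.hom.app S γ) :
    IsClosedEmbedding s := by
  let X' : Over (Spec (.of F)) := Over.mk (ι ≫ Y'.hom)
  let f : X' ⟶ Y' := Over.homMk ι
  have hex : ∀ (S : CommAlgCat.{u} F) (δ : (algSpec (.of F)).obj (op S) ⟶ X'),
      ∃ x, s.app S x = eY.hom.app S (δ ≫ f) := fun S δ => (h S _).1 ⟨δ.left, rfl⟩
  choose x hx using hex
  have hinj : ∀ S, Function.Injective (eY.hom.app S) := fun S =>
    ((eY.app S).toEquiv).injective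
  have hsurj : ∀ S, Function.Surjective (eY.hom.app S) := fun S =>
    ((eY.app S).toEquiv).surjective
  have hbij : ∀ S, Function.Bijective (x S) := by
    intro S
    constructor
    · intro δ δ' hδ
      have h1 : δ ≫ f = δ' ≫ f := hinj S (by
        have := congrArg (s.app S) hδ
        rwa [hx, hx] at this)
      have h2 : δ.left ≫ ι = δ'.left ≫ ι := congrArg CommaMorphism.left h1
      exact Over.OverMorphism.ext ((cancel_mono ι).1 h2)
    · intro y
      obtain ⟨γ, hγ⟩ := hsurj S (s.app S y)
      obtain ⟨δ, hδ⟩ := (h S γ).2 ⟨y, hγ.symm⟩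
      let δ' : (algSpec (.of F)).obj (op S) ⟶ X' := Over.homMk δ (by
        change δ ≫ ι ≫ Y'.hom = _
        rw [← Category.assoc, hδ]
        exact Over.w γ)
      refine ⟨δ', hs S ?_⟩
      rw [hx, ← hγ]
      congr 1
      exact Over.OverMorphism.ext hδ
  have hnat : ∀ {S T : CommAlgCat.{u} F} (φ : S ⟶ T) (δ : (algSpec (.of F)).obj (op S) ⟶ X'),
      x T ((points X').map φ δ) = X.map φ (x S δ) := by
    intro S T φ δ
    apply hs T
    have h1 : s.app T (X.map φ (x S δ)) = Y.map φ (s.app S (x S δ)) :=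
      NatTrans.naturality_apply s φ _
    have h2 : eY.hom.app T ((points Y').map φ (δ ≫ f)) = Y.map φ (eY.hom.app S (δ ≫ f)) :=
      NatTrans.naturality_apply eY.hom φ _
    rw [hx, h1, hx, ← h2]
    rfl
  let eX : points X' ≅ X := NatIso.ofComponents (fun S => (Equiv.ofBijective _ (hbij S)).toIso)
    (fun φ => ConcreteCategory.hom_ext _ _ fun δ => hnat φ δ)
  have := hY'.isSeparated
  have := hY'.locallyOfFiniteType
  have := hY'.quasiCompact
  refine ⟨X', Y', eX, eY, f, ⟨?_, ?_, ?_⟩, hY', inferInstanceAs (IsClosedImmersion ι), ?_⟩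
  · exact inferInstanceAs (IsSeparated (ι ≫ Y'.hom))
  · exact inferInstanceAs (LocallyOfFiniteType (ι ≫ Y'.hom))
  · exact inferInstanceAs (QuasiCompact (ι ≫ Y'.hom))
  · ext S δ
    exact hx S δ

variable {n : ℕ} {V : Type u} [AddCommGroup V] [Module F V] (b : Module.Basis (Fin n) F V)

/-- The functor of points of the scheme `ℙⁿ⁻¹` is the functor of lines in an `n`-dimensional
vector space, by means of `Represents`. -/
lemma exists_points_iso : ∃ e : points (Over.mk (projToSpec F n)) ≅ projectiveSpace F V,
    ∀ (S : CommAlgCat.{u} F) (γ : (algSpec (.of F)).obj (op S) ⟶ Over.mk (projToSpec F n)),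
      Represents b (R := S) γ.left (e.hom.app S γ).1 := by
  have hex : ∀ (S : CommAlgCat.{u} F)
      (γ : (algSpec (.of F)).obj (op S) ⟶ Over.mk (projToSpec F n)),
      ∃ N : (projectiveSpace F V).obj S, Represents b (R := S) γ.left N.1 := by
    intro S γ
    obtain ⟨N, hN, hγ⟩ := exists_isLine_represents (R := S) (b := b) (g := γ.left) (Over.w γ)
    exact ⟨⟨N, hN.isSummandOfRank⟩, hγ⟩
  choose N hN using hex
  have huniq : ∀ {S : CommAlgCat.{u} F} {γ : Spec (.of S) ⟶ projScheme F n}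
      {N N' : (projectiveSpace F V).obj S}, Represents b (R := S) γ N.1 →
      Represents b (R := S) γ N'.1 → N = N' := fun {S γ N N'} h h' =>
    Subtype.ext (Represents.eq_line (N.2.isLine _) (N'.2.isLine _) h h')
  have hbij : ∀ S, Function.Bijective (N S) := by
    intro S
    constructor
    · intro γ γ' h
      refine Over.OverMorphism.ext ?_
      have h1 := hN S γ
      rw [h] at h1
      exact Represents.unique ((N S γ').2.isLine _) h1 (hN S γ')
    · intro L
      obtain ⟨g, hg, hgF⟩ := (L.2.isLine (b.baseChange S)).exists_represents
      exact ⟨Over.homMk g hgF, huniq (hN S _) hg⟩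
  have hnat : ∀ {S T : CommAlgCat.{u} F} (φ : S ⟶ T)
      (γ : (algSpec (.of F)).obj (op S) ⟶ Over.mk (projToSpec F n)),
      N T ((points (Over.mk (projToSpec F n))).map φ γ) = (projectiveSpace F V).map φ (N S γ) := by
    intro S T φ γ
    exact huniq (hN T _) ((hN S γ).extend φ.hom)
  exact ⟨NatIso.ofComponents (fun S => (Equiv.ofBijective _ (hbij S)).toIso)
    (fun φ => ConcreteCategory.hom_ext _ _ fun γ => hnat φ γ), hN⟩

end Functors

/-! ### The Segre morphism is a closed embedding -/

section ClosedEmbedding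

open Opposite

variable {F B : Type u} [Field F] [Ring B] [Algebra F B] {n : ℕ} {τ : B →ₗ[F] B}
  (b : Module.Basis (Fin n) F (symElems τ))

/-- The ideal of the sandwich identity for the line represented by an affine point of projective
space. -/
noncomputable def pointIdeal {A : CommRingCat.{u}} (g : Spec A ⟶ projScheme F n) : Ideal A :=
  let : Algebra F A := (Spec.preimage (g ≫ projToSpec F n)).hom.toAlgebra
  sandwichIdeal (Module.Free.chooseBasis F B)
    ((exists_isLine_represents (R := A) (b := b) (g := g) (Spec.map_preimage _).symm).choose.map
      (symInclusion τ A))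

/-- The ideal may be computed with any `F`-algebra structure and any line that the point
represents. -/
lemma pointIdeal_eq {R : Type u} [CommRing R] [Algebra F R] {g : Spec (.of R) ⟶ projScheme F n}
    (hg : g ≫ projToSpec F n = Spec.map (CommRingCat.ofHom (algebraMap F R)))
    {N : Submodule R (R ⊗[F] symElems τ)} (hN : IsLine (b.baseChange R) N)
    (hgN : Represents b g N) :
    pointIdeal b g = sandwichIdeal (Module.Free.chooseBasis F B) (N.map (symInclusion τ R)) := by
  have halg : (Spec.preimage (g ≫ projToSpec F n)).hom.toAlgebra = ‹Algebra F R› := by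
    refine Algebra.algebra_ext _ _ fun r => ?_
    change (Spec.preimage (g ≫ projToSpec F n)).hom r = _
    rw [hg, Spec.preimage_map]
    rfl
  have h1 := (exists_isLine_represents (b := b) hg).choose_spec
  have h2 := Represents.eq_line h1.1 hN h1.2 hgN
  rw [← h2]
  unfold pointIdeal
  subst halg
  rfl

/-- The ideals are compatible with base change, as `exists_closed_subscheme` requires. -/
lemma pointIdeal_comp {A A' : CommRingCat.{u}} (ψ : A ⟶ A') (g : Spec A ⟶ projScheme F n) :
    pointIdeal b (Spec.map ψ ≫ g) = (pointIdeal b g).map ψ.hom := by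
  let : Algebra F A := (Spec.preimage (g ≫ projToSpec F n)).hom.toAlgebra
  let : Algebra F A' := (ψ.hom.comp (Spec.preimage (g ≫ projToSpec F n)).hom).toAlgebra
  let h : A →ₐ[F] A' := ⟨ψ.hom, fun _ => rfl⟩
  have hg : g ≫ projToSpec F n = Spec.map (CommRingCat.ofHom (algebraMap F A)) :=
    (Spec.map_preimage _).symm
  obtain ⟨N, hN, hgN⟩ := exists_isLine_represents (R := A) (b := b) (g := g) hg
  have hg' : (Spec.map ψ ≫ g) ≫ projToSpec F n =
      Spec.map (CommRingCat.ofHom (algebraMap F A')) := by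
    rw [Category.assoc, hg, ← Spec.map_comp]
    rfl
  have h1 := pointIdeal_eq (R := A) b hg hN hgN
  have h2 := pointIdeal_eq (R := A') b (g := Spec.map ψ ≫ g) hg' (hN.extend h) (hgN.extend h)
  rw [← extendSubmodule_map_symInclusion, sandwichIdeal_extend] at h2
  exact h2.trans (congrArg (Ideal.map ψ.hom) h1.symm)

/-- The Segre morphism identifies the Weil restriction of the Severi-Brauer variety with the closed
subvariety of projective space given by the sandwich identity. -/
theorem isClosedEmbedding_segreMorphism {K E : Type u} [CommRing K] [Algebra F K] [Algebra K B]
    [IsScalarTower F K B] [IsSemisimpleRing K] [IsAzumaya K B] [Module.Finite F B] [Field E]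
    [Algebra F E] (φ : Splitting τ E) :
    IsClosedEmbedding (segreMorphism (K := K) φ) := by
  let b := Module.finBasis F (symElems τ)
  obtain ⟨e, he⟩ := exists_points_iso b
  obtain ⟨Z, ι, hι, hZ⟩ := exists_closed_subscheme (fun {A} g => pointIdeal (A := A) b g)
    (pointIdeal_comp b)
  refine isClosedEmbedding_of_closed_subscheme (segreMorphism φ)
    (fun S => segreMorphism_app_injective (R := S) φ) isVariety_projScheme e ι fun S γ => ?_
  have h1 := pointIdeal_eq (R := S) b (Over.w γ) ((e.hom.app S γ).2.isLine _) (he S γ)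
  refine (hZ γ.left).trans ?_
  refine Iff.trans ?_ (mem_range_segreMorphism_iff (R := S) φ (e.hom.app S γ)).symm
  refine (Iff.of_eq (congrArg (· = ⊥) h1)).trans ?_
  exact sandwichIdeal_eq_bot_iff

end ClosedEmbedding

/-! ### Rational points -/

section RationalPoints

variable {F K B E : Type u} [Field F] [CommRing K] [Algebra F K] [Ring B] [Algebra K B]
  [Algebra F B] [IsScalarTower F K B] [IsSemisimpleRing K] [IsAzumaya K B] {τ : B →ₗ[F] B}
  [Field E] [Algebra F E]

/-- Right ideals of `B` of rank three over `K` are the `F`-rational points of `R_{K/F} SB(B)`; they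
are direct summands because `K` is semisimple. -/
lemma exists_idealOf_eq {I : Submodule K B} (hI : IsRightIdeal I)
    (hr : ∀ p : PrimeSpectrum K, Module.rankAtStalk (R := K) I p = 3) :
    ∃ N : (weilSB F K B).obj (.of F F), idealOf N =
      (I.restrictScalars F).map (Algebra.TensorProduct.lid F B).symm.toLinearMap := by
  have hsum : IsSummandOfRank 3 I := by
    have : IsNoetherianRing K := inferInstance
    have : IsNoetherian K B := inferInstance
    exact ⟨exists_isCompl I, inferInstance, Module.projective_of_isSemisimpleRing K I, hr⟩
  let e := (TensorProduct.lid K B).symm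
  let f : K →ₐ[K] K ⊗[F] F := Algebra.TensorProduct.includeLeft
  let g : K ⊗[F] F →ₐ[K] K := (Algebra.TensorProduct.rid F K K).toAlgHom
  have hI₀ : IsRightIdeal (I.map e.toLinearMap) := by
    rintro _ ⟨x, hx, rfl⟩ d
    obtain ⟨d, rfl⟩ := e.surjective d
    exact ⟨x * d, hI x hx d, by simp [e]⟩
  refine ⟨⟨extendSubmodule f (I.map e.toLinearMap), hI₀.extend f,
    (hsum.map_equiv e).extend f⟩, ?_⟩
  ext x
  obtain ⟨y, rfl⟩ := (Algebra.TensorProduct.lid F B).symm.surjective x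
  have h1 : toWeil F K B F ((Algebra.TensorProduct.lid F B).symm y) =
      f.toLinearMap.rTensor B (e y) := by
    simp [toWeil_tmul, f, e]
  have h2 : (Algebra.TensorProduct.lid F B).symm y ∈ (I.restrictScalars F).map
      (Algebra.TensorProduct.lid F B).symm.toLinearMap ↔ y ∈ I :=
    (Algebra.TensorProduct.lid F B).symm.injective.mem_set_image (s := (I : Set B))
  rw [h2]
  change toWeil F K B F ((Algebra.TensorProduct.lid F B).symm y) ∈ extendSubmodule f _ ↔ _
  rw [h1]
  constructor
  · intro h
    have h3 := rTensor_mem_extendSubmodule g h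
    rw [← extendSubmodule_comp] at h3
    have hgf : g.comp f = AlgHom.id K K := by ext
    have h4 : g.toLinearMap.rTensor B (f.toLinearMap.rTensor B (e y)) = e y := by
      simp [f, g, e]
    rw [hgf, extendSubmodule_id, h4] at h3
    exact (e.injective.mem_set_image (s := (I : Set B))).1 h3
  · exact fun h => rTensor_mem_extendSubmodule f ⟨y, h, rfl⟩

lemma IsSummandOfRank.finrank_eq {V : Type*} [AddCommGroup V] [Module F V] {m : ℕ}
    {N : Submodule F V} (hN : IsSummandOfRank m N) : Module.finrank F N = m := by
  have h := hN.rank_eq ⊥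
  rwa [Module.rankAtStalk_eq_finrank_of_free] at h

/-- `(I · τ I) ∩ Sym(B, τ)` is one-dimensional: this is `isSummandOfRank_lineSym` for `R = F`. -/
theorem finrank_symPart_eq_one (φ : Splitting τ E) {I : Submodule K B} (hI : IsRightIdeal I)
    (hr : ∀ p : PrimeSpectrum K, Module.rankAtStalk (R := K) I p = 3) :
    Module.finrank F (symPart τ (I.restrictScalars F)) = 1 := by
  obtain ⟨N, hN⟩ := exists_idealOf_eq (F := F) hI hr
  have h2 := (isSummandOfRank_lineSym φ N).finrank_eq
  have h3 := (Submodule.equivMapOfInjective (symInclusion τ F) symInclusion_injective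
    (lineSym τ (idealOf N))).finrank_eq
  rw [h2, map_lineSym, hN, ← map_symPart_algEquiv (σ := τ) _ (fun x => by simp)] at h3
  rw [h3]
  exact (LinearEquiv.finrank_map_eq (Algebra.TensorProduct.lid F B).symm.toLinearEquiv _).symm

end RationalPoints

end Segre

theorem lemma4p1 {F K B : Type u} [Field F] [CommRing K] [Algebra F K] [Algebra.Etale F K]
    (hK : Module.finrank F K = 2) [Ring B] [Algebra K B] [Algebra F B] [IsScalarTower F K B]
    [IsAzumaya K B] (hB : ∀ p : PrimeSpectrum K, Module.rankAtStalk (R := K) B p = 9)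
    (τ : B →ₗ[F] B) (hτ : IsUnitaryInvolution F K τ) :
    (∀ I : Submodule K B, IsRightIdeal I →
      (∀ p : PrimeSpectrum K, Module.rankAtStalk (R := K) I p = 3) →
        Module.finrank F (symPart τ (I.restrictScalars F)) = 1) ∧
    (∃ s : weilSB F K B ⟶ projectiveSpace F (symElems τ),
      (∀ (R : Type u) [CommRing R] [Algebra F R] (I : (weilSB F K B).obj (.of F R)),
        lineOf (s.app (.of F R) I) = symPart (τ.baseChange R) (idealOf I)) ∧
      IsClosedEmbedding s ∧
      (∀ (R : Type u) [CommRing R] [Algebra F R] (φ : Splitting τ R),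
        ∃ e : (weilSB F K B).obj (.of F R) ≃ P2 R × P2 R, ∀ I : (weilSB F K B).obj (.of F R),
          (idealOf I).map φ.equiv.toLinearMap = splitIdeal (e I).1.1 (e I).2.1 ∧
          (lineOf (s.app (.of F R) I)).map φ.equiv.toLinearMap =
            (segreProduct (e I).1.1 (e I).2.1).map symEmbedding)) ∧
    (∀ (E : Type u) [Field E] [IsAlgClosed E] [Algebra F E], Nonempty (Splitting τ E)) := by
  have : Module.Finite F K := Module.finite_of_finrank_pos (by rw [hK]; exact two_pos)
  have : IsSemisimpleRing K := isSemisimpleRing_of_etale F K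
  have : Module.Finite F B := Module.Finite.trans K B
  obtain ⟨φ⟩ := nonempty_splitting hK hB hτ (AlgebraicClosure F)
  exact ⟨fun I hI hr => finrank_symPart_eq_one φ hI hr, ⟨segreMorphism φ,
    fun R _ _ I => lineOf_segreMorphism φ I, isClosedEmbedding_segreMorphism φ,
    fun R _ _ φR => exists_equiv_of_splitting φ φR⟩,
    fun E _ _ _ => nonempty_splitting hK hB hτ E⟩
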